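/- Let $0<\rho\le 1$, $-1<\mu,\upsilon\le -\tfrac12$, and let $s\ge 1$ be an integer. For a function $f$ on $J=[0,1]$ put $g(t):=f\bigl(1-(1-t)^{1/\rho}\bigr)$, and for real $a,b$ let $$\|v\|_{0,\varkappa^{a,b,1}}=\Bigl(\int_0^1 (1-t)^{a}t^{b}\,v(t)^2\,dt\Bigr)^{1/2}.$$ Assume that $g\in B^{s,1}_{\mu,\upsilon}(J)$, i.e. that the weak derivatives $\partial_t^k g$ exist on $(0,1)$ and satisfy $\|\partial_t^k g\|_{0,\varkappa^{\mu+k,\upsilon+k,1}}<\infty$ for $0\le k\le s$. Then $f$ has a representative that is continuous on $[0,1]$, again denoted by $f$. For $N\ge 1$ let $t_0,\dots,t_N\in(0,1)$ be the zeros of $t\mapsto \mathcal P_{N+1}^{\mu,\upsilon}\bigl(1-2(1-t)^\rho\bigr)$, where $\mathcal P_n^{\mu,\upsilon}$ is the classical Jacobi polynomial of degree $n$ on $[-1,1]$, and let $$J_{N,\rho}^{\mu,\upsilon}f(t)=\sum_{j=0}^N f(t_j)\prod_{i\ne j}\frac{(1-t)^\rho-(1-t_i)^\rho}{(1-t_j)^\rho-(1-t_i)^\rho}.$$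 Then there is a constant $c>0$, independent of $N$ and $f$ (it may depend on $\mu,\upsilon,\rho,s$), such that for all $N\ge1$ with $s\le N+1$, $$\|f-J_{N,\rho}^{\mu,\upsilon}f\|_\infty=\max_{t\in[0,1]}\bigl|f(t)-J_{N,\rho}^{\mu,\upsilon}f(t)\bigr|\le c\,N^{1/2-s}\,\bigl\|\partial_t^s\bigl\{f\bigl(1-(1-t)^{1/\rho}\bigr)\bigr\}\bigr\|_{0,\varkappa^{\mu+s,\upsilon+s,1}}.$$ -/

import Mathlib

open MeasureTheory Set
open scoped ContDiff ENNReal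

noncomputable section

namespace BackwardJacobi

/-- The classical Jacobi polynomial of degree `n` with parameters `a` (at `x = 1`) and `b`
(at `x = -1`), normalised as usual by `P_n(1) = (a + 1)_n / n!`:
`P_n(x) = (1 / n!) ∑_k (n choose k) (n + a + b + 1)_k (a + k + 1)_{n - k} ((x - 1) / 2)^k`,
where `(y)_k` is the rising factorial. -/
def jacobi (a b : ℝ) (n : ℕ) : Polynomial ℝ :=
  ∑ k ∈ Finset.range (n + 1),
    Polynomial.C ((n.factorial : ℝ)⁻¹ * (n.choose k : ℝ)
        * (ascPochhammer ℝ k).eval ((n : ℝ) + a + b + 1)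
        * (ascPochhammer ℝ (n - k)).eval (a + (k : ℝ) + 1))
      * (Polynomial.C (1 / 2 : ℝ) * (Polynomial.X - 1)) ^ k

/-- The fractional backward orthogonal function
`P_r^{mu, ups, rho}(t) = P_r^{mu, ups}(1 - 2 (1 - t)^rho)`. -/
def backwardFun (mu ups rho : ℝ) (r : ℕ) (t : ℝ) : ℝ :=
  (jacobi mu ups r).eval (1 - 2 * (1 - t) ^ rho)

/-- The Gauss nodes: the zeros in `(0, 1)` of the backward function of degree `N + 1`. -/
def nodes (mu ups rho : ℝ) (N : ℕ) : Set ℝ :=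
  {t | t ∈ Ioo (0 : ℝ) 1 ∧ backwardFun mu ups rho (N + 1) t = 0}

/-- For the parameters in use the set of nodes is finite, so that the finite sums and products
over it in the definitions below are genuine ones. -/
theorem nodes_finite {mu ups rho : ℝ} (hmu : -1 < mu) (hrho : 0 < rho) (N : ℕ) :
    (nodes mu ups rho N).Finite := by
  have hval : (jacobi mu ups (N + 1)).eval 1 ≠ 0 := by
    have h : (jacobi mu ups (N + 1)).eval 1
        = (((N + 1).factorial : ℝ))⁻¹ * (ascPochhammer ℝ (N + 1)).eval (mu + 1) := by
      unfold jacobi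
      rw [Polynomial.eval_finsetSum, Finset.sum_eq_single 0]
      · simp
      · intro k _ hk
        simp [hk]
      · simp
    rw [h]
    have hp := ascPochhammer_pos (S := ℝ) (N + 1) (mu + 1) (by linarith)
    positivity
  have hne : jacobi mu ups (N + 1) ≠ 0 := by
    intro h
    simp [h] at hval
  have hinj : InjOn (fun t : ℝ => 1 - 2 * (1 - t) ^ rho) (Ioo 0 1) := by
    intro x hx y hy hxy
    have h1 : (1 - x) ^ rho = (1 - y) ^ rho := by
      simp only at hxy
      linarith
    have h2 := (Real.rpow_left_inj (by linarith [hx.2]) (by linarith [hy.2]) hrho.ne').1 h1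
    linarith
  refine Set.Finite.of_finite_image (f := fun t : ℝ => 1 - 2 * (1 - t) ^ rho) ?_
    (hinj.mono fun t ht => ht.1)
  refine (jacobi mu ups (N + 1)).roots.toFinset.finite_toSet.subset ?_
  rintro _ ⟨t, ht, rfl⟩
  have h0 : (jacobi mu ups (N + 1)).eval (1 - 2 * (1 - t) ^ rho) = 0 := ht.2
  simpa [hne] using h0

/-- The Lagrange basis function at the node `p`:
`∏_{q ≠ p} ((1 - t)^rho - (1 - q)^rho) / ((1 - p)^rho - (1 - q)^rho)`, `q` running over the
other nodes. -/
def lagrangeFun (mu ups rho : ℝ) (N : ℕ) (p t : ℝ) : ℝ :=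
  ∏ᶠ q ∈ nodes mu ups rho N \ {p},
    ((1 - t) ^ rho - (1 - q) ^ rho) / ((1 - p) ^ rho - (1 - q) ^ rho)

/-- The Jacobi-Gauss interpolation operator `J_{N, rho}^{mu, ups}`. -/
def interp (mu ups rho : ℝ) (N : ℕ) (f : ℝ → ℝ) (t : ℝ) : ℝ :=
  ∑ᶠ p ∈ nodes mu ups rho N, f p * lagrangeFun mu ups rho N p t

/-- The weight `rho (1 - t)^{rho (mu + 1) - 1} (1 - (1 - t)^rho)^ups`;
for `rho = 1` it is `(1 - t)^mu t^ups`. -/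
def weight (mu ups rho t : ℝ) : ℝ :=
  rho * (1 - t) ^ (rho * (mu + 1) - 1) * (1 - (1 - t) ^ rho) ^ ups

/-- The measure `weight(t) dt` on `(0, 1)`. -/
def weightMeasure (mu ups rho : ℝ) : Measure ℝ :=
  (volume.restrict (Ioo (0 : ℝ) 1)).withDensity fun t => ENNReal.ofReal (weight mu ups rho t)

/-- The norm of the weighted space `L^2` over `(0, 1)`. -/
def weightNorm (mu ups rho : ℝ) (v : ℝ → ℝ) : ℝ :=
  (eLpNorm v 2 (weightMeasure mu ups rho)).toReal

/-- `v` is a weak (distributional) derivative of order `k` of `g` on the interval `(0, 1)`. -/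
def IsWeakDeriv (k : ℕ) (g v : ℝ → ℝ) : Prop :=
  LocallyIntegrableOn g (Ioo 0 1) ∧ LocallyIntegrableOn v (Ioo 0 1) ∧
    ∀ φ : ℝ → ℝ, ContDiff ℝ ∞ φ → HasCompactSupport φ → tsupport φ ⊆ Ioo 0 1 →
      ∫ t in Ioo (0 : ℝ) 1, g t * iteratedDeriv k φ t
        = (-1) ^ k * ∫ t in Ioo (0 : ℝ) 1, v t * φ t

/-- Membership in the Jacobi-weighted Sobolev space `B^{s, 1}_{mu, ups}(0, 1)`: for `0 ≤ k ≤ s`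
the weak derivative of order `k` exists and lies in `L^2` with weight
`(1 - t)^{mu + k} t^{ups + k}`. -/
def MemB (mu ups : ℝ) (s : ℕ) (g : ℝ → ℝ) : Prop :=
  ∀ k ≤ s, ∃ v, IsWeakDeriv k g v ∧ MemLp v 2 (weightMeasure (mu + k) (ups + k) 1)

/-- The transformed function `t ↦ f (1 - (1 - t)^{1 / rho})`. -/
def pullback (rho : ℝ) (f : ℝ → ℝ) (t : ℝ) : ℝ :=
  f (1 - (1 - t) ^ (1 / rho))

/-- `F` is a representative of the class of `f` that is continuous on `[0, 1]`. -/
def IsContRep (f F : ℝ → ℝ) : Prop :=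
  ContinuousOn F (Icc 0 1) ∧ F =ᵐ[volume.restrict (Icc (0 : ℝ) 1)] f

end BackwardJacobi

end

/-! The substitution `x = 1 - (1 - t)^rho` (`powMap`) carries the nodes, the interpolant and `f` to
ordinary polynomial interpolation of `g = pullback rho f` at the zeros of a Jacobi polynomial on
`(0, 1)` (`interp_eq_eval`). It remains to bound `g - I`, with `I` the interpolant of degree at most
`N`. Write `‖·‖_k` for the L² norm with weight `(1 - x)^(a + k) x^(b + k)`, and let `p` be the
orthogonal projection of `g` on polynomials of degree at most `N`.

Projection. Jacobi polynomials diagonalise a second order operator whose eigenvalues grow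
quadratically. This gives a Bernstein inequality for polynomials and, by density, a Poincaré
inequality for functions orthogonal to low degrees (`eigenvalue_mul_integral_sq_le`). The
derivatives of `g - p` stay orthogonal to low degrees for the shifted weights, so iterating Poincaré
bounds `‖(g - p)'‖_1` by `N^(1 - s) ‖g^(s)‖_s` (`integral_projection_error_le`).

Stability. Let `e = g - p` and `q = I - p`. Gauss quadrature is exact for `q ^ 2`, and `q = e` at
the nodes while `e` is orthogonal to `q`; thus `‖q‖_0 ^ 2` is exactly the quadrature error of `e q`,
an integral of `(e q)'` against the Peano kernel. The Chebyshev-Markov-Stieltjes inequalities bound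
that kernel by the weight's mass between neighbouring zeros, and a Picone identity bounds the
spacing of the zeros. With Cauchy-Schwarz, Bernstein and Poincaré, `N ‖q‖_0` is at most a constant
times `‖e'‖_1` (`interpolant_stable`); Bernstein then bounds `‖(g - I)'‖_1` by `‖e'‖_1`.

From L² to sup. `g - I` vanishes at every node, so integrating its derivative over a single gap
gains a factor `N^(-1/2)` (`sq_le_of_eq_zero_on_nodes`). Together these give `N^(1/2 - s)`. The
hypothesis `a, b ≤ -1/2` gives the required sign to the exponents `a + 1/2`, `b + 1/2` in both gap
estimates. -/

namespace BackwardJacobi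

open Polynomial Filter Topology

/-! ### The Jacobi measure on the unit interval -/

/-- The measure `(1 - x) ^ a * x ^ b dx` on `(0, 1)`. -/
noncomputable abbrev jacobiMeasure (a b : ℝ) : Measure ℝ := weightMeasure a b 1

/-- The Jacobi weight `(1 - x) ^ a * x ^ b`. -/
noncomputable def jacobiWeight (a b x : ℝ) : ℝ := (1 - x) ^ a * x ^ b

theorem measurable_jacobiWeight (a b : ℝ) : Measurable (jacobiWeight a b) := by
  unfold jacobiWeight
  fun_prop

theorem jacobiWeight_pos (a b : ℝ) {x : ℝ} (hx : x ∈ Ioo (0 : ℝ) 1) : 0 < jacobiWeight a b x :=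
  mul_pos (Real.rpow_pos_of_pos (by linarith [hx.2]) _) (Real.rpow_pos_of_pos hx.1 _)

theorem jacobiWeight_add_one (a b : ℝ) {x : ℝ} (hx : x ∈ Ioo (0 : ℝ) 1) :
    jacobiWeight (a + 1) (b + 1) x = x * (1 - x) * jacobiWeight a b x := by
  unfold jacobiWeight
  rw [Real.rpow_add_one (by linarith [hx.2]), Real.rpow_add_one hx.1.ne']
  ring

theorem jacobiMeasure_eq (a b : ℝ) :
    jacobiMeasure a b = (volume.restrict (Ioo (0 : ℝ) 1)).withDensity
      fun t => ((jacobiWeight a b t).toNNReal : ℝ≥0∞) := by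
  unfold jacobiMeasure weightMeasure
  congr 1
  ext t
  simp [weight, jacobiWeight, ENNReal.ofReal]

theorem integral_jacobiMeasure (a b : ℝ) (f : ℝ → ℝ) :
    ∫ x, f x ∂(jacobiMeasure a b) = ∫ x in Ioo (0 : ℝ) 1, jacobiWeight a b x * f x := by
  rw [jacobiMeasure_eq, integral_withDensity_eq_integral_smul
    (measurable_jacobiWeight a b).real_toNNReal]
  refine setIntegral_congr_fun measurableSet_Ioo fun x hx => ?_
  simp [NNReal.smul_def, (jacobiWeight_pos a b hx).le]

theorem integrable_jacobiMeasure_iff (a b : ℝ) (f : ℝ → ℝ) :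
    Integrable f (jacobiMeasure a b) ↔
      IntegrableOn (fun x => jacobiWeight a b x * f x) (Ioo (0 : ℝ) 1) := by
  rw [jacobiMeasure_eq, integrable_withDensity_iff_integrable_smul
    (measurable_jacobiWeight a b).real_toNNReal]
  refine integrableOn_congr_fun (fun x hx => ?_) measurableSet_Ioo
  simp [NNReal.smul_def, (jacobiWeight_pos a b hx).le]

theorem ae_jacobiMeasure_iff (a b : ℝ) {p : ℝ → Prop} :
    (∀ᵐ x ∂(jacobiMeasure a b), p x) ↔ ∀ᵐ x ∂(volume.restrict (Ioo (0 : ℝ) 1)), p x := by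
  rw [jacobiMeasure_eq, ae_withDensity_iff (measurable_jacobiWeight a b).real_toNNReal.coe_nnreal_ennreal]
  constructor
  · intro h
    filter_upwards [h, ae_restrict_mem measurableSet_Ioo] with x hx hx'
    exact hx (by simpa using jacobiWeight_pos a b hx')
  · intro h
    filter_upwards [h] with x hx _ using hx

theorem ae_jacobiMeasure_mem (a b : ℝ) : ∀ᵐ x ∂(jacobiMeasure a b), x ∈ Ioo (0 : ℝ) 1 :=
  (ae_jacobiMeasure_iff a b).2 (ae_restrict_mem measurableSet_Ioo)

theorem aestronglyMeasurable_jacobiMeasure_iff (a b : ℝ) {f : ℝ → ℝ} :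
    AEStronglyMeasurable f (jacobiMeasure a b) ↔
      AEStronglyMeasurable f (volume.restrict (Ioo (0 : ℝ) 1)) := by
  constructor
  · intro h
    exact h.mono_ac fun s hs => by
      have : ∀ᵐ x ∂(jacobiMeasure a b), x ∉ s := measure_eq_zero_iff_ae_notMem.1 hs
      exact measure_eq_zero_iff_ae_notMem.2 ((ae_jacobiMeasure_iff a b).1 this)
  · intro h
    exact h.mono_ac fun s hs => by
      have : ∀ᵐ x ∂(volume.restrict (Ioo (0 : ℝ) 1)), x ∉ s := measure_eq_zero_iff_ae_notMem.1 hs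
      exact measure_eq_zero_iff_ae_notMem.2 ((ae_jacobiMeasure_iff a b).2 this)

/-! ### Integrals of the weight over subintervals -/

/-- On the left half of `(c, d)` the distance to `1` is still at least half of `1 - c`, because `d ≤
1`; the power `p` then costs a factor `2^(-p) ≤ 2`. -/
theorem rpow_one_sub_le_of_le_midpoint {p c x d : ℝ} (hp : -1 < p) (hp0 : p ≤ 0) (hd : d ≤ 1)
    (hcd : c < d) (hx : x < d) (hxm : x ≤ (c + d) / 2) : (1 - x) ^ p ≤ 2 * (1 - c) ^ p := by
  have h1 : 0 < 1 - x := by linarith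
  have h2 : (1 - c) / 2 ≤ 1 - x := by linarith
  have h3 : 0 < 1 - c := by linarith
  calc (1 - x) ^ p ≤ ((1 - c) / 2) ^ p := Real.rpow_le_rpow_of_nonpos (by linarith) h2 hp0
    _ = (1 - c) ^ p * (2 : ℝ) ^ (-p) := by
        rw [Real.div_rpow h3.le (by norm_num), Real.rpow_neg (by norm_num), div_eq_mul_inv]
    _ ≤ (1 - c) ^ p * 2 := by
        gcongr
        calc (2 : ℝ) ^ (-p) ≤ 2 ^ (1 : ℝ) :=
              Real.rpow_le_rpow_of_exponent_le (by norm_num) (by linarith)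
          _ = 2 := by simp
    _ = _ := by ring

/-- On each half of the interval one of the two factors is essentially constant. The right half
follows from the left one by the reflection `x ↦ 1 - x`. -/
theorem jacobiWeight_le_split {p q c d x : ℝ} (hp : -1 < p) (hp0 : p ≤ 0) (hq : -1 < q)
    (hq0 : q ≤ 0) (hc : 0 ≤ c) (hd : d ≤ 1) (hx : x ∈ Ioo c d) :
    jacobiWeight p q x ≤ 2 * (1 - c) ^ p * x ^ q + 2 * d ^ q * (1 - x) ^ p := by
  have h1 : 0 < 1 - x := by linarith [hx.2]
  have h0 : 0 < x := by linarith [hx.1]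
  have h2 := Real.rpow_pos_of_pos h1 p
  have h3 := Real.rpow_pos_of_pos h0 q
  have h4 := Real.rpow_pos_of_pos (show 0 < 1 - c by linarith [hx.1, hx.2]) p
  have h5 := Real.rpow_pos_of_pos (show 0 < d by linarith [hx.1, hx.2]) q
  unfold jacobiWeight
  rcases le_total x ((c + d) / 2) with h | h
  · have := rpow_one_sub_le_of_le_midpoint hp hp0 hd (hx.1.trans hx.2) hx.2 h
    have h6 := mul_le_mul_of_nonneg_right this h3.le
    have : 0 ≤ 2 * d ^ q * (1 - x) ^ p := by positivity
    linarith
  · have := rpow_one_sub_le_of_le_midpoint (x := 1 - x) (c := 1 - d) (d := 1 - c) hq hq0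
      (by linarith) (by linarith [hx.1, hx.2]) (by linarith [hx.1]) (by linarith)
    simp only [sub_sub_cancel] at this
    have h6 := mul_le_mul_of_nonneg_left this h2.le
    have : 0 ≤ 2 * (1 - c) ^ p * x ^ q := by positivity
    linarith

theorem intervalIntegrable_one_sub_rpow {p : ℝ} (hp : -1 < p) (c d : ℝ) :
    IntervalIntegrable (fun x : ℝ => (1 - x) ^ p) volume c d := by
  have := (intervalIntegral.intervalIntegrable_rpow' (a := 1 - c) (b := 1 - d) hp).comp_sub_left 1
  simpa using this

theorem integral_rpow_le {q c d : ℝ} (hq : -1 < q) (hq0 : q ≤ 0) (hc : 0 ≤ c) (hcd : c < d) :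
    ∫ x in c..d, x ^ q ≤ (d - c) * d ^ q / (q + 1) := by
  rw [integral_rpow (Or.inl hq)]
  have hq1 : 0 < q + 1 := by linarith
  gcongr
  have hd : 0 < d := by linarith
  rw [Real.rpow_add_one hd.ne']
  rcases hc.eq_or_lt with rfl | hc'
  · rw [Real.zero_rpow hq1.ne']
    linarith
  · rw [Real.rpow_add_one hc'.ne']
    have : d ^ q ≤ c ^ q := Real.rpow_le_rpow_of_nonpos hc' hcd.le hq0
    nlinarith

theorem integral_one_sub_rpow_le {p c d : ℝ} (hp : -1 < p) (hp0 : p ≤ 0) (hd : d ≤ 1)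
    (hcd : c < d) :
    ∫ x in c..d, (1 - x) ^ p ≤ (d - c) * (1 - c) ^ p / (p + 1) := by
  have h := integral_rpow_le (c := 1 - d) (d := 1 - c) hp hp0 (by linarith) (by linarith)
  rw [intervalIntegral.integral_comp_sub_left (fun y => y ^ p) 1]
  convert h using 2
  ring

theorem integrableOn_jacobiWeight_of_nonpos {p q : ℝ} (hp : -1 < p) (hp0 : p ≤ 0)
    (hq : -1 < q) (hq0 : q ≤ 0) : IntegrableOn (jacobiWeight p q) (Ioo 0 1) := by
  have h1 : IntegrableOn (fun x : ℝ => x ^ q) (Ioo 0 1) :=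
    ((intervalIntegrable_iff_integrableOn_Ioo_of_le zero_le_one).1
      (intervalIntegral.intervalIntegrable_rpow' hq))
  have h2 : IntegrableOn (fun x : ℝ => (1 - x) ^ p) (Ioo 0 1) :=
    ((intervalIntegrable_iff_integrableOn_Ioo_of_le zero_le_one).1
      (intervalIntegrable_one_sub_rpow hp 0 1))
  refine Integrable.mono' ((h1.const_mul (2 * (1 - 0) ^ p)).add (h2.const_mul (2 * 1 ^ q)))
    (measurable_jacobiWeight p q).aestronglyMeasurable ?_
  filter_upwards [ae_restrict_mem measurableSet_Ioo] with x hx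
  rw [Real.norm_of_nonneg (jacobiWeight_pos p q hx).le]
  exact jacobiWeight_le_split hp hp0 hq hq0 le_rfl le_rfl hx

theorem integrableOn_jacobiWeight {a b : ℝ} (ha : -1 < a) (hb : -1 < b) :
    IntegrableOn (jacobiWeight a b) (Ioo 0 1) := by
  refine Integrable.mono' (integrableOn_jacobiWeight_of_nonpos (p := min a 0) (q := min b 0)
    (by simp [ha]) (by simp) (by simp [hb]) (by simp))
    (measurable_jacobiWeight a b).aestronglyMeasurable ?_
  filter_upwards [ae_restrict_mem measurableSet_Ioo] with x hx
  rw [Real.norm_of_nonneg (jacobiWeight_pos a b hx).le]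
  unfold jacobiWeight
  have h1 : 0 < 1 - x := by linarith [hx.2]
  have h0 : 0 < x := by linarith [hx.1]
  have := Real.rpow_pos_of_pos h1 (min a 0)
  have := Real.rpow_pos_of_pos h0 b
  gcongr ?_ * ?_
  · exact Real.rpow_le_rpow_of_exponent_ge h1 (by linarith) (min_le_left _ _)
  · exact Real.rpow_le_rpow_of_exponent_ge h0 hx.2.le (min_le_left _ _)

/-- For exponents in `(-1, 0]` the mean of each power over `(c, d)` is at most a constant times its
smallest value, taken at `d` for `x ^ q` and at `c` for `(1 - x) ^ p`. The bound remains valid when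
the interval reaches `0` or `1`. -/
theorem integral_jacobiWeight_le {p q c d : ℝ} (hp : -1 < p) (hp0 : p ≤ 0) (hq : -1 < q)
    (hq0 : q ≤ 0) (hc : 0 ≤ c) (hd : d ≤ 1) (hcd : c < d) :
    ∫ x in Ioo c d, jacobiWeight p q x
      ≤ (2 / (p + 1) + 2 / (q + 1)) * ((d - c) * (d ^ q * (1 - c) ^ p)) := by
  have h1 : IntegrableOn (fun x : ℝ => x ^ q) (Ioo c d) :=
    ((intervalIntegrable_iff_integrableOn_Ioo_of_le hcd.le).1
      (intervalIntegral.intervalIntegrable_rpow' hq))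
  have h2 : IntegrableOn (fun x : ℝ => (1 - x) ^ p) (Ioo c d) :=
    ((intervalIntegrable_iff_integrableOn_Ioo_of_le hcd.le).1
      (intervalIntegrable_one_sub_rpow hp c d))
  have h4 := Real.rpow_pos_of_pos (show 0 < 1 - c by linarith) p
  have h5 := Real.rpow_pos_of_pos (show 0 < d by linarith) q
  calc ∫ x in Ioo c d, jacobiWeight p q x
      ≤ ∫ x in Ioo c d, (2 * (1 - c) ^ p * x ^ q + 2 * d ^ q * (1 - x) ^ p) := by
        refine setIntegral_mono_on ((integrableOn_jacobiWeight hp hq).mono_set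
          (Ioo_subset_Ioo hc hd)) ((h1.const_mul _).add (h2.const_mul _)) measurableSet_Ioo
          fun x hx => jacobiWeight_le_split hp hp0 hq hq0 hc hd hx
    _ = 2 * (1 - c) ^ p * (∫ x in c..d, x ^ q) + 2 * d ^ q * ∫ x in c..d, (1 - x) ^ p := by
        rw [integral_add (h1.const_mul _) (h2.const_mul _), integral_const_mul,
          integral_const_mul, intervalIntegral.integral_of_le hcd.le,
          intervalIntegral.integral_of_le hcd.le, integral_Ioc_eq_integral_Ioo,
          integral_Ioc_eq_integral_Ioo]
    _ ≤ 2 * (1 - c) ^ p * ((d - c) * d ^ q / (q + 1))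
          + 2 * d ^ q * ((d - c) * (1 - c) ^ p / (p + 1)) := by
        gcongr
        · exact integral_rpow_le hq hq0 hc hcd
        · exact integral_one_sub_rpow_le hp hp0 hd hcd
    _ = _ := by ring

/-! ### Square integrable functions -/

theorem isFiniteMeasure_jacobiMeasure {a b : ℝ} (ha : -1 < a) (hb : -1 < b) :
    IsFiniteMeasure (jacobiMeasure a b) := by
  have h : Integrable (fun _ : ℝ => (1 : ℝ)) (jacobiMeasure a b) := by
    rw [integrable_jacobiMeasure_iff]
    simpa using integrableOn_jacobiWeight ha hb
  exact (integrable_const_iff_isFiniteMeasure one_ne_zero).1 h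

theorem memLp_eval {a b : ℝ} (ha : -1 < a) (hb : -1 < b) (p : ℝ[X]) :
    MemLp (fun x => p.eval x) 2 (jacobiMeasure a b) := by
  have := isFiniteMeasure_jacobiMeasure ha hb
  obtain ⟨C, hC⟩ := isCompact_Icc.exists_bound_of_continuousOn (s := Icc (0 : ℝ) 1)
    (f := fun x => p.eval x) p.continuous.continuousOn
  refine MemLp.of_bound p.continuous.aestronglyMeasurable C ?_
  filter_upwards [ae_jacobiMeasure_mem a b] with x hx
  exact hC x (Ioo_subset_Icc_self hx)

theorem MemLp.integrable_jacobi {a b : ℝ} (ha : -1 < a) (hb : -1 < b) {f : ℝ → ℝ}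
    (hf : MemLp f 2 (jacobiMeasure a b)) : Integrable f (jacobiMeasure a b) := by
  have := isFiniteMeasure_jacobiMeasure ha hb
  exact hf.integrable (by norm_num)

theorem weightNorm_sq {a b : ℝ} {f : ℝ → ℝ} (hf : MemLp f 2 (jacobiMeasure a b)) :
    weightNorm a b 1 f ^ 2 = ∫ x, f x ^ 2 ∂(jacobiMeasure a b) := by
  unfold weightNorm
  rw [hf.eLpNorm_eq_integral_rpow_norm (by norm_num) (by norm_num),
    ENNReal.toReal_ofReal (by positivity)]
  simp only [ENNReal.toReal_ofNat, Real.rpow_ofNat, Real.norm_eq_abs, sq_abs]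
  have h : 0 ≤ ∫ x, f x ^ 2 ∂(jacobiMeasure a b) := integral_nonneg fun x => sq_nonneg _
  rw [← Real.rpow_natCast, ← Real.rpow_mul h]
  norm_num

/-- The Cauchy-Schwarz inequality. -/
theorem sq_integral_mul_le {X : Type*} [MeasurableSpace X] {m : Measure X} {f g : X → ℝ}
    (hf : MemLp f 2 m) (hg : MemLp g 2 m) :
    (∫ x, f x * g x ∂m) ^ 2 ≤ (∫ x, f x ^ 2 ∂m) * ∫ x, g x ^ 2 ∂m := by
  have h1 := hf.integrable_sq
  have h2 := hg.integrable_sq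
  have h3 : Integrable (fun x => f x * g x) m := hf.integrable_mul hg
  have key : ∀ t : ℝ, 0 ≤ (∫ x, g x ^ 2 ∂m) * (t * t) + (2 * ∫ x, f x * g x ∂m) * t
      + ∫ x, f x ^ 2 ∂m := by
    intro t
    have : 0 ≤ ∫ x, (f x + t * g x) ^ 2 ∂m := integral_nonneg fun x => sq_nonneg _
    have h4 : ∫ x, (f x + t * g x) ^ 2 ∂m
        = ∫ x, ((t * t) * g x ^ 2 + (2 * t) * (f x * g x) + f x ^ 2) ∂m := by
      congr 1
      ext x
      ring
    have h5 : Integrable (fun x => t * t * g x ^ 2 + 2 * t * (f x * g x)) m :=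
      (h2.const_mul _).add (h3.const_mul _)
    rw [h4, integral_add h5 h1, integral_add (h2.const_mul _) (h3.const_mul _), integral_const_mul,
      integral_const_mul] at this
    linarith
  have := discrim_le_zero key
  unfold discrim at this
  nlinarith

/-! ### Absolutely continuous functions -/

/-- `H` is absolutely continuous on `[0, 1]` with integrable derivative `h`. -/
structure HasL1Deriv (H h : ℝ → ℝ) : Prop where
  integrable : IntervalIntegrable h volume 0 1
  eq_integral : ∀ x ∈ Icc (0 : ℝ) 1, H x = H 0 + ∫ t in 0..x, h t

theorem HasL1Deriv.continuousOn {H h : ℝ → ℝ} (hH : HasL1Deriv H h) :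
    ContinuousOn H (Icc 0 1) := by
  have h1 := intervalIntegral.continuousOn_primitive_interval' hH.integrable left_mem_uIcc
  rw [uIcc_of_le zero_le_one] at h1
  exact (continuousOn_const.add h1).congr hH.eq_integral

theorem hasL1Deriv_of_contDiff {φ : ℝ → ℝ} (hφ : ContDiff ℝ 1 φ) : HasL1Deriv φ (deriv φ) := by
  have hc : Continuous (deriv φ) := hφ.continuous_deriv le_rfl
  refine ⟨hc.intervalIntegrable _ _, fun x _ => ?_⟩
  rw [intervalIntegral.integral_deriv_eq_sub
    (fun y _ => (hφ.differentiable one_ne_zero).differentiableAt) (hc.intervalIntegrable _ _)]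
  ring

theorem hasL1Deriv_eval (p : ℝ[X]) :
    HasL1Deriv (fun x => p.eval x) (fun x => (derivative p).eval x) := by
  have h := hasL1Deriv_of_contDiff (φ := fun x => p.eval x)
    (by simpa [Polynomial.aeval_def, Polynomial.eval₂_eq_eval_map] using p.contDiff_aeval (𝕜 := ℝ) 1)
  have : deriv (fun x => p.eval x) = fun x => (derivative p).eval x := by
    ext x
    exact p.deriv
  rwa [this] at h

theorem HasL1Deriv.sub {H h K k : ℝ → ℝ} (hH : HasL1Deriv H h) (hK : HasL1Deriv K k) :
    HasL1Deriv (fun x => H x - K x) (fun x => h x - k x) := by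
  refine ⟨hH.integrable.sub hK.integrable, fun x hx => ?_⟩
  have hsub : uIcc 0 x ⊆ uIcc (0 : ℝ) 1 := by
    rw [uIcc_of_le hx.1, uIcc_of_le zero_le_one]
    exact Icc_subset_Icc_right hx.2
  rw [intervalIntegral.integral_sub (hH.integrable.mono_set hsub) (hK.integrable.mono_set hsub),
    hH.eq_integral x hx, hK.eq_integral x hx]
  ring

theorem HasL1Deriv.mul {H h K k : ℝ → ℝ} (hH : HasL1Deriv H h) (hK : HasL1Deriv K k) :
    HasL1Deriv (fun x => H x * K x) (fun x => h x * K x + H x * k x) := by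
  have hHc := hH.continuousOn
  have hKc := hK.continuousOn
  rw [← uIcc_of_le (zero_le_one' ℝ)] at hHc hKc
  refine ⟨(hH.integrable.mul_continuousOn hKc).add (hK.integrable.continuousOn_mul hHc),
    fun x hx => ?_⟩
  -- `H` and `K` are known only on `[0, 1]`, so the two-sided derivatives are taken of the
  -- primitives, which are defined on the whole line.
  set H' : ℝ → ℝ := fun x => H 0 + ∫ t in 0..x, h t with hH'
  set K' : ℝ → ℝ := fun x => K 0 + ∫ t in 0..x, k t with hK'
  have hsub : uIcc 0 x ⊆ uIcc (0 : ℝ) 1 := by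
    rw [uIcc_of_le hx.1, uIcc_of_le zero_le_one]
    exact Icc_subset_Icc_right hx.2
  have acc : ∀ c : ℝ, AbsolutelyContinuousOnInterval (fun _ : ℝ => c) 0 1 := fun c =>
    (contDiffOn_const (c := c)).absolutelyContinuousOnInterval
  have acH : AbsolutelyContinuousOnInterval H' 0 1 := (acc _).add
    (hH.integrable.absolutelyContinuousOnInterval_intervalIntegral left_mem_uIcc)
  have acK : AbsolutelyContinuousOnInterval K' 0 1 := (acc _).add
    (hK.integrable.absolutelyContinuousOnInterval_intervalIntegral left_mem_uIcc)
  have h1 := AbsolutelyContinuousOnInterval.integral_deriv_mul_eq_sub (acH.mono hsub)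
    (acK.mono hsub)
  have h0 : (0 : ℝ) ∈ Icc (0 : ℝ) 1 := ⟨le_rfl, zero_le_one⟩
  have e1 : ∀ y ∈ Icc (0 : ℝ) 1, H' y = H y := fun y hy => (hH.eq_integral y hy).symm
  have e2 : ∀ y ∈ Icc (0 : ℝ) 1, K' y = K y := fun y hy => (hK.eq_integral y hy).symm
  rw [e1 x hx, e2 x hx, e1 0 h0, e2 0 h0] at h1
  have h2 : ∫ y in 0..x, deriv H' y * K' y + H' y * deriv K' y
      = ∫ y in 0..x, h y * K y + H y * k y := by
    apply intervalIntegral.integral_congr_ae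
    filter_upwards [hH.integrable.ae_hasDerivAt_integral, hK.integrable.ae_hasDerivAt_integral]
      with y hy1 hy2 hy
    have hy' : y ∈ uIcc (0 : ℝ) 1 := hsub (uIoc_subset_uIcc hy)
    have hy'' : y ∈ Icc (0 : ℝ) 1 := by rwa [uIcc_of_le zero_le_one] at hy'
    have d1 : HasDerivAt H' (h y) y := (hy1 hy' 0 left_mem_uIcc).const_add _
    have d2 : HasDerivAt K' (k y) y := (hy2 hy' 0 left_mem_uIcc).const_add _
    rw [d1.deriv, d2.deriv, e1 y hy'', e2 y hy'']
  rw [h2] at h1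
  rw [h1]
  ring

/-! ### Weak derivatives -/

theorem integrable_mul_of_tsupport_subset {g φ : ℝ → ℝ} (hg : LocallyIntegrableOn g (Ioo 0 1))
    (hφ : Continuous φ) (hc : HasCompactSupport φ) (hs : tsupport φ ⊆ Ioo 0 1) :
    Integrable (fun x => g x * φ x) := by
  have h1 : IntegrableOn g (tsupport φ) := hg.integrableOn_compact_subset hs hc
  have h2 : IntegrableOn (fun x => g x * φ x) (tsupport φ) :=
    h1.mul_continuousOn hφ.continuousOn hc
  rwa [integrableOn_iff_integrable_of_support_subset] at h2
  exact (Function.support_mul_subset_right g φ).trans (subset_tsupport φ)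

theorem tsupport_iteratedDeriv_subset (k : ℕ) (φ : ℝ → ℝ) :
    tsupport (iteratedDeriv k φ) ⊆ tsupport φ := by
  induction k with
  | zero => simp
  | succ k ih =>
    rw [iteratedDeriv_succ]
    exact tsupport_deriv_subset.trans ih

/-- The fundamental lemma of the calculus of variations. It allows any weak derivative to be
exchanged for the one constructed later. -/
theorem IsWeakDeriv.ae_eq {k : ℕ} {g v v' : ℝ → ℝ} (h : IsWeakDeriv k g v)
    (h' : IsWeakDeriv k g v') : v =ᵐ[volume.restrict (Ioo 0 1)] v' := by
  have hloc : LocallyIntegrableOn (fun x => v x - v' x) (Ioo 0 1) := h.2.1.sub h'.2.1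
  have := isOpen_Ioo.ae_eq_zero_of_integral_contDiff_smul_eq_zero hloc (μ := volume) ?_
  · rw [Filter.EventuallyEq, ae_restrict_iff' measurableSet_Ioo]
    filter_upwards [this] with x hx hx'
    linarith [hx hx']
  · intro φ hφ hc hs
    have e1 := h.2.2 φ hφ hc hs
    have e2 := h'.2.2 φ hφ hc hs
    have e3 : ∫ t in Ioo (0 : ℝ) 1, v t * φ t = ∫ t in Ioo (0 : ℝ) 1, v' t * φ t := by
      have : ((-1 : ℝ) ^ k) ≠ 0 := pow_ne_zero _ (by norm_num)
      exact mul_left_cancel₀ this (e1.symm.trans e2)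
    have e4 : ∫ x, φ x • (v x - v' x) = ∫ x in Ioo (0 : ℝ) 1, (v x * φ x - v' x * φ x) := by
      rw [setIntegral_eq_integral_of_forall_compl_eq_zero]
      · congr 1
        ext x
        simp only [smul_eq_mul]
        ring
      · intro x hx
        have : φ x = 0 := image_eq_zero_of_notMem_tsupport fun h => hx (hs h)
        simp [this]
    rw [e4, integral_sub, e3, sub_self]
    · exact (integrable_mul_of_tsupport_subset h.2.1 hφ.continuous hc hs).integrableOn
    · exact (integrable_mul_of_tsupport_subset h'.2.1 hφ.continuous hc hs).integrableOn

theorem isWeakDeriv_zero {g : ℝ → ℝ} (hg : LocallyIntegrableOn g (Ioo 0 1)) :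
    IsWeakDeriv 0 g g := ⟨hg, hg, fun φ _ _ _ => by simp⟩

/-- The identity of order `k` is tested against `φ'`. -/
theorem IsWeakDeriv.of_succ {k : ℕ} {g v v' : ℝ → ℝ} (h : IsWeakDeriv k g v)
    (h' : IsWeakDeriv (k + 1) g v') : IsWeakDeriv 1 v v' := by
  refine ⟨h.2.1, h'.2.1, fun φ hφ hc hs => ?_⟩
  have h1 := h.2.2 (deriv φ) (contDiff_infty_iff_deriv.1 hφ).2 hc.deriv (tsupport_deriv_subset.trans hs)
  rw [← iteratedDeriv_succ', h'.2.2 φ hφ hc hs, pow_succ, mul_assoc] at h1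
  have : ((-1 : ℝ) ^ k) ≠ 0 := pow_ne_zero _ (by norm_num)
  rw [iteratedDeriv_one, ← mul_left_cancel₀ this h1, pow_one]

theorem IsWeakDeriv.sub {k : ℕ} {g v g' v' : ℝ → ℝ} (h : IsWeakDeriv k g v)
    (h' : IsWeakDeriv k g' v') :
    IsWeakDeriv k (fun x => g x - g' x) (fun x => v x - v' x) := by
  refine ⟨h.1.sub h'.1, h.2.1.sub h'.2.1, fun φ hφ hc hs => ?_⟩
  have hck : Continuous (iteratedDeriv k φ) := hφ.continuous_iteratedDeriv k (by exact_mod_cast le_top)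
  have hcs : HasCompactSupport (iteratedDeriv k φ) :=
    hc.mono' ((subset_tsupport _).trans (tsupport_iteratedDeriv_subset k φ))
  have hss := (tsupport_iteratedDeriv_subset k φ).trans hs
  simp only [sub_mul]
  rw [integral_sub (integrable_mul_of_tsupport_subset h.1 hck hcs hss).integrableOn
    (integrable_mul_of_tsupport_subset h'.1 hck hcs hss).integrableOn,
    integral_sub (integrable_mul_of_tsupport_subset h.2.1 hφ.continuous hc hs).integrableOn
    (integrable_mul_of_tsupport_subset h'.2.1 hφ.continuous hc hs).integrableOn,
    h.2.2 φ hφ hc hs, h'.2.2 φ hφ hc hs]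
  ring

theorem HasL1Deriv.isWeakDeriv {H h : ℝ → ℝ} (hH : HasL1Deriv H h) : IsWeakDeriv 1 H h := by
  have hi : IntegrableOn h (Ioo 0 1) :=
    (intervalIntegrable_iff_integrableOn_Ioo_of_le zero_le_one).1 hH.integrable
  refine ⟨(hH.continuousOn.mono Ioo_subset_Icc_self).locallyIntegrableOn measurableSet_Ioo,
    hi.locallyIntegrableOn, fun φ hφ hc hs => ?_⟩
  have hφ1 : HasL1Deriv φ (deriv φ) := hasL1Deriv_of_contDiff (hφ.of_le (by exact_mod_cast le_top))
  have e := (hH.mul hφ1).eq_integral 1 ⟨zero_le_one, le_rfl⟩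
  have h0 : φ 0 = 0 := image_eq_zero_of_notMem_tsupport fun h => by simpa using hs h
  have h1 : φ 1 = 0 := image_eq_zero_of_notMem_tsupport fun h => by simpa using hs h
  have hHc := hH.continuousOn
  rw [← uIcc_of_le (zero_le_one' ℝ)] at hHc
  rw [h0, h1, mul_zero, mul_zero, zero_add, intervalIntegral.integral_add
    (hH.integrable.mul_continuousOn hφ.continuous.continuousOn)
    (hφ1.integrable.continuousOn_mul hHc)] at e
  simp only [iteratedDeriv_one]
  rw [← integral_Ioc_eq_integral_Ioo, ← integral_Ioc_eq_integral_Ioo,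
    ← intervalIntegral.integral_of_le zero_le_one, ← intervalIntegral.integral_of_le zero_le_one]
  linarith

theorem isWeakDeriv_eval (p : ℝ[X]) :
    IsWeakDeriv 1 (fun x => p.eval x) (fun x => (derivative p).eval x) :=
  (hasL1Deriv_eval p).isWeakDeriv

/-! ### Integration by parts against the Jacobi weight -/

/-- The first order operator with
`d/dx ((1 - x) ^ (a + 1) * x ^ (b + 1) * p) = (1 - x) ^ a * x ^ b * adjDeriv a b p`. -/
noncomputable def adjDeriv (a b : ℝ) (p : ℝ[X]) : ℝ[X] :=
  X * (1 - X) * derivative p + (C (b + 1) * (1 - X) - C (a + 1) * X) * p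

theorem hasDerivAt_jacobiWeight_mul (a b : ℝ) (p : ℝ[X]) {x : ℝ} (hx : x ∈ Ioo (0 : ℝ) 1) :
    HasDerivAt (fun y => jacobiWeight (a + 1) (b + 1) y * p.eval y)
      (jacobiWeight a b x * (adjDeriv a b p).eval x) x := by
  have h1 : 0 < 1 - x := by linarith [hx.2]
  have d1 : HasDerivAt (fun y : ℝ => (1 - y) ^ (a + 1)) (-1 * (a + 1) * (1 - x) ^ (a + 1 - 1)) x :=
    ((hasDerivAt_id x).const_sub 1).rpow_const (Or.inl h1.ne')
  have d2 : HasDerivAt (fun y : ℝ => y ^ (b + 1)) (1 * (b + 1) * x ^ (b + 1 - 1)) x :=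
    (hasDerivAt_id x).rpow_const (Or.inl hx.1.ne')
  have d3 := (d1.mul d2).mul (p.hasDerivAt x)
  refine d3.congr_deriv ?_
  simp only [Pi.mul_apply, add_sub_cancel_right, jacobiWeight, adjDeriv, eval_add, eval_mul, eval_sub, eval_one,
    eval_X, eval_C]
  rw [Real.rpow_add_one h1.ne', Real.rpow_add_one hx.1.ne']
  ring

/-- Smooth cutoff functions exhausting the unit interval. -/
noncomputable def cutoff (n : ℕ) (x : ℝ) : ℝ := Real.smoothTransition (n * (x * (1 - x)) - 1)

theorem contDiff_cutoff (n : ℕ) : ContDiff ℝ ∞ (cutoff n) :=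
  Real.smoothTransition.contDiff.comp (by fun_prop)

theorem cutoff_eq_zero {n : ℕ} {x : ℝ} (h : n * (x * (1 - x)) ≤ 1) : cutoff n x = 0 :=
  Real.smoothTransition.zero_of_nonpos (by linarith)

theorem abs_cutoff_le_one (n : ℕ) (x : ℝ) : |cutoff n x| ≤ 1 := by
  unfold cutoff
  rw [abs_of_nonneg (Real.smoothTransition.nonneg _)]
  exact Real.smoothTransition.le_one _

theorem eventually_cutoff_eq_one {x : ℝ} (hx : x ∈ Ioo (0 : ℝ) 1) :
    ∀ᶠ n : ℕ in atTop, cutoff n =ᶠ[𝓝 x] fun _ => 1 := by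
  have hpos : 0 < x * (1 - x) := mul_pos hx.1 (by linarith [hx.2])
  filter_upwards [tendsto_natCast_atTop_atTop.eventually_gt_atTop (2 / (x * (1 - x)))] with n hn
  have h2 : 2 < n * (x * (1 - x)) := by
    rwa [div_lt_iff₀ hpos] at hn
  have : ∀ᶠ y : ℝ in 𝓝 x, 2 < n * (y * (1 - y)) :=
    (show Continuous fun y : ℝ => (n : ℝ) * (y * (1 - y)) by fun_prop).continuousAt.eventually
      (lt_mem_nhds h2)
  filter_upwards [this] with y hy
  exact Real.smoothTransition.one_of_one_le (by linarith)

theorem closure_support_cutoff_mul_subset (n : ℕ) (u : ℝ → ℝ) :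
    tsupport (fun x => cutoff n x * u x) ⊆ {x | 1 ≤ n * (x * (1 - x))} := by
  refine closure_minimal (fun x hx => ?_) (isClosed_le (by fun_prop) (by fun_prop))
  by_contra h
  exact hx (by simp [cutoff_eq_zero (le_of_not_ge h)])

theorem setOf_one_le_subset (n : ℕ) : {x : ℝ | 1 ≤ n * (x * (1 - x))} ⊆ Ioo 0 1 := by
  intro x hx
  have h : 0 < n * (x * (1 - x)) := lt_of_lt_of_le one_pos hx
  have h2 : 0 < x * (1 - x) := pos_of_mul_pos_right h (Nat.cast_nonneg n)
  constructor <;> nlinarith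

/-- The derivative has size `n`, but it lives where `n x (1 - x)` is between `1` and `2`. The factor
`x (1 - x)`, the ratio of two consecutive weights, compensates exactly. -/
theorem exists_bound_deriv_cutoff : ∃ B : ℝ, 0 ≤ B ∧ ∀ (n : ℕ), ∀ x ∈ Ioo (0 : ℝ) 1,
    |deriv (cutoff n) x * (x * (1 - x))| ≤ B := by
  have hs : ContDiff ℝ 1 Real.smoothTransition := Real.smoothTransition.contDiff
  have hc : Continuous (deriv Real.smoothTransition) := hs.continuous_deriv le_rfl
  obtain ⟨M, hM⟩ := isCompact_Icc.exists_bound_of_continuousOn (s := Icc (0 : ℝ) 1) hc.continuousOn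
  have hM0 : 0 ≤ M := (norm_nonneg _).trans (hM 0 ⟨le_rfl, zero_le_one⟩)
  refine ⟨2 * M, by positivity, fun n x hx => ?_⟩
  have hpos : 0 < x * (1 - x) := mul_pos hx.1 (by linarith [hx.2])
  have hd : HasDerivAt (cutoff n)
      (deriv Real.smoothTransition (n * (x * (1 - x)) - 1) * (n * (1 - 2 * x))) x := by
    have d1 : HasDerivAt (fun y : ℝ => n * (y * (1 - y)) - 1) (n * (1 - 2 * x)) x := by
      have := (((hasDerivAt_id x).mul ((hasDerivAt_id x).const_sub 1)).const_mul (n : ℝ)).sub_const 1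
      refine this.congr_deriv ?_
      simp only [id]
      ring
    exact (hs.differentiable one_ne_zero _).hasDerivAt.comp x d1
  rw [hd.deriv]
  set z := n * (x * (1 - x)) - 1 with hz
  by_cases hzI : z ∈ Icc (0 : ℝ) 1
  · have h1 := hM z hzI
    rw [Real.norm_eq_abs] at h1
    have h2 : |1 - 2 * x| ≤ 1 := by
      rw [abs_le]
      constructor <;> linarith [hx.1, hx.2]
    have h3 : |n * (x * (1 - x))| ≤ 2 := by
      rw [abs_of_nonneg (by positivity)]
      linarith [hzI.2]
    calc |deriv Real.smoothTransition z * (n * (1 - 2 * x)) * (x * (1 - x))|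
        = |deriv Real.smoothTransition z| * |1 - 2 * x| * |n * (x * (1 - x))| := by
          rw [← abs_mul, ← abs_mul]
          congr 1
          ring
      _ ≤ M * 1 * 2 := by gcongr
      _ = 2 * M := by ring
  · have : deriv Real.smoothTransition z = 0 := by
      rcases lt_or_gt_of_ne (show z ≠ 0 by rintro h; exact hzI (by simp [h])) with h | h
      · have : Real.smoothTransition =ᶠ[𝓝 z] fun _ => 0 := by
          filter_upwards [gt_mem_nhds h] with y hy
          exact Real.smoothTransition.zero_of_nonpos hy.le
        rw [this.deriv_eq]
        simp
      · have h1 : 1 < z := by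
          by_contra h'
          exact hzI ⟨h.le, le_of_not_gt h'⟩
        have : Real.smoothTransition =ᶠ[𝓝 z] fun _ => 1 := by
          filter_upwards [lt_mem_nhds h1] with y hy
          exact Real.smoothTransition.one_of_one_le hy.le
        rw [this.deriv_eq]
        simp
    rw [this]
    simpa using hM0

theorem contDiff_cutoff_mul (a b : ℝ) (p : ℝ[X]) (n : ℕ) :
    ContDiff ℝ ∞ (fun x => cutoff n x * (jacobiWeight a b x * p.eval x)) := by
  rw [contDiff_iff_contDiffAt]
  intro x
  by_cases hx : x ∈ Ioo (0 : ℝ) 1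
  · have h1 : ContDiffAt ℝ ∞ (fun y : ℝ => (1 - y) ^ a) x :=
      (contDiffAt_const.sub contDiffAt_id).rpow_const_of_ne (by
        simp only [id]
        linarith [hx.2])
    have h2 : ContDiffAt ℝ ∞ (fun y : ℝ => y ^ b) x :=
      contDiffAt_id.rpow_const_of_ne hx.1.ne'
    have h3 : ContDiff ℝ ∞ (fun y => p.eval y) := by
      simpa [Polynomial.aeval_def, Polynomial.eval₂_eq_eval_map] using p.contDiff_aeval (𝕜 := ℝ) ∞
    exact (contDiff_cutoff n).contDiffAt.mul ((h1.mul h2).mul h3.contDiffAt)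
  · have : (fun x => cutoff n x * (jacobiWeight a b x * p.eval x)) =ᶠ[𝓝 x] fun _ => 0 := by
      refine notMem_tsupport_iff_eventuallyEq.1 fun h => hx ?_
      exact setOf_one_le_subset n (closure_support_cutoff_mul_subset n _ h)
    exact contDiffAt_const.congr_of_eventuallyEq this

/-- Integration by parts for weak derivatives against the Jacobi weight; there are no boundary
terms. -/
theorem integral_weakDeriv_mul {a b : ℝ} (ha : -1 < a) (hb : -1 < b) {h h1 : ℝ → ℝ}
    (hh : MemLp h 2 (jacobiMeasure a b)) (hh1 : MemLp h1 2 (jacobiMeasure (a + 1) (b + 1)))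
    (hw : IsWeakDeriv 1 h h1) (p : ℝ[X]) :
    ∫ x, h1 x * p.eval x ∂(jacobiMeasure (a + 1) (b + 1))
      = -∫ x, h x * (adjDeriv a b p).eval x ∂(jacobiMeasure a b) := by
  obtain ⟨B, hB0, hB⟩ := exists_bound_deriv_cutoff
  have hm : AEStronglyMeasurable h (volume.restrict (Ioo (0 : ℝ) 1)) :=
    (aestronglyMeasurable_jacobiMeasure_iff _ _).1 hh.1
  have hm1 : AEStronglyMeasurable h1 (volume.restrict (Ioo (0 : ℝ) 1)) :=
    (aestronglyMeasurable_jacobiMeasure_iff _ _).1 hh1.1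
  have i1 := (integrable_jacobiMeasure_iff _ _ _).1
    (hh1.integrable_mul (memLp_eval (by linarith) (by linarith) p))
  have i2 := (integrable_jacobiMeasure_iff _ _ _).1 (hh.integrable_mul (memLp_eval ha hb p))
  have i3 := (integrable_jacobiMeasure_iff _ _ _).1
    (hh.integrable_mul (memLp_eval ha hb (adjDeriv a b p)))
  simp only [Pi.mul_apply] at i1 i2 i3
  rw [integral_jacobiMeasure, integral_jacobiMeasure]
  -- The weight times `p` is not a test function; its truncations are, and the identity passes to
  -- the limit in `n`.
  set φ : ℕ → ℝ → ℝ := fun n x => cutoff n x * (jacobiWeight (a + 1) (b + 1) x * p.eval x) with hφ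
  have hderiv : ∀ n : ℕ, ∀ x ∈ Ioo (0 : ℝ) 1, deriv (φ n) x
      = deriv (cutoff n) x * (jacobiWeight (a + 1) (b + 1) x * p.eval x)
        + cutoff n x * (jacobiWeight a b x * (adjDeriv a b p).eval x) := fun n x hx =>
    ((((contDiff_cutoff n).differentiable (by simp)) x).hasDerivAt.mul
      (hasDerivAt_jacobiWeight_mul a b p hx)).deriv
  have hφd : ∀ n, ContDiff ℝ ∞ (φ n) := fun n => contDiff_cutoff_mul _ _ p n
  have t1 : Tendsto (fun n : ℕ => ∫ x in Ioo (0 : ℝ) 1, h1 x * φ n x) atTop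
      (𝓝 (∫ x in Ioo (0 : ℝ) 1, jacobiWeight (a + 1) (b + 1) x * (h1 x * p.eval x))) := by
    refine tendsto_integral_of_dominated_convergence _
      (fun n => hm1.mul (hφd n).continuous.aestronglyMeasurable) i1.norm (fun n => ?_) ?_
    · refine Eventually.of_forall fun x => ?_
      have : h1 x * φ n x
          = cutoff n x * (jacobiWeight (a + 1) (b + 1) x * (h1 x * p.eval x)) := by
        simp only [hφ]
        ring
      rw [this, norm_mul]
      exact mul_le_of_le_one_left (norm_nonneg _) (abs_cutoff_le_one n x)
    · filter_upwards [ae_restrict_mem measurableSet_Ioo] with x hx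
      refine tendsto_const_nhds.congr' ?_
      filter_upwards [eventually_cutoff_eq_one hx] with n hn
      simp only [hφ, hn.eq_of_nhds]
      ring
  have t2 : Tendsto (fun n : ℕ => ∫ x in Ioo (0 : ℝ) 1, h x * iteratedDeriv 1 (φ n) x) atTop
      (𝓝 (∫ x in Ioo (0 : ℝ) 1, jacobiWeight a b x * (h x * (adjDeriv a b p).eval x))) := by
    -- The term with the derivative of the cutoff is dominated by `B |w h p|`, since the shifted
    -- weight is `x (1 - x) w`. It tends to `0` pointwise, which is why no boundary term survives.
    refine tendsto_integral_of_dominated_convergence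
      (fun x => B * ‖jacobiWeight a b x * (h x * p.eval x)‖
        + ‖jacobiWeight a b x * (h x * (adjDeriv a b p).eval x)‖)
      (fun n => hm.mul ?_) ((i2.norm.const_mul B).add i3.norm) (fun n => ?_) ?_
    · exact ((hφd n).continuous_iteratedDeriv 1 (by exact_mod_cast le_top)).aestronglyMeasurable
    · filter_upwards [ae_restrict_mem measurableSet_Ioo] with x hx
      have : h x * iteratedDeriv 1 (φ n) x
          = (deriv (cutoff n) x * (x * (1 - x))) * (jacobiWeight a b x * (h x * p.eval x))
            + cutoff n x * (jacobiWeight a b x * (h x * (adjDeriv a b p).eval x)) := by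
        rw [iteratedDeriv_one, hderiv n x hx, jacobiWeight_add_one a b hx]
        ring
      rw [this]
      refine (norm_add_le _ _).trans (add_le_add ?_ ?_)
      · rw [norm_mul]
        exact mul_le_mul_of_nonneg_right (hB n x hx) (norm_nonneg _)
      · rw [norm_mul]
        exact mul_le_of_le_one_left (norm_nonneg _) (abs_cutoff_le_one n x)
    · filter_upwards [ae_restrict_mem measurableSet_Ioo] with x hx
      refine tendsto_const_nhds.congr' ?_
      filter_upwards [eventually_cutoff_eq_one hx] with n hn
      rw [iteratedDeriv_one, hderiv n x hx, hn.eq_of_nhds, hn.deriv_eq]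
      simp only [deriv_const]
      ring
  have t3 : ∀ n : ℕ, ∫ x in Ioo (0 : ℝ) 1, h x * iteratedDeriv 1 (φ n) x
      = -∫ x in Ioo (0 : ℝ) 1, h1 x * φ n x := by
    intro n
    have hsub := (closure_support_cutoff_mul_subset n
      (fun x => jacobiWeight (a + 1) (b + 1) x * p.eval x)).trans (setOf_one_le_subset n)
    have hcs : HasCompactSupport (φ n) :=
      isCompact_Icc.of_isClosed_subset (isClosed_tsupport _) (hsub.trans Ioo_subset_Icc_self)
    rw [hw.2.2 (φ n) (hφd n) hcs hsub]
    ring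
  have t4 := tendsto_nhds_unique t2 ((t1.neg).congr fun n => (t3 n).symm)
  linarith

theorem integrable_mul_of_memLp {Y : Type*} [MeasurableSpace Y] {m : Measure Y} {f g : Y → ℝ}
    (hf : MemLp f 2 m) (hg : MemLp g 2 m) : Integrable (fun x => f x * g x) m :=
  hf.integrable_mul hg

/-! ### The differential equation -/

/-- The Jacobi polynomial transported to the unit interval. -/
noncomputable def unitJacobi (a b : ℝ) (n : ℕ) : ℝ[X] := (jacobi a b n).comp (2 * X - 1)

/-- The coefficients of the Jacobi polynomial in powers of `(x - 1) / 2`. -/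
noncomputable def jacobiCoeff (a b : ℝ) (n k : ℕ) : ℝ :=
  (n.factorial : ℝ)⁻¹ * (n.choose k : ℝ) * (ascPochhammer ℝ k).eval ((n : ℝ) + a + b + 1)
    * (ascPochhammer ℝ (n - k)).eval (a + (k : ℝ) + 1)

/-- The Jacobi polynomial in the variable `(x - 1) / 2`. -/
noncomputable def shiftJacobi (a b : ℝ) (n : ℕ) : ℝ[X] :=
  ∑ k ∈ Finset.range (n + 1), C (jacobiCoeff a b n k) * X ^ k

/-- The eigenvalues of the Jacobi operator. -/
def jacobiEigenvalue (a b : ℝ) (n : ℕ) : ℝ := n * (n + a + b + 1)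

/-- The Jacobi operator on the unit interval. -/
noncomputable def jacobiOp (a b : ℝ) (p : ℝ[X]) : ℝ[X] := adjDeriv a b (derivative p)

theorem unitJacobi_eq_comp (a b : ℝ) (n : ℕ) :
    unitJacobi a b n = (shiftJacobi a b n).comp (X - 1) := by
  unfold unitJacobi jacobi shiftJacobi jacobiCoeff
  rw [Polynomial.sum_comp, Polynomial.sum_comp]
  refine Finset.sum_congr rfl fun k _ => ?_
  simp only [mul_comp, C_comp, pow_comp, sub_comp, X_comp, one_comp]
  congr 2
  have h : (C (1 / 2 : ℝ)) * 2 = 1 := by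
    rw [show (2 : ℝ[X]) = C 2 from rfl, ← C_mul]
    norm_num
  linear_combination (X - 1 : ℝ[X]) * h

theorem jacobiCoeff_eq_zero (a b : ℝ) {n k : ℕ} (h : n < k) : jacobiCoeff a b n k = 0 := by
  simp [jacobiCoeff, Nat.choose_eq_zero_of_lt h]

theorem coeff_shiftJacobi (a b : ℝ) (n k : ℕ) :
    (shiftJacobi a b n).coeff k = jacobiCoeff a b n k := by
  unfold shiftJacobi
  simp only [finsetSum_coeff, coeff_C_mul, coeff_X_pow, mul_ite, mul_one, mul_zero,
    Finset.sum_ite_eq, Finset.mem_range]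
  split_ifs with h
  · rfl
  · exact (jacobiCoeff_eq_zero a b (by omega)).symm

/-- The ratio of consecutive hypergeometric coefficients; read coefficient by coefficient, this is
the differential equation `shiftJacobi_ode`. -/
theorem jacobiCoeff_succ (a b : ℝ) (n k : ℕ) :
    jacobiCoeff a b n (k + 1) * ((k + 1) * (k + a + 1))
      = jacobiCoeff a b n k * (((n : ℝ) - k) * (n + k + a + b + 1)) := by
  rcases lt_trichotomy k n with h | rfl | h
  · obtain ⟨m, rfl⟩ : ∃ m, n = k + 1 + m := ⟨n - k - 1, by omega⟩
    have h1 : k + 1 + m - (k + 1) = m := by omega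
    have h2 : k + 1 + m - k = m + 1 := by omega
    have h3 : (((k + 1 + m).choose (k + 1) : ℕ) : ℝ) * (k + 1)
        = ((k + 1 + m).choose k : ℕ) * (m + 1) := by
      have := Nat.choose_succ_right_eq (k + 1 + m) k
      rw [h2] at this
      exact_mod_cast this
    have h4 : (ascPochhammer ℝ (m + 1)).eval (a + (k : ℝ) + 1)
        = (a + k + 1) * (ascPochhammer ℝ m).eval (a + ((k + 1 : ℕ) : ℝ) + 1) := by
      rw [ascPochhammer_succ_left]
      simp only [eval_mul, eval_X, eval_comp, eval_add, eval_one]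
      push_cast
      ring_nf
    have h5 : ∀ y : ℝ, (ascPochhammer ℝ (k + 1)).eval y = (ascPochhammer ℝ k).eval y * (y + k) :=
      fun y => ascPochhammer_succ_eval k y
    unfold jacobiCoeff
    rw [h1, h2, h4, h5]
    push_cast
    linear_combination ((k + 1 + m).factorial : ℝ)⁻¹
      * (ascPochhammer ℝ k).eval ((k : ℝ) + 1 + m + a + b + 1)
      * ((k : ℝ) + 1 + m + a + b + 1 + k)
      * (ascPochhammer ℝ m).eval (a + ((k : ℝ) + 1) + 1) * (k + a + 1) * h3
  · rw [jacobiCoeff_eq_zero a b (Nat.lt_succ_self k)]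
    simp
  · rw [jacobiCoeff_eq_zero a b h, jacobiCoeff_eq_zero a b (Nat.lt_succ_of_lt h)]
    simp

theorem shiftJacobi_ode (a b : ℝ) (n : ℕ) :
    X * (1 + X) * derivative (derivative (shiftJacobi a b n))
      + (C (a + 1) + C (a + b + 2) * X) * derivative (shiftJacobi a b n)
      = C (jacobiEigenvalue a b n) * shiftJacobi a b n := by
  set Y := shiftJacobi a b n with hY
  have hc : ∀ k, Y.coeff k = jacobiCoeff a b n k := coeff_shiftJacobi a b n
  have hr := jacobiCoeff_succ a b n
  have e : X * (1 + X) * derivative (derivative Y) + (C (a + 1) + C (a + b + 2) * X) * derivative Y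
      = X * derivative (derivative Y) + X * (X * derivative (derivative Y))
        + C (a + 1) * derivative Y + C (a + b + 2) * (X * derivative Y) := by ring
  rw [e]
  ext k
  simp only [coeff_add, coeff_C_mul, jacobiEigenvalue]
  rcases k with _ | _ | k
  · simp only [coeff_X_mul_zero, coeff_derivative, hc]
    have := hr 0
    push_cast at this ⊢
    linear_combination this
  · simp only [coeff_X_mul_zero, coeff_X_mul, coeff_derivative, hc]
    have := hr 1
    push_cast at this ⊢
    linear_combination this
  · simp only [coeff_X_mul, coeff_derivative, hc]
    have := hr (k + 2)
    push_cast at this ⊢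
    linear_combination this

/-- Replacing `X` by `X - 1` turns `X (1 + X)` into `-X (1 - X)`, whence the minus sign. -/
theorem jacobiOp_unitJacobi (a b : ℝ) (n : ℕ) :
    jacobiOp a b (unitJacobi a b n) = -(C (jacobiEigenvalue a b n) * unitJacobi a b n) := by
  have h := congrArg (fun p : ℝ[X] => p.comp (X - 1)) (shiftJacobi_ode a b n)
  have d1 : derivative (X - 1 : ℝ[X]) = 1 := by simp
  rw [unitJacobi_eq_comp]
  simp only [jacobiOp, adjDeriv, derivative_comp, d1, one_mul]
  simp only [add_comp, mul_comp, X_comp, one_comp, C_comp] at h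
  simp only [C_add, C_1] at h ⊢
  rw [show (C 2 : ℝ[X]) = 2 from rfl] at h
  linear_combination -h

theorem natDegree_unitJacobi {a b : ℝ} (ha : -1 < a) (hb : -1 < b) (n : ℕ) :
    (unitJacobi a b n).natDegree = n := by
  have h1 : (X - 1 : ℝ[X]).natDegree = 1 := natDegree_X_sub_C (1 : ℝ)
  rw [unitJacobi_eq_comp, natDegree_comp, h1, mul_one]
  refine natDegree_eq_of_le_of_coeff_ne_zero ?_ ?_
  · rw [natDegree_le_iff_coeff_eq_zero]
    intro k hk
    rw [coeff_shiftJacobi, jacobiCoeff_eq_zero a b hk]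
  · rw [coeff_shiftJacobi]
    unfold jacobiCoeff
    have : 0 < (ascPochhammer ℝ n).eval ((n : ℝ) + a + b + 1) := by
      -- For `n = 0` the base `a + b + 1` may be negative, but then the product is empty.
      rcases n with _ | n
      · simp
      · refine ascPochhammer_pos _ _ ?_
        push_cast
        have : (0 : ℝ) ≤ n := Nat.cast_nonneg n
        linarith
    simp only [Nat.choose_self, Nat.sub_self, ascPochhammer_zero, eval_one]
    positivity

theorem unitJacobi_ne_zero {a b : ℝ} (ha : -1 < a) (hb : -1 < b) (n : ℕ) :
    unitJacobi a b n ≠ 0 := by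
  intro h
  rcases n with _ | n
  · have : unitJacobi a b 0 = 1 := by simp [unitJacobi_eq_comp, shiftJacobi, jacobiCoeff]
    rw [this] at h
    exact one_ne_zero h
  · have := natDegree_unitJacobi ha hb (n + 1)
    rw [h] at this
    simp at this

theorem jacobiEigenvalue_strictMono {a b : ℝ} (ha : -1 < a) (hb : -1 < b) :
    StrictMono (jacobiEigenvalue a b) := by
  refine strictMono_nat_of_lt_succ fun n => ?_
  unfold jacobiEigenvalue
  push_cast
  have : (0 : ℝ) ≤ n := Nat.cast_nonneg n
  nlinarith

theorem jacobiEigenvalue_nonneg {a b : ℝ} (ha : -1 < a) (hb : -1 < b) (n : ℕ) :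
    0 ≤ jacobiEigenvalue a b n := by
  have := (jacobiEigenvalue_strictMono ha hb).monotone (Nat.zero_le n)
  simpa [jacobiEigenvalue] using this

/-! ### Orthogonality -/

theorem eq_zero_of_ae_eval_eq_zero {c d : ℝ} (hcd : c < d) {p : ℝ[X]}
    (h : ∀ᵐ x ∂(volume.restrict (Ioo c d)), p.eval x = 0) : p = 0 := by
  by_contra hp
  have hfin : {x | p.IsRoot x}.Finite := finite_setOfPred_isRoot hp
  have h2 : ∀ᵐ x ∂(volume.restrict (Ioo c d)), ¬ p.IsRoot x := by
    refine ae_restrict_of_ae ?_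
    exact measure_eq_zero_iff_ae_notMem.1 (hfin.measure_zero volume)
  have h3 : ∀ᵐ x ∂(volume.restrict (Ioo c d)), False := by
    filter_upwards [h, h2] with x h1 h2 using h2 h1
  rw [ae_restrict_iff' measurableSet_Ioo] at h3
  have h4 : volume (Ioo c d) = 0 := measure_eq_zero_iff_ae_notMem.2 h3
  rw [Real.volume_Ioo, ENNReal.ofReal_eq_zero] at h4
  linarith

theorem integrable_eval {a b : ℝ} (ha : -1 < a) (hb : -1 < b) (p : ℝ[X]) :
    Integrable (fun x => p.eval x) (jacobiMeasure a b) :=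
  MemLp.integrable_jacobi ha hb (memLp_eval ha hb p)

theorem eq_zero_of_integral_eval_eq_zero {a b : ℝ} (ha : -1 < a) (hb : -1 < b) {p : ℝ[X]}
    (h0 : ∀ x ∈ Ioo (0 : ℝ) 1, 0 ≤ p.eval x) (h : ∫ x, p.eval x ∂(jacobiMeasure a b) = 0) :
    p = 0 := by
  rw [integral_eq_zero_iff_of_nonneg_ae ((ae_jacobiMeasure_mem a b).mono fun x hx => h0 x hx)
    (integrable_eval ha hb p)] at h
  exact eq_zero_of_ae_eval_eq_zero zero_lt_one ((ae_jacobiMeasure_iff a b).1 h)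

theorem integral_eval_sq_pos {a b : ℝ} (ha : -1 < a) (hb : -1 < b) {p : ℝ[X]} (hp : p ≠ 0) :
    0 < ∫ x, p.eval x ^ 2 ∂(jacobiMeasure a b) := by
  refine lt_of_le_of_ne (integral_nonneg fun x => sq_nonneg _) fun h => hp ?_
  have := eq_zero_of_integral_eval_eq_zero ha hb (p := p ^ 2)
    (fun x _ => by rw [eval_pow]; positivity) (by simpa using h.symm)
  exact pow_eq_zero_iff two_ne_zero |>.1 this

/-- Integration by parts for the Jacobi operator. -/
theorem integral_weakDeriv_mul_derivative {a b : ℝ} (ha : -1 < a) (hb : -1 < b) {h h1 : ℝ → ℝ}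
    (hh : MemLp h 2 (jacobiMeasure a b)) (hh1 : MemLp h1 2 (jacobiMeasure (a + 1) (b + 1)))
    (hw : IsWeakDeriv 1 h h1) (p : ℝ[X]) :
    ∫ x, h1 x * (derivative p).eval x ∂(jacobiMeasure (a + 1) (b + 1))
      = -∫ x, h x * (jacobiOp a b p).eval x ∂(jacobiMeasure a b) :=
  integral_weakDeriv_mul ha hb hh hh1 hw _

theorem integral_derivative_mul_derivative {a b : ℝ} (ha : -1 < a) (hb : -1 < b) (p q : ℝ[X]) :
    ∫ x, (derivative p).eval x * (derivative q).eval x ∂(jacobiMeasure (a + 1) (b + 1))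
      = -∫ x, p.eval x * (jacobiOp a b q).eval x ∂(jacobiMeasure a b) :=
  integral_weakDeriv_mul_derivative ha hb (memLp_eval ha hb p)
    (memLp_eval (by linarith) (by linarith) _) (isWeakDeriv_eval p) q

/-- The derivatives of the eigenfunctions are again orthogonal, for the shifted weight, and their
squared norms are multiplied by the eigenvalue. Both the Bernstein and the Poincaré inequality rest
on this. -/
theorem integral_derivative_mul_derivative_unitJacobi {a b : ℝ} (ha : -1 < a) (hb : -1 < b)
    (p : ℝ[X]) (n : ℕ) :
    ∫ x, (derivative p).eval x * (derivative (unitJacobi a b n)).eval x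
        ∂(jacobiMeasure (a + 1) (b + 1))
      = jacobiEigenvalue a b n * ∫ x, p.eval x * (unitJacobi a b n).eval x ∂(jacobiMeasure a b) := by
  rw [integral_derivative_mul_derivative ha hb, jacobiOp_unitJacobi, ← integral_neg,
    ← integral_const_mul]
  congr 1
  ext x
  simp only [eval_neg, eval_mul, eval_C]
  ring

/-- The integral of the product of the derivatives is symmetric in `m` and `n`, while the
eigenvalues differ. -/
theorem integral_unitJacobi_mul_unitJacobi {a b : ℝ} (ha : -1 < a) (hb : -1 < b) {m n : ℕ}
    (hmn : m ≠ n) :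
    ∫ x, (unitJacobi a b m).eval x * (unitJacobi a b n).eval x ∂(jacobiMeasure a b) = 0 := by
  have h1 := integral_derivative_mul_derivative_unitJacobi ha hb (unitJacobi a b m) n
  have h2 := integral_derivative_mul_derivative_unitJacobi ha hb (unitJacobi a b n) m
  simp only [mul_comm (eval _ (derivative (unitJacobi a b n))),
    mul_comm (eval _ (unitJacobi a b n))] at h2
  rw [h1] at h2
  have h3 : jacobiEigenvalue a b n ≠ jacobiEigenvalue a b m := fun h =>
    hmn ((jacobiEigenvalue_strictMono ha hb).injective h).symm
  have h4 := sub_eq_zero.2 h2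
  rw [← sub_mul] at h4
  exact (mul_eq_zero.1 h4).resolve_left (sub_ne_zero.2 h3)

theorem exists_eq_sum_unitJacobi {a b : ℝ} (ha : -1 < a) (hb : -1 < b) (M : ℕ) :
    ∀ p : ℝ[X], p.degree < M →
      ∃ c : ℕ → ℝ, p = ∑ n ∈ Finset.range M, C (c n) * unitJacobi a b n := by
  induction M with
  | zero =>
    intro p hp
    refine ⟨0, ?_⟩
    simpa [degree_lt_iff_coeff_zero, Polynomial.ext_iff] using hp
  | succ M ih =>
    intro p hp
    have hl : (unitJacobi a b M).coeff M ≠ 0 := by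
      have := leadingCoeff_ne_zero.2 (unitJacobi_ne_zero ha hb M)
      rwa [leadingCoeff, natDegree_unitJacobi ha hb] at this
    set t := p.coeff M / (unitJacobi a b M).coeff M with ht
    obtain ⟨c, hc⟩ := ih (p - C t * unitJacobi a b M) (by
      rw [degree_lt_iff_coeff_zero] at hp ⊢
      intro k hk
      rw [coeff_sub, coeff_C_mul]
      rcases hk.eq_or_lt with rfl | hk
      · rw [ht, div_mul_cancel₀ _ hl, sub_self]
      · rw [hp k hk, coeff_eq_zero_of_natDegree_lt (by rwa [natDegree_unitJacobi ha hb])]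
        simp)
    refine ⟨fun n => if n = M then t else c n, ?_⟩
    simp only [Finset.sum_range_succ, if_true]
    rw [← sub_eq_iff_eq_add, hc]
    refine Finset.sum_congr rfl fun n hn => ?_
    rw [if_neg (Finset.mem_range.1 hn).ne]

theorem integral_mul_sum_unitJacobi {a b : ℝ} (ha : -1 < a) (hb : -1 < b) {h : ℝ → ℝ}
    (hh : MemLp h 2 (jacobiMeasure a b)) (s : Finset ℕ) (c : ℕ → ℝ) :
    ∫ x, h x * (∑ n ∈ s, C (c n) * unitJacobi a b n).eval x ∂(jacobiMeasure a b)
      = ∑ n ∈ s, c n * ∫ x, h x * (unitJacobi a b n).eval x ∂(jacobiMeasure a b) := by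
  have hi : ∀ n ∈ s, Integrable (fun x => c n * (h x * (unitJacobi a b n).eval x))
      (jacobiMeasure a b) := fun n _ => (hh.integrable_mul (memLp_eval ha hb _)).const_mul _
  simp only [← integral_const_mul]
  rw [← integral_finsetSum s hi]
  congr 1
  ext x
  rw [eval_finsetSum, Finset.mul_sum]
  refine Finset.sum_congr rfl fun n _ => ?_
  rw [eval_mul, eval_C]
  ring

theorem integral_sum_unitJacobi_mul {a b : ℝ} (ha : -1 < a) (hb : -1 < b) (M : ℕ) (c : ℕ → ℝ)
    {n : ℕ} (hn : n < M) :
    ∫ x, (∑ n ∈ Finset.range M, C (c n) * unitJacobi a b n).eval x * (unitJacobi a b n).eval x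
        ∂(jacobiMeasure a b)
      = c n * ∫ x, (unitJacobi a b n).eval x ^ 2 ∂(jacobiMeasure a b) := by
  simp only [mul_comm _ (eval _ (unitJacobi a b n))]
  rw [integral_mul_sum_unitJacobi ha hb (memLp_eval ha hb _), Finset.sum_eq_single n]
  · simp only [sq]
  · intro m _ hm
    rw [integral_unitJacobi_mul_unitJacobi ha hb hm.symm, mul_zero]
  · intro h
    exact absurd (Finset.mem_range.2 hn) h

theorem integral_sum_unitJacobi_sq {a b : ℝ} (ha : -1 < a) (hb : -1 < b) (M : ℕ) (c : ℕ → ℝ) :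
    ∫ x, (∑ n ∈ Finset.range M, C (c n) * unitJacobi a b n).eval x ^ 2 ∂(jacobiMeasure a b)
      = ∑ n ∈ Finset.range M,
        c n ^ 2 * ∫ x, (unitJacobi a b n).eval x ^ 2 ∂(jacobiMeasure a b) := by
  simp only [sq (eval _ (∑ n ∈ Finset.range M, C (c n) * unitJacobi a b n))]
  rw [integral_mul_sum_unitJacobi ha hb (memLp_eval ha hb _)]
  refine Finset.sum_congr rfl fun n hn => ?_
  rw [integral_sum_unitJacobi_mul ha hb M c (Finset.mem_range.1 hn)]
  ring

theorem integral_derivative_sum_unitJacobi_sq {a b : ℝ} (ha : -1 < a) (hb : -1 < b) (M : ℕ)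
    (c : ℕ → ℝ) :
    ∫ x, (derivative (∑ n ∈ Finset.range M, C (c n) * unitJacobi a b n)).eval x ^ 2
        ∂(jacobiMeasure (a + 1) (b + 1))
      = ∑ n ∈ Finset.range M, jacobiEigenvalue a b n *
        (c n ^ 2 * ∫ x, (unitJacobi a b n).eval x ^ 2 ∂(jacobiMeasure a b)) := by
  set p := ∑ n ∈ Finset.range M, C (c n) * unitJacobi a b n with hp
  have h1 : ∀ x, (derivative p).eval x ^ 2 = ∑ n ∈ Finset.range M,
      c n * ((derivative p).eval x * (derivative (unitJacobi a b n)).eval x) := by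
    intro x
    have : derivative p = ∑ n ∈ Finset.range M, C (c n) * derivative (unitJacobi a b n) := by
      rw [hp, derivative_sum]
      simp only [derivative_C_mul]
    rw [sq]
    nth_rewrite 2 [this]
    rw [eval_finsetSum, Finset.mul_sum]
    refine Finset.sum_congr rfl fun n _ => ?_
    rw [eval_mul, eval_C]
    ring
  simp only [h1]
  rw [integral_finsetSum]
  · refine Finset.sum_congr rfl fun n hn => ?_
    rw [integral_const_mul, integral_derivative_mul_derivative_unitJacobi ha hb, hp,
      integral_sum_unitJacobi_mul ha hb M c (Finset.mem_range.1 hn)]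
    ring
  · intro n _
    exact ((memLp_eval (by linarith) (by linarith) _).integrable_mul
      (memLp_eval (by linarith) (by linarith) _)).const_mul _

/-- The Bernstein inequality in the weighted `L²` norms. -/
theorem integral_derivative_sq_le {a b : ℝ} (ha : -1 < a) (hb : -1 < b) {M : ℕ} {p : ℝ[X]}
    (hp : p.degree < (M + 1 : ℕ)) :
    ∫ x, (derivative p).eval x ^ 2 ∂(jacobiMeasure (a + 1) (b + 1))
      ≤ jacobiEigenvalue a b M * ∫ x, p.eval x ^ 2 ∂(jacobiMeasure a b) := by
  obtain ⟨c, hc⟩ := exists_eq_sum_unitJacobi ha hb _ p hp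
  rw [hc, integral_derivative_sum_unitJacobi_sq ha hb, integral_sum_unitJacobi_sq ha hb,
    Finset.mul_sum]
  refine Finset.sum_le_sum fun n hn => mul_le_mul_of_nonneg_right ?_
    (mul_nonneg (sq_nonneg _) (integral_nonneg fun x => sq_nonneg _))
  exact (jacobiEigenvalue_strictMono ha hb).monotone (Nat.lt_succ_iff.1 (Finset.mem_range.1 hn))

/-- The Poincaré inequality for polynomials: orthogonality removes the modes below `M`, and all the
others have eigenvalue at least that of `M`. -/
theorem le_integral_derivative_sq {a b : ℝ} (ha : -1 < a) (hb : -1 < b) {M : ℕ} {p : ℝ[X]}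
    (hp : ∀ q : ℝ[X], q.degree < M → ∫ x, p.eval x * q.eval x ∂(jacobiMeasure a b) = 0) :
    jacobiEigenvalue a b M * ∫ x, p.eval x ^ 2 ∂(jacobiMeasure a b)
      ≤ ∫ x, (derivative p).eval x ^ 2 ∂(jacobiMeasure (a + 1) (b + 1)) := by
  set D := p.natDegree + 1 with hD
  obtain ⟨c, hc⟩ := exists_eq_sum_unitJacobi ha hb D p
    (degree_le_natDegree.trans_lt (by exact_mod_cast Nat.lt_succ_self _))
  have h0 : ∀ n ∈ Finset.range D, n < M → c n = 0 := by
    intro n hn hnM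
    have h1 := hp (unitJacobi a b n) (by
      rw [degree_eq_natDegree (unitJacobi_ne_zero ha hb n), natDegree_unitJacobi ha hb]
      exact_mod_cast hnM)
    rw [hc, integral_sum_unitJacobi_mul ha hb D c (Finset.mem_range.1 hn)] at h1
    exact (mul_eq_zero.1 h1).resolve_right
      (integral_eval_sq_pos ha hb (unitJacobi_ne_zero ha hb n)).ne'
  -- `D` is defined through `p`; forgetting its value allows `p` to be rewritten as the sum without
  -- changing `D`.
  clear_value D
  rw [hc, integral_derivative_sum_unitJacobi_sq ha hb, integral_sum_unitJacobi_sq ha hb,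
    Finset.mul_sum]
  refine Finset.sum_le_sum fun n hn => ?_
  rcases lt_or_ge n M with h | h
  · simp [h0 n hn h]
  · exact mul_le_mul_of_nonneg_right ((jacobiEigenvalue_strictMono ha hb).monotone h)
      (mul_nonneg (sq_nonneg _) (integral_nonneg fun x => sq_nonneg _))

/-- The orthogonal projection onto polynomials. -/
theorem exists_projection {a b : ℝ} (ha : -1 < a) (hb : -1 < b) {h : ℝ → ℝ}
    (hh : MemLp h 2 (jacobiMeasure a b)) (M : ℕ) :
    ∃ p : ℝ[X], p.degree < M ∧ ∀ q : ℝ[X], q.degree < M →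
      ∫ x, (h x - p.eval x) * q.eval x ∂(jacobiMeasure a b) = 0 := by
  set c : ℕ → ℝ := fun n => (∫ x, h x * (unitJacobi a b n).eval x ∂(jacobiMeasure a b))
    / ∫ x, (unitJacobi a b n).eval x ^ 2 ∂(jacobiMeasure a b) with hc
  refine ⟨∑ n ∈ Finset.range M, C (c n) * unitJacobi a b n, ?_, fun q hq => ?_⟩
  · rw [← mem_degreeLT]
    refine Submodule.sum_mem _ fun n hn => ?_
    rw [← smul_eq_C_mul]
    refine Submodule.smul_mem _ _ (mem_degreeLT.2 ?_)
    rw [degree_eq_natDegree (unitJacobi_ne_zero ha hb n), natDegree_unitJacobi ha hb]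
    exact_mod_cast Finset.mem_range.1 hn
  · obtain ⟨e, he⟩ := exists_eq_sum_unitJacobi ha hb M q hq
    have hi := integral_mul_sum_unitJacobi ha hb (hh.sub (memLp_eval ha hb
      (∑ n ∈ Finset.range M, C (c n) * unitJacobi a b n))) (Finset.range M) e
    simp only [Pi.sub_apply] at hi
    rw [he, hi]
    refine Finset.sum_eq_zero fun n hn => ?_
    have h1 : ∫ x, (h x - (∑ n ∈ Finset.range M, C (c n) * unitJacobi a b n).eval x)
        * (unitJacobi a b n).eval x ∂(jacobiMeasure a b) = 0 := by
      simp only [sub_mul]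
      rw [integral_sub (integrable_mul_of_memLp hh (memLp_eval ha hb _))
        (integrable_mul_of_memLp (memLp_eval ha hb _) (memLp_eval ha hb _)),
        integral_sum_unitJacobi_mul ha hb M c (Finset.mem_range.1 hn), hc,
        div_mul_cancel₀ _ (integral_eval_sq_pos ha hb (unitJacobi_ne_zero ha hb n)).ne', sub_self]
    rw [h1, mul_zero]

/-! ### Density of polynomials and the weighted Poincaré inequality -/

/-- Bounded continuous functions are dense in L² of a finite measure, and Weierstrass approximates
them uniformly on `[0, 1]`. -/
theorem exists_polynomial_integral_sq_sub_le {a b : ℝ} (ha : -1 < a) (hb : -1 < b) {h : ℝ → ℝ}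
    (hh : MemLp h 2 (jacobiMeasure a b)) {ε : ℝ} (hε : 0 < ε) :
    ∃ p : ℝ[X], ∫ x, (h x - p.eval x) ^ 2 ∂(jacobiMeasure a b) ≤ ε := by
  have := isFiniteMeasure_jacobiMeasure ha hb
  set m : ℝ := (jacobiMeasure a b).real univ with hm
  have hm0 : 0 ≤ m := measureReal_nonneg
  -- Chosen so that the final bound `2 δ ^ 2 + 2 δ ^ 2 m` is exactly `ε`.
  set δ : ℝ := √(ε / (2 + 2 * m)) with hδ
  have hδ0 : 0 < δ := Real.sqrt_pos.2 (by positivity)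
  have hδ2 : δ ^ 2 * (2 + 2 * m) = ε := by
    rw [hδ, Real.sq_sqrt (by positivity)]
    field_simp
  obtain ⟨g, hg, hgm⟩ := hh.exists_boundedContinuous_eLpNorm_sub_le (by norm_num)
    (ε := ENNReal.ofReal δ) (by simpa using hδ0)
  obtain ⟨p, hp⟩ := exists_polynomial_near_of_continuousOn 0 1 g g.continuous.continuousOn δ hδ0
  refine ⟨p, ?_⟩
  have h1 : ∫ x, (h x - g x) ^ 2 ∂(jacobiMeasure a b) ≤ δ ^ 2 := by
    have h2 := weightNorm_sq (hh.sub hgm)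
    simp only [Pi.sub_apply] at h2
    rw [← h2]
    have : weightNorm a b 1 (h - ⇑g) ≤ δ := by
      unfold weightNorm
      exact ENNReal.toReal_le_of_le_ofReal hδ0.le hg
    gcongr
    exact ENNReal.toReal_nonneg
  have i1 : Integrable (fun x => 2 * (h x - g x) ^ 2) (jacobiMeasure a b) :=
    (hh.sub hgm).integrable_sq.const_mul 2
  calc ∫ x, (h x - p.eval x) ^ 2 ∂(jacobiMeasure a b)
      ≤ ∫ x, (2 * (h x - g x) ^ 2 + 2 * δ ^ 2) ∂(jacobiMeasure a b) := by
        refine integral_mono_ae (hh.sub (memLp_eval ha hb p)).integrable_sq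
          (i1.add (integrable_const _)) ?_
        filter_upwards [ae_jacobiMeasure_mem a b] with x hx
        have h2 := hp x (Ioo_subset_Icc_self hx)
        rw [abs_lt] at h2
        have h3 : (g x - p.eval x) ^ 2 ≤ δ ^ 2 := sq_le_sq' (by linarith) (by linarith)
        nlinarith [sq_nonneg ((h x - g x) - (g x - p.eval x))]
    _ = 2 * (∫ x, (h x - g x) ^ 2 ∂(jacobiMeasure a b)) + 2 * δ ^ 2 * m := by
        rw [integral_add i1 (integrable_const _), integral_const_mul, integral_const, smul_eq_mul]
        ring
    _ ≤ ε := by linarith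

theorem integral_sq_sub {a b : ℝ} (ha : -1 < a) (hb : -1 < b) {h : ℝ → ℝ}
    (hh : MemLp h 2 (jacobiMeasure a b)) (p : ℝ[X]) :
    ∫ x, (h x - p.eval x) ^ 2 ∂(jacobiMeasure a b)
      = ∫ x, h x ^ 2 ∂(jacobiMeasure a b) - 2 * ∫ x, h x * p.eval x ∂(jacobiMeasure a b)
        + ∫ x, p.eval x ^ 2 ∂(jacobiMeasure a b) := by
  have i1 := hh.integrable_sq
  have i2 := (integrable_mul_of_memLp hh (memLp_eval ha hb p)).const_mul 2
  have i3 := (memLp_eval ha hb p).integrable_sq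
  have i4 : Integrable (fun x => h x ^ 2 - 2 * (h x * p.eval x)) (jacobiMeasure a b) := i1.sub i2
  have e : ∀ x, (h x - p.eval x) ^ 2 = h x ^ 2 - 2 * (h x * p.eval x) + p.eval x ^ 2 :=
    fun x => by ring
  simp only [e]
  rw [integral_add i4 i3, integral_sub i1 i2, integral_const_mul]

/-- Pythagoras' theorem for a function orthogonal to the polynomials of degree `< M`. -/
theorem integral_sq_le_of_orthogonal {a b : ℝ} (ha : -1 < a) (hb : -1 < b) {h : ℝ → ℝ}
    (hh : MemLp h 2 (jacobiMeasure a b)) {M : ℕ}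
    (ho : ∀ q : ℝ[X], q.degree < M → ∫ x, h x * q.eval x ∂(jacobiMeasure a b) = 0)
    {p : ℝ[X]} (hp : p.degree < M) :
    ∫ x, h x ^ 2 ∂(jacobiMeasure a b) ≤ ∫ x, (h x - p.eval x) ^ 2 ∂(jacobiMeasure a b) := by
  rw [integral_sq_sub ha hb hh, ho p hp]
  have : 0 ≤ ∫ x, p.eval x ^ 2 ∂(jacobiMeasure a b) := integral_nonneg fun x => sq_nonneg _
  linarith

/-- The operator is diagonal in the Jacobi basis, so it preserves each space of polynomials of
bounded degree. -/
theorem degree_jacobiOp_lt {a b : ℝ} (ha : -1 < a) (hb : -1 < b) {D : ℕ} {p : ℝ[X]}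
    (hpd : p.degree < D) : (jacobiOp a b p).degree < D := by
  obtain ⟨c, hc⟩ := exists_eq_sum_unitJacobi ha hb D p hpd
  have : jacobiOp a b p = ∑ n ∈ Finset.range D,
      (-(c n * jacobiEigenvalue a b n)) • unitJacobi a b n := by
    have hadd : ∀ s : Finset ℕ, jacobiOp a b (∑ n ∈ s, C (c n) * unitJacobi a b n)
        = ∑ n ∈ s, (-(c n * jacobiEigenvalue a b n)) • unitJacobi a b n := by
      intro s
      induction s using Finset.induction_on with
      | empty => simp [jacobiOp, adjDeriv]
      | insert n s hn ih =>
        rw [Finset.sum_insert hn, Finset.sum_insert hn, ← ih, smul_eq_C_mul]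
        have h2 := jacobiOp_unitJacobi a b n
        simp only [jacobiOp, adjDeriv, derivative_add, derivative_C_mul, C_neg, C_mul] at h2 ⊢
        linear_combination C (c n) * h2
    rw [hc, hadd]
  rw [this, ← mem_degreeLT]
  refine Submodule.sum_mem _ fun n hn => Submodule.smul_mem _ _ (mem_degreeLT.2 ?_)
  rw [degree_eq_natDegree (unitJacobi_ne_zero ha hb n), natDegree_unitJacobi ha hb]
  exact_mod_cast Finset.mem_range.1 hn

/-- The weighted Poincaré inequality on the orthogonal complement of polynomials. -/
theorem eigenvalue_mul_integral_sq_le {a b : ℝ} (ha : -1 < a) (hb : -1 < b) {h h1 : ℝ → ℝ}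
    (hh : MemLp h 2 (jacobiMeasure a b)) (hh1 : MemLp h1 2 (jacobiMeasure (a + 1) (b + 1)))
    (hw : IsWeakDeriv 1 h h1) {M : ℕ}
    (ho : ∀ q : ℝ[X], q.degree < M → ∫ x, h x * q.eval x ∂(jacobiMeasure a b) = 0) :
    jacobiEigenvalue a b M * ∫ x, h x ^ 2 ∂(jacobiMeasure a b)
      ≤ ∫ x, h1 x ^ 2 ∂(jacobiMeasure (a + 1) (b + 1)) := by
  have hl0 := jacobiEigenvalue_nonneg ha hb M
  refine le_of_forall_pos_le_add fun ε hε => ?_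
  obtain ⟨r, hr⟩ := exists_polynomial_integral_sq_sub_le ha hb hh
    (ε := ε / (jacobiEigenvalue a b M + 1)) (by positivity)
  -- The degree is large enough for the projection `p` to be as close to `h` as `r` is, and at least
  -- `M`, so that `p` inherits the orthogonality of `h`.
  set D := max M (r.natDegree + 1) with hD
  obtain ⟨p, hpd, hpo⟩ := exists_projection ha hb hh D
  have hrD : r.degree < D := degree_le_natDegree.trans_lt (by
    exact_mod_cast (Nat.lt_succ_self _).trans_le (le_max_right M _))
  have hop : ∀ q : ℝ[X], q.degree < D → ∫ x, h x * q.eval x ∂(jacobiMeasure a b)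
      = ∫ x, p.eval x * q.eval x ∂(jacobiMeasure a b) := by
    intro q hq
    have := hpo q hq
    simp only [sub_mul] at this
    rw [integral_sub (integrable_mul_of_memLp hh (memLp_eval ha hb q))
      (integrable_mul_of_memLp (memLp_eval ha hb p) (memLp_eval ha hb q))] at this
    linarith
  have e1 : ∫ x, (h x - p.eval x) ^ 2 ∂(jacobiMeasure a b)
      ≤ ∫ x, (h x - r.eval x) ^ 2 ∂(jacobiMeasure a b) := by
    have := integral_sq_le_of_orthogonal ha hb (hh.sub (memLp_eval ha hb p)) hpo
      (p := r - p) ((degree_sub_le _ _).trans_lt (max_lt hrD hpd))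
    simpa using this
  have e2 : jacobiEigenvalue a b M * ∫ x, p.eval x ^ 2 ∂(jacobiMeasure a b)
      ≤ ∫ x, (derivative p).eval x ^ 2 ∂(jacobiMeasure (a + 1) (b + 1)) := by
    refine le_integral_derivative_sq ha hb fun q hq => ?_
    rw [← hop q (hq.trans_le (by exact_mod_cast le_max_left M _)), ho q hq]
  -- This says that `h1 - p'` is orthogonal to `p'`. Hence the norm of `p'` is at most that of `h1`,
  -- and the polynomial inequality `e2` transfers to `h` up to `ε`.
  have e3 : ∫ x, h1 x * (derivative p).eval x ∂(jacobiMeasure (a + 1) (b + 1))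
      = ∫ x, (derivative p).eval x ^ 2 ∂(jacobiMeasure (a + 1) (b + 1)) := by
    rw [integral_weakDeriv_mul_derivative ha hb hh hh1 hw, hop _ (degree_jacobiOp_lt ha hb hpd),
      ← integral_derivative_mul_derivative ha hb]
    simp only [sq]
  have e4 := integral_sq_sub (by linarith) (by linarith) hh1 (derivative p)
  have e5 : 0 ≤ ∫ x, (h1 x - (derivative p).eval x) ^ 2 ∂(jacobiMeasure (a + 1) (b + 1)) :=
    integral_nonneg fun x => sq_nonneg _
  have e6 := integral_sq_sub ha hb hh p
  rw [hop p hpd] at e6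
  have e7 : ∫ x, p.eval x * p.eval x ∂(jacobiMeasure a b)
      = ∫ x, p.eval x ^ 2 ∂(jacobiMeasure a b) := by simp only [sq]
  have e8 : jacobiEigenvalue a b M * (ε / (jacobiEigenvalue a b M + 1)) ≤ ε := by
    rw [mul_div_assoc', div_le_iff₀ (by positivity)]
    nlinarith
  have e9 : jacobiEigenvalue a b M * ∫ x, (h x - p.eval x) ^ 2 ∂(jacobiMeasure a b) ≤ ε :=
    (mul_le_mul_of_nonneg_left (e1.trans hr) hl0).trans e8
  rw [e7] at e6
  rw [e3] at e4
  have e10 : ∫ x, h x ^ 2 ∂(jacobiMeasure a b) = ∫ x, (h x - p.eval x) ^ 2 ∂(jacobiMeasure a b)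
      + ∫ x, p.eval x ^ 2 ∂(jacobiMeasure a b) := by linarith
  rw [e10, mul_add]
  linarith

/-! ### Zeros -/

theorem integral_mul_unitJacobi_eq_zero {a b : ℝ} (ha : -1 < a) (hb : -1 < b) {n : ℕ} {p : ℝ[X]}
    (hp : p.degree < n) :
    ∫ x, p.eval x * (unitJacobi a b n).eval x ∂(jacobiMeasure a b) = 0 := by
  obtain ⟨c, hc⟩ := exists_eq_sum_unitJacobi ha hb n p hp
  simp only [mul_comm (eval _ p)]
  rw [hc, integral_mul_sum_unitJacobi ha hb (memLp_eval ha hb _)]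
  refine Finset.sum_eq_zero fun m hm => ?_
  rw [integral_unitJacobi_mul_unitJacobi ha hb (Finset.mem_range.1 hm).ne', mul_zero]

/-- If `(X - z)^2 q` were the polynomial, its integral against `q` would be that of `((X - z) q)^2 >
0`, although `q` has degree below `n`. -/
theorem not_sq_dvd_unitJacobi {a b : ℝ} (ha : -1 < a) (hb : -1 < b) (n : ℕ) (z : ℝ) :
    ¬ (X - C z) ^ 2 ∣ unitJacobi a b n := by
  rintro ⟨q, hq⟩
  have hne := unitJacobi_ne_zero ha hb n
  have hq0 : q ≠ 0 := by
    rintro rfl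
    exact hne (by simpa using hq)
  have hdeg : q.degree < n := by
    have h1 := congrArg natDegree hq
    rw [natDegree_unitJacobi ha hb, natDegree_mul (pow_ne_zero _ (X_sub_C_ne_zero z)) hq0,
      natDegree_pow, natDegree_X_sub_C] at h1
    rw [degree_eq_natDegree hq0]
    exact_mod_cast (by omega : q.natDegree < n)
  have h2 := integral_mul_unitJacobi_eq_zero ha hb hdeg
  have h3 := integral_eval_sq_pos ha hb (p := (X - C z) * q) (mul_ne_zero (X_sub_C_ne_zero z) hq0)
  rw [hq] at h2
  refine h3.ne' (Eq.trans ?_ h2)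
  congr 1
  ext x
  simp only [eval_mul, eval_pow]
  ring

/-- The zeros in the open unit interval. -/
noncomputable def unitNodes (a b : ℝ) (n : ℕ) : Finset ℝ :=
  (unitJacobi a b n).roots.toFinset.filter fun x => x ∈ Ioo (0 : ℝ) 1

theorem mem_unitNodes {a b : ℝ} (ha : -1 < a) (hb : -1 < b) {n : ℕ} {x : ℝ} :
    x ∈ unitNodes a b n ↔ x ∈ Ioo (0 : ℝ) 1 ∧ (unitJacobi a b n).eval x = 0 := by
  simp [unitNodes, unitJacobi_ne_zero ha hb n, and_comm]

/-- Let `Q` be the product of the linear factors at the zeros in `(0, 1)` and `P = Q R`. With fewer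
than `n` zeros, `Q` would be orthogonal to `P`; but `Q P = Q^2 R`, and `R` keeps its sign on `(0,
1)`. -/
theorem card_unitNodes {a b : ℝ} (ha : -1 < a) (hb : -1 < b) (n : ℕ) :
    (unitNodes a b n).card = n := by
  set P := unitJacobi a b n with hP
  set S := unitNodes a b n with hS
  have hP0 : P ≠ 0 := unitJacobi_ne_zero ha hb n
  have hle : S.val ≤ P.roots := (Finset.val_le_iff_val_subset).2 (by
    intro x hx
    have hx' : x ∈ unitNodes a b n := hx
    rw [mem_unitNodes ha hb] at hx'
    exact (mem_roots hP0).2 hx'.2)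
  obtain ⟨R, hR⟩ := (Multiset.prod_X_sub_C_dvd_iff_le_roots hP0 S.val).2 hle
  set Q : ℝ[X] := (S.val.map fun x => X - C x).prod with hQ
  have hQ0 : Q ≠ 0 := left_ne_zero_of_mul (hR ▸ hP0)
  have hR0 : R ≠ 0 := right_ne_zero_of_mul (hR ▸ hP0)
  have hQd : Q.natDegree = S.card := natDegree_multiset_prod_X_sub_C_eq_card _
  have hSn : S.card ≤ n := by
    have := congrArg natDegree hR
    rw [natDegree_mul hQ0 hR0, hQd, natDegree_unitJacobi ha hb] at this
    omega
  by_contra hne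
  have hlt : Q.degree < n := by
    rw [degree_eq_natDegree hQ0, hQd]
    exact_mod_cast lt_of_le_of_ne hSn hne
  -- A zero of `R` here would be a zero of `P` already counted in `Q`, hence a double zero.
  have hRne : ∀ x ∈ Ioo (0 : ℝ) 1, R.eval x ≠ 0 := by
    intro x hx h0
    have hxS : x ∈ S := (mem_unitNodes ha hb).2 ⟨hx, by rw [← hP, hR, eval_mul, h0, mul_zero]⟩
    have d1 : X - C x ∣ Q := Multiset.dvd_prod (Multiset.mem_map_of_mem _ hxS)
    have d2 : X - C x ∣ R := dvd_iff_isRoot.2 h0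
    refine not_sq_dvd_unitJacobi ha hb n x ?_
    rw [← hP, hR, sq]
    exact mul_dvd_mul d1 d2
  have hsign : (∀ x ∈ Ioo (0 : ℝ) 1, 0 ≤ R.eval x) ∨ ∀ x ∈ Ioo (0 : ℝ) 1, 0 ≤ (-R).eval x := by
    by_contra hcon
    push Not at hcon
    obtain ⟨⟨x, hx, hx0⟩, y, hy, hy0⟩ := hcon
    rw [eval_neg, neg_lt_zero] at hy0
    have := isPreconnected_Ioo.intermediate_value hx hy (f := fun z => R.eval z)
      R.continuous.continuousOn
    obtain ⟨z, hz, hz0⟩ := this ⟨hx0.le, hy0.le⟩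
    exact hRne z hz hz0
  have h0 := integral_mul_unitJacobi_eq_zero ha hb hlt
  rw [← hP, hR] at h0
  rcases hsign with h | h
  · have : Q ^ 2 * R = 0 := eq_zero_of_integral_eval_eq_zero ha hb
      (fun x hx => by
        rw [eval_mul, eval_pow]
        exact mul_nonneg (sq_nonneg _) (h x hx))
      (by
        rw [← h0]
        congr 1
        ext x
        simp only [eval_mul, eval_pow]
        ring)
    exact mul_ne_zero (pow_ne_zero 2 hQ0) hR0 this
  · have : Q ^ 2 * (-R) = 0 := eq_zero_of_integral_eval_eq_zero ha hb
      (fun x hx => by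
        rw [eval_mul, eval_pow]
        exact mul_nonneg (sq_nonneg _) (h x hx))
      (by
        rw [← neg_eq_zero, ← integral_neg, ← h0]
        congr 1
        ext x
        simp only [eval_mul, eval_pow, eval_neg]
        ring)
    exact mul_ne_zero (pow_ne_zero 2 hQ0) (neg_ne_zero.2 hR0) this

/-! ### Gauss quadrature -/

/-- The weights of the Gauss quadrature formula. -/
noncomputable def gaussWeight (a b : ℝ) (n : ℕ) (z : ℝ) : ℝ :=
  ∫ x, (Lagrange.basis (unitNodes a b n) id z).eval x ∂(jacobiMeasure a b)

/-- Divide `p` by the Jacobi polynomial `P`. The quotient has degree below `n`, so its product with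
`P` integrates to zero; the remainder is the Lagrange interpolant of `p` at the nodes. -/
theorem gauss_quadrature {a b : ℝ} (ha : -1 < a) (hb : -1 < b) {n : ℕ} {p : ℝ[X]}
    (hp : p.degree < (2 * n : ℕ)) :
    ∫ x, p.eval x ∂(jacobiMeasure a b) = ∑ z ∈ unitNodes a b n, gaussWeight a b n z * p.eval z := by
  set P := unitJacobi a b n with hP
  have hP0 : P ≠ 0 := unitJacobi_ne_zero ha hb n
  have hPd : P.degree = n := by
    rw [degree_eq_natDegree hP0, natDegree_unitJacobi ha hb]
  have hsplit : p = P * (p / P) + p % P := (EuclideanDomain.div_add_mod p P).symm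
  have hmod : (p % P).degree < n := hPd ▸ degree_mod_lt p hP0
  have hdiv : (p / P).degree < n := by
    rcases eq_or_ne (p / P) 0 with h | h
    · rw [h, degree_zero]
      exact WithBot.bot_lt_coe _
    · have h1 : (P * (p / P)).degree < (2 * n : ℕ) := by
        have : P * (p / P) = p - p % P := by
          nth_rewrite 2 [hsplit]
          ring
        rw [this]
        refine (degree_sub_le _ _).trans_lt (max_lt hp (hmod.trans_le ?_))
        exact_mod_cast (by omega : n ≤ 2 * n)
      rw [degree_mul, hPd, degree_eq_natDegree h] at h1
      rw [degree_eq_natDegree h]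
      have h2 : n + (p / P).natDegree < 2 * n := by exact_mod_cast h1
      exact_mod_cast (by omega : (p / P).natDegree < n)
  have h1 : ∫ x, p.eval x ∂(jacobiMeasure a b) = ∫ x, (p % P).eval x ∂(jacobiMeasure a b) := by
    have e : ∀ x, p.eval x = (p / P).eval x * P.eval x + (p % P).eval x := by
      intro x
      nth_rewrite 1 [hsplit]
      rw [eval_add, eval_mul]
      ring
    simp only [e]
    rw [integral_add (integrable_mul_of_memLp (memLp_eval ha hb _) (memLp_eval ha hb _))
      (integrable_eval ha hb _), integral_mul_unitJacobi_eq_zero ha hb hdiv, zero_add]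
  have h2 : p % P = Lagrange.interpolate (unitNodes a b n) id fun z => p.eval z := by
    refine Lagrange.eq_interpolate_of_eval_eq _ (injOn_id _) ?_ fun z hz => ?_
    · rwa [card_unitNodes ha hb]
    · have hz0 : P.eval z = 0 := ((mem_unitNodes ha hb).1 hz).2
      nth_rewrite 2 [hsplit]
      simp [hz0]
  rw [h1, h2]
  simp only [Lagrange.interpolate_apply, eval_finsetSum, eval_mul, eval_C]
  rw [integral_finsetSum]
  · refine Finset.sum_congr rfl fun z _ => ?_
    rw [integral_const_mul, gaussWeight]
    ring
  · intro z _
    exact (integrable_eval ha hb _).const_mul _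

/-! ### Spacing of the zeros -/

theorem jacobiWeight_le_endpoint {a b c d x : ℝ} (ha : 0 ≤ a) (hb : 0 ≤ b) (hc : 0 ≤ c)
    (hd : d ≤ 1) (hx : x ∈ Icc c d) : jacobiWeight a b x ≤ (1 - c) ^ a * d ^ b := by
  unfold jacobiWeight
  have h1 : 0 ≤ 1 - x := by linarith [hx.2]
  have h0 : 0 ≤ x := by linarith [hx.1]
  have := hx.1
  have := hx.2
  have h2 : 0 ≤ 1 - c := by linarith
  gcongr

theorem endpoint_le_jacobiWeight {a b c d x : ℝ} (ha : a ≤ 0) (hb : b ≤ 0)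
    (hx : x ∈ Icc c d) (hx' : x ∈ Ioo (0 : ℝ) 1) :
    (1 - c) ^ a * d ^ b ≤ jacobiWeight a b x := by
  unfold jacobiWeight
  have h1 : 0 < 1 - x := by linarith [hx'.2]
  have h0 : 0 < x := hx'.1
  have h3 : 0 ≤ d ^ b := Real.rpow_nonneg (by linarith [hx.2]) _
  have h4 : 0 ≤ (1 - x) ^ a := Real.rpow_nonneg h1.le _
  exact mul_le_mul (Real.rpow_le_rpow_of_nonpos h1 (by linarith [hx.1]) ha)
    (Real.rpow_le_rpow_of_nonpos h0 hx.2 hb) h3 h4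

/-- A Picone type identity: the left side is the derivative of `φ ^ 2 * w * y' / y`. -/
theorem hasDerivAt_picone {a b : ℝ} {n : ℕ} {φ φ' : ℝ → ℝ} {x : ℝ} (hx : x ∈ Ioo (0 : ℝ) 1)
    (hφ : HasDerivAt φ (φ' x) x) (hy : (unitJacobi a b n).eval x ≠ 0) :
    HasDerivAt (fun t => φ t ^ 2 * (jacobiWeight (a + 1) (b + 1) t
        * (derivative (unitJacobi a b n)).eval t / (unitJacobi a b n).eval t))
      (jacobiWeight (a + 1) (b + 1) x * φ' x ^ 2
        - jacobiEigenvalue a b n * (jacobiWeight a b x * φ x ^ 2)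
        - jacobiWeight (a + 1) (b + 1) x * (φ' x - φ x * (derivative (unitJacobi a b n)).eval x
          / (unitJacobi a b n).eval x) ^ 2) x := by
  have d1 := hasDerivAt_jacobiWeight_mul a b (derivative (unitJacobi a b n)) hx
  have d2 := (unitJacobi a b n).hasDerivAt x
  have d3 := (hφ.pow 2).mul (d1.div d2 hy)
  have h1 : (adjDeriv a b (derivative (unitJacobi a b n))).eval x
      = -(jacobiEigenvalue a b n * (unitJacobi a b n).eval x) := by
    have := congrArg (eval x) (jacobiOp_unitJacobi a b n)
    simpa [jacobiOp] using this
  refine d3.congr_deriv ?_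
  rw [h1]
  simp only [Pi.pow_apply, Pi.div_apply]
  field_simp
  ring

/-- A Sturm type argument. Picone's identity with the test function `(x - c)(d - x)` gives `l ∫ w
φ^2 ≤ ∫ w₁ φ'^2` on a zero-free interval, where `w` and `w₁` have exponents `a, b` and `a + 1, b +
1`. Replacing `w₁` by its upper bound `A` and `w` by its lower bound `B` leaves elementary
integrals. -/
theorem eigenvalue_mul_sq_le_of_ne_zero {a b : ℝ} (ha : -1 < a) (ha0 : a ≤ 0) (hb : -1 < b)
    (hb0 : b ≤ 0) {n : ℕ} {c d : ℝ} (hc : 0 < c) (hd : d < 1) (hcd : c < d)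
    (hne : ∀ x ∈ Icc c d, (unitJacobi a b n).eval x ≠ 0) :
    jacobiEigenvalue a b n * (d - c) ^ 2 ≤ 10 * (d * (1 - c)) := by
  have hl0 := jacobiEigenvalue_nonneg ha hb n
  set l := jacobiEigenvalue a b n with hl
  set φ : ℝ → ℝ := fun x => (x - c) * (d - x) with hφ
  set φ' : ℝ → ℝ := fun x => d + c - 2 * x with hφ'
  have hφd : ∀ x, HasDerivAt φ (φ' x) x := by
    intro x
    refine (((hasDerivAt_id x).sub_const c).mul ((hasDerivAt_id x).const_sub d)).congr_deriv ?_
    simp only [hφ', id]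
    ring
  set G : ℝ → ℝ := fun t => φ t ^ 2 * (jacobiWeight (a + 1) (b + 1) t
        * (derivative (unitJacobi a b n)).eval t / (unitJacobi a b n).eval t) with hG
  set A : ℝ := (1 - c) ^ (a + 1) * d ^ (b + 1) with hA
  set B : ℝ := (1 - c) ^ a * d ^ b with hB
  have hB0 : 0 < B := mul_pos (Real.rpow_pos_of_pos (by linarith) _)
    (Real.rpow_pos_of_pos (by linarith) _)
  have hAB : A = (d * (1 - c)) * B := by
    rw [hA, hB, Real.rpow_add_one (by linarith), Real.rpow_add_one (by linarith)]
    ring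
  set L := d - c with hL
  -- The primitive, vanishing at `c`, of `A φ'^2 - l B φ^2`. Comparing `G` with `Z` by monotonicity
  -- replaces an integration of Picone's identity.
  set Z : ℝ → ℝ := fun x => A * (L ^ 2 * (x - c) - 2 * L * (x - c) ^ 2 + 4 / 3 * (x - c) ^ 3)
    - l * B * (L ^ 2 * (x - c) ^ 3 / 3 - L * (x - c) ^ 4 / 2 + (x - c) ^ 5 / 5) with hZ
  have hZd : ∀ x, HasDerivAt Z (A * φ' x ^ 2 - l * B * φ x ^ 2) x := by
    intro x
    have e := (hasDerivAt_id x).sub_const c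
    have d1 := (((e.const_mul (L ^ 2)).sub ((e.pow 2).const_mul (2 * L))).add
      ((e.pow 3).const_mul (4 / 3))).const_mul A
    have d2 := (((((e.pow 3).const_mul (L ^ 2)).div_const 3).sub
      (((e.pow 4).const_mul L).div_const 2)).add ((e.pow 5).div_const 5)).const_mul (l * B)
    refine (d1.sub d2).congr_deriv ?_
    simp only [hφ', hφ, hL, id]
    push_cast
    ring
  have hanti : AntitoneOn (fun x => G x - Z x) (Icc c d) := by
    have hder : ∀ x ∈ Icc c d, HasDerivAt (fun x => G x - Z x) _ x := fun x hx =>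
      (hasDerivAt_picone (a := a) (b := b) (n := n) (φ := φ) (φ' := φ')
        ⟨hc.trans_le hx.1, hx.2.trans_lt hd⟩ (hφd x) (hne x hx)).sub (hZd x)
    refine antitoneOn_of_deriv_nonpos (convex_Icc c d)
      (fun x hx => (hder x hx).continuousAt.continuousWithinAt)
      (fun x hx => (hder x (interior_subset hx)).differentiableAt.differentiableWithinAt)
      fun x hx => ?_
    have hx := interior_subset hx
    have hx1 : x ∈ Ioo (0 : ℝ) 1 := ⟨hc.trans_le hx.1, hx.2.trans_lt hd⟩
    rw [(hder x hx).deriv]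
    have w1 : jacobiWeight (a + 1) (b + 1) x ≤ A :=
      jacobiWeight_le_endpoint (by linarith) (by linarith) hc.le hd.le hx
    have w2 : B ≤ jacobiWeight a b x := endpoint_le_jacobiWeight ha0 hb0 hx hx1
    have w3 := (jacobiWeight_pos (a + 1) (b + 1) hx1).le
    have i1 := mul_le_mul_of_nonneg_right w1 (sq_nonneg (φ' x))
    have i2 := mul_le_mul_of_nonneg_left
      (mul_le_mul_of_nonneg_right w2 (sq_nonneg (φ x))) hl0
    have i3 := mul_nonneg w3 (sq_nonneg (φ' x - φ x * (derivative (unitJacobi a b n)).eval x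
          / (unitJacobi a b n).eval x))
    linarith
  have h1 := hanti (left_mem_Icc.2 hcd.le) (right_mem_Icc.2 hcd.le) hcd.le
  have hLpos : 0 < L := by linarith
  -- `G` vanishes at both ends because `φ` does, so `Z d ≥ 0`; here `∫ φ'^2 = L^3 / 3` and `∫ φ^2 =
  -- L^5 / 30`.
  have h2 : l * B * (L ^ 5 / 30) ≤ A * (L ^ 3 / 3) := by
    have e1 : G c = 0 := by simp [hG, hφ]
    have e2 : G d = 0 := by simp [hG, hφ]
    have e3 : Z c = 0 := by simp [hZ]
    have e4 : Z d = A * (L ^ 3 / 3) - l * B * (L ^ 5 / 30) := by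
      simp only [hZ, ← hL]
      ring
    simp only [e1, e2, e3, e4] at h1
    linarith
  rw [hAB] at h2
  have h3 : (B * L ^ 3 / 30) * (l * L ^ 2) ≤ (B * L ^ 3 / 30) * (10 * (d * (1 - c))) := by
    linarith
  exact le_of_mul_le_mul_left h3 (by positivity)

/-- The interval is shrunk by `ε` at both ends and `ε → 0`, which admits zeros at `c`, `d` and the
endpoints `0`, `1`. -/
theorem eigenvalue_mul_sq_le_of_gap {a b : ℝ} (ha : -1 < a) (ha0 : a ≤ 0) (hb : -1 < b)
    (hb0 : b ≤ 0) {n : ℕ} {c d : ℝ} (hc : 0 ≤ c) (hd : d ≤ 1) (hcd : c < d)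
    (hne : ∀ x ∈ Ioo c d, (unitJacobi a b n).eval x ≠ 0) :
    jacobiEigenvalue a b n * (d - c) ^ 2 ≤ 10 * (d * (1 - c)) := by
  have h1 : Tendsto (fun ε : ℝ => jacobiEigenvalue a b n * ((d - ε) - (c + ε)) ^ 2) (𝓝[>] 0)
      (𝓝 (jacobiEigenvalue a b n * ((d - 0) - (c + 0)) ^ 2)) :=
    ((by fun_prop : Continuous fun ε : ℝ =>
      jacobiEigenvalue a b n * ((d - ε) - (c + ε)) ^ 2).tendsto 0).mono_left nhdsWithin_le_nhds
  have h2 : Tendsto (fun ε : ℝ => 10 * ((d - ε) * (1 - (c + ε)))) (𝓝[>] 0)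
      (𝓝 (10 * ((d - 0) * (1 - (c + 0))))) :=
    ((by fun_prop : Continuous fun ε : ℝ => 10 * ((d - ε) * (1 - (c + ε)))).tendsto 0).mono_left
      nhdsWithin_le_nhds
  have h3 := le_of_tendsto_of_tendsto h1 h2 (by
    filter_upwards [Ioo_mem_nhdsGT (show (0 : ℝ) < (d - c) / 2 by linarith)] with ε hε
    exact eigenvalue_mul_sq_le_of_ne_zero ha ha0 hb hb0 (by linarith [hε.1]) (by linarith [hε.1])
      (by linarith [hε.2]) fun x hx => hne x ⟨by linarith [hx.1, hε.1], by linarith [hx.2, hε.1]⟩)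
  simpa using h3

theorem sq_le_jacobiEigenvalue {a b : ℝ} (ha : -1 < a) (hb : -1 < b) (N : ℕ) :
    (N : ℝ) ^ 2 ≤ jacobiEigenvalue a b (N + 1) := by
  unfold jacobiEigenvalue
  push_cast
  have : (0 : ℝ) ≤ N := Nat.cast_nonneg N
  nlinarith

/-- The square root of the previous estimate; `4` serves because `10 ≤ 16`. -/
theorem mul_gap_le {a b : ℝ} (ha : -1 < a) (ha0 : a ≤ 0) (hb : -1 < b)
    (hb0 : b ≤ 0) {N : ℕ} {c d : ℝ} (hc : 0 ≤ c) (hd : d ≤ 1) (hcd : c < d)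
    (hne : ∀ x ∈ Ioo c d, (unitJacobi a b (N + 1)).eval x ≠ 0) :
    N * (d - c) ≤ 4 * (d ^ (1 / 2 : ℝ) * (1 - c) ^ (1 / 2 : ℝ)) := by
  have h1 := eigenvalue_mul_sq_le_of_gap ha ha0 hb hb0 hc hd hcd hne
  have h2 := sq_le_jacobiEigenvalue ha hb N
  have hd0 : 0 < d := by linarith
  have hc1 : 0 < 1 - c := by linarith
  rw [← Real.sqrt_eq_rpow, ← Real.sqrt_eq_rpow]
  refine abs_le_of_sq_le_sq' ?_ (by positivity) |>.2
  rw [mul_pow, mul_pow, mul_pow, Real.sq_sqrt hd0.le, Real.sq_sqrt hc1.le]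
  have := mul_pos hd0 hc1
  nlinarith [sq_nonneg (d - c)]

/-- The mass of a gap between zeros, for a general weight with exponents in `(-1, 0]`. -/
theorem mul_integral_gap_le {a b : ℝ} (ha : -1 < a) (ha0 : a ≤ 0) (hb : -1 < b)
    (hb0 : b ≤ 0) {p q : ℝ} (hp : -1 < p) (hp0 : p ≤ 0) (hq : -1 < q) (hq0 : q ≤ 0)
    {N : ℕ} {c d : ℝ} (hc : 0 ≤ c) (hd : d ≤ 1) (hcd : c < d)
    (hne : ∀ x ∈ Ioo c d, (unitJacobi a b (N + 1)).eval x ≠ 0) :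
    N * ∫ x in Ioo c d, jacobiWeight p q x
      ≤ 4 * (2 / (p + 1) + 2 / (q + 1)) * ((1 - c) ^ (p + 1 / 2) * d ^ (q + 1 / 2)) := by
  have h1 := mul_le_mul_of_nonneg_left (integral_jacobiWeight_le hp hp0 hq hq0 hc hd hcd)
    (Nat.cast_nonneg (α := ℝ) N)
  have hd0 : 0 < d := by linarith
  have hc1 : 0 < 1 - c := by linarith
  have h2 := mul_gap_le ha ha0 hb hb0 hc hd hcd hne
  have hC : 0 < 2 / (p + 1) + 2 / (q + 1) :=
    add_pos (div_pos two_pos (by linarith)) (div_pos two_pos (by linarith))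
  refine h1.trans ?_
  rw [Real.rpow_add hd0, Real.rpow_add hc1]
  have h3 : 0 < d ^ q * (1 - c) ^ p := mul_pos (Real.rpow_pos_of_pos hd0 _)
    (Real.rpow_pos_of_pos hc1 _)
  have h4 := mul_le_mul_of_nonneg_left h2 (mul_pos hC h3).le
  linarith

/-- As `a + 1/2` and `b + 1/2` are nonpositive, the endpoint value is a minimum over the gap, so it
can be replaced by the weight at any point `y`. -/
theorem mul_integral_gap_le_jacobiWeight {a b : ℝ} (ha : -1 < a) (ha' : a ≤ -1 / 2) (hb : -1 < b)
    (hb' : b ≤ -1 / 2) {N : ℕ} {c d y : ℝ} (hc : 0 ≤ c) (hd : d ≤ 1) (hy : y ∈ Ioo c d)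
    (hne : ∀ x ∈ Ioo c d, (unitJacobi a b (N + 1)).eval x ≠ 0) :
    N * ∫ x in Ioo c d, jacobiWeight a b x
      ≤ 4 * (2 / (a + 1) + 2 / (b + 1)) * jacobiWeight (a + 1 / 2) (b + 1 / 2) y := by
  refine (mul_integral_gap_le ha (by linarith) hb (by linarith) ha (by linarith) hb (by linarith)
    hc hd (hy.1.trans hy.2) hne).trans ?_
  have hC : 0 < 2 / (a + 1) + 2 / (b + 1) :=
    add_pos (div_pos two_pos (by linarith)) (div_pos two_pos (by linarith))
  refine mul_le_mul_of_nonneg_left ?_ (by positivity)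
  exact endpoint_le_jacobiWeight (by linarith) (by linarith) (Ioo_subset_Icc_self hy)
    ⟨hc.trans_lt hy.1, hy.2.trans_le hd⟩

/-- For `p = -(a + 1)` the exponent `p + 1/2` is nonnegative, so the endpoint factors are at most
`1`, and `p + 1 = -a ≥ 1/2`; the same holds for `b`. The constant is `4 (4 + 4)`. -/
theorem mul_integral_gap_inv_le {a b : ℝ} (ha : -1 < a) (ha' : a ≤ -1 / 2) (hb : -1 < b)
    (hb' : b ≤ -1 / 2) {N : ℕ} {c d : ℝ} (hc : 0 ≤ c) (hd : d ≤ 1) (hcd : c < d)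
    (hne : ∀ x ∈ Ioo c d, (unitJacobi a b (N + 1)).eval x ≠ 0) :
    N * ∫ x in Ioo c d, jacobiWeight (-(a + 1)) (-(b + 1)) x ≤ 32 := by
  refine (mul_integral_gap_le ha (by linarith) hb (by linarith) (by linarith) (by linarith)
    (by linarith) (by linarith) hc hd hcd hne).trans ?_
  have h1 : 2 / (-(a + 1) + 1) ≤ 4 := by
    rw [div_le_iff₀ (by linarith)]
    linarith
  have h2 : 2 / (-(b + 1) + 1) ≤ 4 := by
    rw [div_le_iff₀ (by linarith)]
    linarith
  have h3 : (1 - c) ^ (-(a + 1) + 1 / 2) ≤ 1 :=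
    Real.rpow_le_one (by linarith) (by linarith) (by linarith)
  have h4 : d ^ (-(b + 1) + 1 / 2) ≤ 1 :=
    Real.rpow_le_one (by linarith) (by linarith) (by linarith)
  have h5 : 0 ≤ (1 - c) ^ (-(a + 1) + 1 / 2) := Real.rpow_nonneg (by linarith) _
  have h6 : 0 ≤ d ^ (-(b + 1) + 1 / 2) := Real.rpow_nonneg (by linarith) _
  calc 4 * (2 / (-(a + 1) + 1) + 2 / (-(b + 1) + 1))
        * ((1 - c) ^ (-(a + 1) + 1 / 2) * d ^ (-(b + 1) + 1 / 2))
      ≤ 4 * (4 + 4) * (1 * 1) := by gcongr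
    _ = 32 := by norm_num

/-- Every point other than a node lies in a gap. -/
theorem exists_gap {S : Finset ℝ} {y : ℝ}
    (hy : y ∈ Ioo (0 : ℝ) 1) (hyS : y ∉ S) :
    ∃ c d, 0 ≤ c ∧ d ≤ 1 ∧ y ∈ Ioo c d ∧ (∀ x ∈ Ioo c d, x ∉ S) ∧ (c ∈ S ∨ c = 0) ∧
      (d ∈ S ∨ d = 1) := by
  obtain ⟨c, hc, hcm⟩ := Finset.exists_max_image (insert 0 (S.filter (· < y))) id
    (Finset.insert_nonempty _ _)
  obtain ⟨d, hd, hdm⟩ := Finset.exists_min_image (insert 1 (S.filter (y < ·))) id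
    (Finset.insert_nonempty _ _)
  simp only [Finset.mem_insert, Finset.mem_filter, id, forall_eq_or_imp] at hc hd hcm hdm
  refine ⟨c, d, hcm.1, hdm.1, ⟨?_, ?_⟩, ?_, ?_, ?_⟩
  · rcases hc with rfl | hc
    exacts [hy.1, hc.2]
  · rcases hd with rfl | hd
    exacts [hy.2, hd.2]
  · intro x hx hxS
    rcases lt_trichotomy x y with h | rfl | h
    · exact absurd (hcm.2 x ⟨hxS, h⟩) (not_le.2 hx.1)
    · exact hyS hxS
    · exact absurd (hdm.2 x ⟨hxS, h⟩) (not_le.2 hx.2)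
  · rcases hc with h | h
    exacts [Or.inr h, Or.inl h.1]
  · rcases hd with h | h
    exacts [Or.inr h, Or.inl h.1]

/-! ### The Peano kernel of the Gauss quadrature formula -/

/-- The distribution function of the Jacobi weight. -/
noncomputable def weightCdf (a b y : ℝ) : ℝ := ∫ x in 0..y, jacobiWeight a b x

/-- The Peano kernel of the Gauss quadrature formula. -/
noncomputable def gaussKernel (a b : ℝ) (n : ℕ) (y : ℝ) : ℝ :=
  ∑ z ∈ unitNodes a b n with z ≤ y, gaussWeight a b n z - weightCdf a b y

theorem intervalIntegrable_jacobiWeight {a b : ℝ} (ha : -1 < a) (hb : -1 < b) :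
    IntervalIntegrable (jacobiWeight a b) volume 0 1 :=
  (intervalIntegrable_iff_integrableOn_Ioo_of_le zero_le_one).2 (integrableOn_jacobiWeight ha hb)

theorem hasL1Deriv_weightCdf {a b : ℝ} (ha : -1 < a) (hb : -1 < b) :
    HasL1Deriv (weightCdf a b) (jacobiWeight a b) :=
  ⟨intervalIntegrable_jacobiWeight ha hb, fun x _ => by simp [weightCdf]⟩

theorem weightCdf_sub {a b : ℝ} (ha : -1 < a) (hb : -1 < b) {c d : ℝ} (hc : 0 ≤ c) (hcd : c ≤ d)
    (hd : d ≤ 1) : weightCdf a b d - weightCdf a b c = ∫ x in Ioo c d, jacobiWeight a b x := by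
  have hi := intervalIntegrable_jacobiWeight ha hb
  have hsub : ∀ y ∈ Icc (0 : ℝ) 1, IntervalIntegrable (jacobiWeight a b) volume 0 y := by
    intro y hy
    refine hi.mono_set ?_
    rw [uIcc_of_le hy.1, uIcc_of_le zero_le_one]
    exact Icc_subset_Icc_right hy.2
  unfold weightCdf
  rw [intervalIntegral.integral_interval_sub_left (hsub d ⟨hc.trans hcd, hd⟩)
    (hsub c ⟨hc, hcd.trans hd⟩), intervalIntegral.integral_of_le hcd, integral_Ioc_eq_integral_Ioo]

theorem weightCdf_strictMonoOn {a b : ℝ} (ha : -1 < a) (hb : -1 < b) :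
    StrictMonoOn (weightCdf a b) (Icc 0 1) := by
  intro c hc d hd hcd
  have h := weightCdf_sub ha hb hc.1 hcd.le hd.2
  have hpos : 0 < ∫ x in Ioo c d, jacobiWeight a b x := by
    rw [setIntegral_pos_iff_support_of_nonneg_ae]
    · have : Ioo c d ⊆ Function.support (jacobiWeight a b) ∩ Ioo c d := fun x hx =>
        ⟨(jacobiWeight_pos a b ⟨hc.1.trans_lt hx.1, hx.2.trans_le hd.2⟩).ne', hx⟩
      refine lt_of_lt_of_le ?_ (measure_mono this)
      simpa using hcd
    · filter_upwards [ae_restrict_mem measurableSet_Ioo] with x hx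
      exact (jacobiWeight_pos a b ⟨hc.1.trans_lt hx.1, hx.2.trans_le hd.2⟩).le
    · exact (integrableOn_jacobiWeight ha hb).mono_set (Ioo_subset_Ioo hc.1 hd.2)
  linarith

theorem weightCdf_zero (a b : ℝ) : weightCdf a b 0 = 0 := by simp [weightCdf]

theorem weightCdf_one {a b : ℝ} (ha : -1 < a) (hb : -1 < b) {n : ℕ} (hn : 0 < n) :
    weightCdf a b 1 = ∑ z ∈ unitNodes a b n, gaussWeight a b n z := by
  have h := gauss_quadrature ha hb (n := n) (p := 1) (by
    rw [degree_one]
    exact_mod_cast (by omega : 0 < 2 * n))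
  simp only [eval_one, mul_one] at h
  rw [← h, integral_jacobiMeasure]
  simp only [mul_one]
  have h2 := weightCdf_sub ha hb le_rfl zero_le_one le_rfl
  rwa [weightCdf_zero, sub_zero] at h2

theorem intervalIntegrable_indicator_mul {f : ℝ → ℝ} (hf : IntervalIntegrable f volume 0 1)
    (S : Finset ℝ) (c : ℝ → ℝ) :
    IntervalIntegrable (fun y => (∑ z ∈ S with z ≤ y, c z) * f y) volume 0 1 := by
  have e : (fun y => (∑ z ∈ S with z ≤ y, c z) * f y)
      = fun y => ∑ z ∈ S, c z * (Ici z).indicator f y := by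
    ext y
    rw [Finset.sum_filter, Finset.sum_mul]
    refine Finset.sum_congr rfl fun z _ => ?_
    by_cases h : z ≤ y <;> simp [h]
  have : ∀ z, IntervalIntegrable (fun y => c z * (Ici z).indicator f y) volume 0 1 := fun z => by
    refine IntervalIntegrable.const_mul ?_ _
    rw [intervalIntegrable_iff] at hf ⊢
    exact hf.indicator measurableSet_Ici
  rw [e, ← Finset.sum_fn]
  exact IntervalIntegrable.sum S fun z _ => this z

theorem intervalIntegrable_gaussKernel_mul {a b : ℝ} (ha : -1 < a) (hb : -1 < b) (n : ℕ)
    {f : ℝ → ℝ} (hf : IntervalIntegrable f volume 0 1) :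
    IntervalIntegrable (fun y => gaussKernel a b n y * f y) volume 0 1 := by
  have h1 := intervalIntegrable_indicator_mul hf (unitNodes a b n) (gaussWeight a b n)
  have hc := (hasL1Deriv_weightCdf ha hb).continuousOn
  rw [← uIcc_of_le (zero_le_one' ℝ)] at hc
  have h2 := hf.continuousOn_mul hc
  refine (h1.sub h2).congr fun y _ => ?_
  simp only [gaussKernel]
  ring

/-- The error of the Gauss quadrature formula in terms of the Peano kernel. -/
theorem quadrature_sub_integral {a b : ℝ} (ha : -1 < a) (hb : -1 < b) {n : ℕ} (hn : 0 < n)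
    {F f : ℝ → ℝ} (hF : HasL1Deriv F f) :
    ∑ z ∈ unitNodes a b n, gaussWeight a b n z * F z - ∫ x, F x ∂(jacobiMeasure a b)
      = -∫ y in 0..1, gaussKernel a b n y * f y := by
  have hW := hasL1Deriv_weightCdf ha hb
  have hc := hW.continuousOn
  have hFc := hF.continuousOn
  rw [← uIcc_of_le (zero_le_one' ℝ)] at hc hFc
  have i1 := hF.integrable.continuousOn_mul hc
  have i2 := hW.integrable.mul_continuousOn hFc
  -- The integral is integrated by parts, and below each `F z` is written as `F 1` minus an integral
  -- of `f` over `[z, 1]`. The two contributions of `F 1` cancel, since the Gauss weights add up to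
  -- the total mass.
  have h1 := (hW.mul hF).eq_integral 1 ⟨zero_le_one, le_rfl⟩
  rw [intervalIntegral.integral_add i2 i1, weightCdf_zero, zero_mul, zero_add] at h1
  have h2 : ∫ x, F x ∂(jacobiMeasure a b) = ∫ x in 0..1, jacobiWeight a b x * F x := by
    rw [integral_jacobiMeasure, intervalIntegral.integral_of_le zero_le_one,
      integral_Ioc_eq_integral_Ioo]
  have h3 : ∀ z ∈ unitNodes a b n, ∫ y in 0..1, (Ici z).indicator f y = F 1 - F z := by
    intro z hz
    have hz1 := ((mem_unitNodes ha hb).1 hz).1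
    have e1 : ∫ y in 0..1, (Ici z).indicator f y = ∫ y in z..1, f y := by
      rw [intervalIntegral.integral_of_le zero_le_one, intervalIntegral.integral_of_le hz1.2.le,
        setIntegral_indicator measurableSet_Ici]
      have : Ioc (0 : ℝ) 1 ∩ Ici z = Icc z 1 := by
        ext y
        simp only [mem_inter_iff, mem_Ioc, mem_Ici, mem_Icc]
        constructor
        · rintro ⟨⟨_, h⟩, h'⟩
          exact ⟨h', h⟩
        · rintro ⟨h, h'⟩
          exact ⟨⟨hz1.1.trans_le h, h'⟩, h⟩
      rw [this, integral_Icc_eq_integral_Ioc]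
    have hsub : uIcc 0 z ⊆ uIcc (0 : ℝ) 1 := by
      rw [uIcc_of_le hz1.1.le, uIcc_of_le zero_le_one]
      exact Icc_subset_Icc_right hz1.2.le
    rw [e1, ← intervalIntegral.integral_interval_sub_left hF.integrable
      (hF.integrable.mono_set hsub), hF.eq_integral 1 ⟨zero_le_one, le_rfl⟩,
      hF.eq_integral z ⟨hz1.1.le, hz1.2.le⟩]
    ring
  have h4 : ∫ y in 0..1, (∑ z ∈ unitNodes a b n with z ≤ y, gaussWeight a b n z) * f y
      = ∑ z ∈ unitNodes a b n, gaussWeight a b n z * (F 1 - F z) := by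
    have e : ∀ y, (∑ z ∈ unitNodes a b n with z ≤ y, gaussWeight a b n z) * f y
        = ∑ z ∈ unitNodes a b n, gaussWeight a b n z * (Ici z).indicator f y := by
      intro y
      rw [Finset.sum_filter, Finset.sum_mul]
      refine Finset.sum_congr rfl fun z _ => ?_
      by_cases h : z ≤ y <;> simp [h]
    simp only [e]
    rw [intervalIntegral.integral_finsetSum]
    · refine Finset.sum_congr rfl fun z hz => ?_
      rw [intervalIntegral.integral_const_mul, h3 z hz]
    · intro z _
      refine IntervalIntegrable.const_mul ?_ _
      have := hF.integrable
      rw [intervalIntegrable_iff] at this ⊢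
      exact this.indicator measurableSet_Ici
  have h5 : ∫ y in 0..1, gaussKernel a b n y * f y
      = (∫ y in 0..1, (∑ z ∈ unitNodes a b n with z ≤ y, gaussWeight a b n z) * f y)
        - ∫ y in 0..1, weightCdf a b y * f y := by
    rw [← intervalIntegral.integral_sub
      (intervalIntegrable_indicator_mul hF.integrable _ _) i1]
    congr 1
    ext y
    simp only [gaussKernel]
    ring
  rw [h5, h4, h2]
  simp only [mul_sub]
  rw [Finset.sum_sub_distrib, ← Finset.sum_mul, ← weightCdf_one ha hb hn]
  linarith

theorem exists_derivative_eq (r : ℝ[X]) :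
    ∃ q : ℝ[X], derivative q = r ∧ q.natDegree ≤ r.natDegree + 1 := by
  refine ⟨∑ k ∈ Finset.range (r.natDegree + 1), C (r.coeff k / (k + 1)) * X ^ (k + 1), ?_, ?_⟩
  · rw [derivative_sum]
    refine Eq.trans ?_ r.as_sum_range_C_mul_X_pow.symm
    refine Finset.sum_congr rfl fun k _ => ?_
    rw [derivative_C_mul_X_pow]
    congr 2
    push_cast
    field_simp
  · refine natDegree_sum_le_of_forall_le _ _ fun k hk => ?_
    refine (natDegree_C_mul_X_pow_le _ _).trans ?_
    have := Finset.mem_range.1 hk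
    omega

/-- The crossing point of a monotone continuous function with a level in an interval. -/
theorem exists_crossing {W : ℝ → ℝ} {p s : ℝ} (hps : p < s) (hW : StrictMonoOn W (Icc p s))
    (hc : ContinuousOn W (Icc p s)) (A : ℝ) :
    ∃ y ∈ Icc p s, (∀ t ∈ Icc p s, t ≤ y → y ≠ p → W t ≤ A) ∧
      (∀ t ∈ Icc p s, y ≤ t → y ≠ s → A ≤ W t) ∧ (A < W p → y = p) ∧ (W s < A → y = s) := by
  have hp : p ∈ Icc p s := left_mem_Icc.2 hps.le
  have hs : s ∈ Icc p s := right_mem_Icc.2 hps.le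
  have hlt := hW hp hs hps
  -- A level outside the range of `W` is clamped: to `p` when too low, to `s` when too high.
  rcases le_or_gt A (W p) with h | h
  · exact ⟨p, hp, fun t _ _ h' => absurd rfl h', fun t ht _ _ =>
      h.trans (hW.monotoneOn hp ht ht.1), fun _ => rfl, fun h' => absurd h' (by linarith)⟩
  rcases le_or_gt (W s) A with h1 | h1
  · exact ⟨s, hs, fun t ht _ _ => (hW.monotoneOn ht hs ht.2).trans h1,
      fun t _ _ h' => absurd rfl h', fun h' => absurd h' (by linarith), fun _ => rfl⟩
  obtain ⟨y, hy, rfl⟩ := intermediate_value_Icc hps.le hc ⟨h.le, h1.le⟩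
  exact ⟨y, hy, fun t ht hty _ => hW.monotoneOn ht hy hty, fun t ht hty _ =>
    hW.monotoneOn hy ht hty, fun h' => absurd h' (by linarith), fun h' => absurd h' (by linarith)⟩

/-- A polynomial of degree `≤ 2n - 1` with the same sign as the Peano kernel cannot have a
double zero. -/
theorem not_sq_dvd_of_gaussKernel_mul_nonneg {a b : ℝ} (ha : -1 < a) (hb : -1 < b) {n : ℕ}
    {q : ℝ[X]} (hq0 : q ≠ 0) (hqd : q.natDegree < 2 * n)
    (hs : ∀ y ∈ Ioo (0 : ℝ) 1, y ∉ unitNodes a b n → 0 ≤ gaussKernel a b n y * q.eval y)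
    (z : ℝ) : ¬ (X - C z) ^ 2 ∣ q := by
  rintro ⟨r, hr⟩
  have hn : 0 < n := by omega
  have hr0 : r ≠ 0 := by
    rintro rfl
    exact hq0 (by simpa using hr)
  have hrd : r.natDegree + 2 = q.natDegree := by
    rw [hr, natDegree_mul (pow_ne_zero _ (X_sub_C_ne_zero z)) hr0, natDegree_pow,
      natDegree_X_sub_C]
    ring
  -- A primitive `Q` of `r` has degree at most `2n - 2`, so the quadrature is exact for it and the
  -- kernel integrates to zero against `r`. But their product is nonnegative.
  obtain ⟨Q, hQ, hQd⟩ := exists_derivative_eq r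
  have h1 := quadrature_sub_integral ha hb hn (hasL1Deriv_eval Q)
  rw [gauss_quadrature ha hb (degree_le_natDegree.trans_lt (by
    exact_mod_cast (by omega : Q.natDegree < 2 * n))), sub_self, hQ] at h1
  have h2 := neg_eq_zero.1 h1.symm
  rw [intervalIntegral.integral_of_le zero_le_one, integral_Ioc_eq_integral_Ioo] at h2
  have hi : IntegrableOn (fun y => gaussKernel a b n y * r.eval y) (Ioo 0 1) :=
    (intervalIntegrable_iff_integrableOn_Ioo_of_le zero_le_one).1
      (intervalIntegrable_gaussKernel_mul ha hb n (r.continuous.intervalIntegrable 0 1))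
  have hne : ∀ᵐ y ∂(volume.restrict (Ioo (0 : ℝ) 1)), y ∉ insert z (unitNodes a b n) :=
    ae_restrict_of_ae (measure_eq_zero_iff_ae_notMem.1
      ((insert z (unitNodes a b n)).finite_toSet.measure_zero volume))
  have hnn : 0 ≤ᵐ[volume.restrict (Ioo (0 : ℝ) 1)] fun y => gaussKernel a b n y * r.eval y := by
    filter_upwards [hne, ae_restrict_mem measurableSet_Ioo] with y hy hy1
    simp only [Finset.mem_insert, not_or] at hy
    have h3 := hs y hy1 hy.2
    rw [hr, eval_mul, eval_pow, eval_sub, eval_X, eval_C] at h3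
    have h4 : 0 < (y - z) ^ 2 := by
      have := sub_ne_zero.2 hy.1
      positivity
    refine nonneg_of_mul_nonneg_right (a := (y - z) ^ 2) ?_ h4
    linarith
  rw [integral_eq_zero_iff_of_nonneg_ae hnn hi] at h2
  have hcard := card_unitNodes ha hb n
  have hSne : (unitNodes a b n).Nonempty := Finset.card_pos.1 (by rwa [hcard])
  set m := (unitNodes a b n).max' hSne with hm
  have hm1 := ((mem_unitNodes ha hb).1 ((unitNodes a b n).max'_mem hSne)).1
  refine hr0 (eq_zero_of_ae_eval_eq_zero hm1.2 ?_)
  filter_upwards [ae_restrict_of_ae_restrict_of_subset (Ioo_subset_Ioo_left hm1.1.le) h2,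
    ae_restrict_mem measurableSet_Ioo] with y hy hy1
  -- To the right of the last node the kernel is the remaining mass, which is positive; so `r`
  -- vanishes on an interval.
  have hK : 0 < gaussKernel a b n y := by
    have : (unitNodes a b n).filter (fun z => z ≤ y) = unitNodes a b n :=
      Finset.filter_true_of_mem fun z hz => ((unitNodes a b n).le_max' z hz).trans hy1.1.le
    unfold gaussKernel
    rw [this, ← weightCdf_one ha hb hn, sub_pos]
    exact weightCdf_strictMonoOn ha hb ⟨hm1.1.le.trans hy1.1.le, hy1.2.le⟩
      ⟨zero_le_one, le_rfl⟩ hy1.2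
  exact (mul_eq_zero.1 hy).resolve_left hK.ne'

theorem filter_le_eq_of_gap {S : Finset ℝ} {p s y : ℝ} (hgap : ∀ x ∈ Ioo p s, x ∉ S)
    (hy : y ∈ Ico p s) : S.filter (fun z => z ≤ y) = S.filter (fun z => z ≤ p) := by
  refine Finset.filter_congr fun z hz => ⟨fun h => ?_, fun h => h.trans hy.1⟩
  by_contra hzp
  exact hgap z ⟨not_le.1 hzp, h.trans_lt hy.2⟩ hz

/-- The Chebyshev-Markov-Stieltjes inequalities, at an interior gap. -/
theorem chebyshev_markov_stieltjes {a b : ℝ} (ha : -1 < a) (hb : -1 < b) {n : ℕ} {c d : ℝ}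
    (hc : c ∈ unitNodes a b n) (hd : d ∈ unitNodes a b n) (hcd : c < d)
    (hgap : ∀ x ∈ Ioo c d, x ∉ unitNodes a b n) :
    weightCdf a b c ≤ ∑ z ∈ unitNodes a b n with z ≤ c, gaussWeight a b n z ∧
      ∑ z ∈ unitNodes a b n with z ≤ c, gaussWeight a b n z ≤ weightCdf a b d := by
  set S := unitNodes a b n with hS
  set A : ℝ → ℝ := fun p => ∑ z ∈ S with z ≤ p, gaussWeight a b n z with hA
  set W := weightCdf a b with hW
  have hS01 : ∀ z ∈ S, z ∈ Ioo (0 : ℝ) 1 := fun z hz => ((mem_unitNodes ha hb).1 hz).1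
  have hmono := weightCdf_strictMonoOn ha hb
  have hcont := (hasL1Deriv_weightCdf ha hb).continuousOn
  set m := S.max' ⟨c, hc⟩ with hm
  have hmS : m ∈ S := S.max'_mem _
  have hle : ∀ z ∈ S, z ≤ m := fun z hz => S.le_max' z hz
  set T := S.erase m with hT
  -- For every node `p` but the last: `s` is the next node, and `y` is where the kernel `A p - W`
  -- changes sign in the gap, clamped to an endpoint if it does not. The value `0` for other `p` is
  -- never used.
  have hsucc : ∀ p : ℝ, ∃ s y : ℝ, p ∈ T → s ∈ S ∧ p < s ∧ (∀ x ∈ Ioo p s, x ∉ S) ∧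
      y ∈ Icc p s ∧ (∀ t ∈ Icc p s, t ≤ y → y ≠ p → W t ≤ A p) ∧
      (∀ t ∈ Icc p s, y ≤ t → y ≠ s → A p ≤ W t) ∧ (A p < W p → y = p) ∧
      (W s < A p → y = s) := by
    intro p
    by_cases hp : p ∈ T
    · have hpS := Finset.mem_of_mem_erase hp
      have hpm : p < m := lt_of_le_of_ne (hle p hpS) (Finset.ne_of_mem_erase hp)
      obtain ⟨s, hs, hsm⟩ := Finset.exists_min_image (S.filter (p < ·)) id
        ⟨m, Finset.mem_filter.2 ⟨hmS, hpm⟩⟩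
      rw [Finset.mem_filter] at hs
      have hsub : Icc p s ⊆ Icc 0 1 := Icc_subset_Icc (hS01 p hpS).1.le (hS01 s hs.1).2.le
      obtain ⟨y, hy, h1, h2, h3, h4⟩ := exists_crossing hs.2 (hmono.mono hsub) (hcont.mono hsub)
        (A p)
      exact ⟨s, y, fun _ => ⟨hs.1, hs.2, fun x hx hxS => absurd
        (hsm x (Finset.mem_filter.2 ⟨hxS, hx.1⟩)) (not_le.2 hx.2), hy, h1, h2, h3, h4⟩⟩
    · exact ⟨0, 0, fun h => absurd h hp⟩
  choose s y hsy using hsucc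
  -- Each gap contributes a zero at its left node and one at the crossing, so `q` follows the sign
  -- of the kernel; its degree is `2 (n - 1) + 1 = 2n - 1`.
  set q : ℝ[X] := (X - C m) * ∏ p ∈ T, ((X - C p) * (X - C (y p))) with hq
  have hprod0 : ∀ U : Finset ℝ, ∏ p ∈ U, ((X - C p) * (X - C (y p))) ≠ 0 := fun U =>
    Finset.prod_ne_zero_iff.2 fun p _ => mul_ne_zero (X_sub_C_ne_zero _) (X_sub_C_ne_zero _)
  have hq0 : q ≠ 0 := mul_ne_zero (X_sub_C_ne_zero m) (hprod0 T)
  have hcard : T.card + 1 = n := by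
    rw [hT, Finset.card_erase_add_one hmS, hS, card_unitNodes ha hb]
  have hqd : q.natDegree < 2 * n := by
    rw [hq, natDegree_mul (X_sub_C_ne_zero m) (hprod0 T), natDegree_X_sub_C,
      natDegree_prod _ _ fun p _ => mul_ne_zero (X_sub_C_ne_zero _) (X_sub_C_ne_zero _)]
    have : ∀ p ∈ T, ((X - C p) * (X - C (y p))).natDegree = 2 := fun p _ => by
      rw [natDegree_mul (X_sub_C_ne_zero _) (X_sub_C_ne_zero _), natDegree_X_sub_C,
        natDegree_X_sub_C]
    rw [Finset.sum_congr rfl this, Finset.sum_const, smul_eq_mul]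
    omega
  have hn : 0 < n := by omega
  have hA1 : A m = W 1 := by
    have : S.filter (fun z => z ≤ m) = S := Finset.filter_true_of_mem hle
    simp only [hA, this]
    exact (weightCdf_one ha hb hn).symm
  have hsign : ∀ t ∈ Ioo (0 : ℝ) 1, t ∉ S → 0 ≤ gaussKernel a b n t * q.eval t := by
    intro t ht htS
    have hev : q.eval t = (t - m) * ∏ p ∈ T, ((t - p) * (t - y p)) := by
      rw [hq, eval_mul, eval_prod]
      simp
    rw [hev]
    have hlow : ∀ p ∈ T, s p < t → 0 ≤ (t - p) * (t - y p) := by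
      intro p hp hpt
      obtain ⟨_, h2, _, h4, _⟩ := hsy p hp
      exact mul_nonneg (by linarith) (by linarith [h4.2])
    have hhigh : ∀ p ∈ T, t < p → 0 ≤ (t - p) * (t - y p) := by
      intro p hp hpt
      obtain ⟨_, _, _, h4, _⟩ := hsy p hp
      exact mul_nonneg_of_nonpos_of_nonpos (by linarith) (by linarith [h4.1])
    have hcase : ∀ p ∈ T, s p < t ∨ t < p ∨ t ∈ Ioo p (s p) := by
      intro p hp
      have hp' : t ≠ p := fun h => htS (h ▸ Finset.mem_of_mem_erase hp)
      have hs' : t ≠ s p := fun h => htS (h ▸ (hsy p hp).1)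
      rcases lt_or_gt_of_ne hp' with h | h
      · exact Or.inr (Or.inl h)
      rcases lt_or_gt_of_ne hs' with h' | h'
      · exact Or.inr (Or.inr ⟨h, h'⟩)
      · exact Or.inl h'
    rcases lt_or_gt_of_ne (show t ≠ m from fun h => htS (h ▸ hmS)) with htm | htm
    · by_cases hex : ∃ p ∈ T, t ∈ Ioo p (s p)
      · obtain ⟨p, hp, hpt⟩ := hex
        obtain ⟨h1, h2, h3, h4, h5, h6, -, -⟩ := hsy p hp
        have hK : gaussKernel a b n t = A p - W t := by
          unfold gaussKernel
          rw [filter_le_eq_of_gap h3 ⟨hpt.1.le, hpt.2⟩]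
        rw [← Finset.mul_prod_erase T _ hp]
        have hrest : 0 ≤ ∏ x ∈ T.erase p, ((t - x) * (t - y x)) := by
          refine Finset.prod_nonneg fun p' hp' => ?_
          have hp'T := Finset.mem_of_mem_erase hp'
          have hp'S := Finset.mem_of_mem_erase hp'T
          rcases hcase p' hp'T with h | h | h
          · exact hlow p' hp'T h
          · exact hhigh p' hp'T h
          · exfalso
            rcases lt_or_gt_of_ne (Finset.ne_of_mem_erase hp') with h' | h'
            · exact (hsy p' hp'T).2.2.1 p ⟨h', hpt.1.trans h.2⟩ (Finset.mem_of_mem_erase hp)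
            · exact h3 p' ⟨h', h.1.trans hpt.2⟩ hp'S
        -- In its own gap the quadratic factor has the sign opposite to the kernel; the negative
        -- factor `t - m` restores the sign.
        have hpair : (A p - W t) * ((t - p) * (t - y p)) ≤ 0 := by
          have htp : 0 < t - p := by linarith [hpt.1]
          rcases le_or_gt t (y p) with h | h
          · have := h5 t ⟨hpt.1.le, hpt.2.le⟩ h (by linarith [hpt.1])
            exact mul_nonpos_of_nonneg_of_nonpos (by linarith)
              (mul_nonpos_of_nonneg_of_nonpos htp.le (by linarith))
          · have := h6 t ⟨hpt.1.le, hpt.2.le⟩ h.le (by linarith [hpt.2])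
            exact mul_nonpos_of_nonpos_of_nonneg (by linarith)
              (mul_nonneg htp.le (by linarith))
        rw [hK]
        have e : (A p - W t) * ((t - m) * ((t - p) * (t - y p)
            * ∏ x ∈ T.erase p, ((t - x) * (t - y x))))
            = ((t - m) * ((A p - W t) * ((t - p) * (t - y p))))
              * ∏ x ∈ T.erase p, ((t - x) * (t - y x)) := by ring
        rw [e]
        exact mul_nonneg (mul_nonneg_of_nonpos_of_nonpos (by linarith) hpair) hrest
      · have hall : ∀ z ∈ S, ¬ z ≤ t := by
          intro z hz hzt
          obtain ⟨p, hp, hpm⟩ := Finset.exists_max_image (S.filter (· ≤ t)) id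
            ⟨z, Finset.mem_filter.2 ⟨hz, hzt⟩⟩
          rw [Finset.mem_filter] at hp
          have hpT : p ∈ T := Finset.mem_erase.2 ⟨by linarith [hp.2], hp.1⟩
          obtain ⟨h1, h2, _⟩ := hsy p hpT
          refine hex ⟨p, hpT, lt_of_le_of_ne hp.2 fun h => htS (h ▸ hp.1), ?_⟩
          by_contra hst
          exact absurd (hpm (s p) (Finset.mem_filter.2 ⟨h1, not_lt.1 hst⟩)) (not_le.2 h2)
        have hK : gaussKernel a b n t = -W t := by
          unfold gaussKernel
          rw [Finset.filter_false_of_mem hall]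
          simp [hW]
        have hWt : 0 ≤ W t := by
          have := hmono.monotoneOn ⟨le_rfl, zero_le_one⟩ ⟨ht.1.le, ht.2.le⟩ ht.1.le
          rwa [weightCdf_zero] at this
        have hp0 : 0 ≤ ∏ p ∈ T, ((t - p) * (t - y p)) := Finset.prod_nonneg fun p hp =>
          hhigh p hp (not_le.1 (hall p (Finset.mem_of_mem_erase hp)))
        rw [hK]
        exact mul_nonneg_of_nonpos_of_nonpos (by linarith)
          (mul_nonpos_of_nonpos_of_nonneg (by linarith) hp0)
    · have hK : gaussKernel a b n t = W 1 - W t := by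
        have : S.filter (fun z => z ≤ t) = S :=
          Finset.filter_true_of_mem fun z hz => (hle z hz).trans htm.le
        unfold gaussKernel
        rw [this, ← weightCdf_one ha hb hn]
      have hWt : W t ≤ W 1 :=
        hmono.monotoneOn ⟨ht.1.le, ht.2.le⟩ ⟨zero_le_one, le_rfl⟩ ht.2.le
      rw [hK]
      refine mul_nonneg (by linarith) (mul_nonneg (by linarith) (Finset.prod_nonneg fun p hp => ?_))
      exact hlow p hp ((hle _ (hsy p hp).1).trans_lt htm)
  have hnd := not_sq_dvd_of_gaussKernel_mul_nonneg ha hb hq0 hqd hsign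
  have hcT : c ∈ T := Finset.mem_erase.2 ⟨(hcd.trans_le (hle d hd)).ne, hc⟩
  obtain ⟨h1, h2, h3, h4, -, -, h7, h8⟩ := hsy c hcT
  have hsd : s c = d := by
    rcases lt_trichotomy (s c) d with h | h | h
    · exact absurd h1 (hgap _ ⟨h2, h⟩)
    · exact h
    · exact absurd hd (h3 _ ⟨hcd, h⟩)
  constructor
  · by_contra! h
    -- If the first inequality fails, the crossing is clamped to `c`, and `X - c` occurs twice.
    refine hnd c ?_
    rw [hq, ← Finset.mul_prod_erase T _ hcT, h7 h]
    exact ⟨(X - C m) * ∏ x ∈ T.erase c, (X - C x) * (X - C (y x)), by ring⟩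
  · by_contra! h
    rw [← hsd] at h
    -- If the second fails, the crossing is clamped to `d`. The other factor `X - d` is `X - m` when
    -- `d` is the last node, and otherwise comes from the gap starting at `d`.
    refine hnd d ?_
    rw [hq, ← Finset.mul_prod_erase T _ hcT, h8 h, hsd]
    rcases eq_or_ne d m with hdm | hdm
    · rw [← hdm]
      exact ⟨(X - C c) * ∏ x ∈ T.erase c, (X - C x) * (X - C (y x)), by ring⟩
    · have hdT : d ∈ T.erase c := Finset.mem_erase.2 ⟨hcd.ne', Finset.mem_erase.2 ⟨hdm, hd⟩⟩
      rw [← Finset.mul_prod_erase _ _ hdT]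
      exact ⟨(X - C m) * (X - C c) * (X - C (y d))
        * ∏ x ∈ (T.erase c).erase d, (X - C x) * (X - C (y x)), by ring⟩

/-- The Peano kernel is bounded by the mass of the gap. -/
theorem abs_gaussKernel_le {a b : ℝ} (ha : -1 < a) (hb : -1 < b) {n : ℕ} (hn : 0 < n)
    {c d y : ℝ} (hc0 : 0 ≤ c) (hd1 : d ≤ 1) (hc : c ∈ unitNodes a b n ∨ c = 0)
    (hd : d ∈ unitNodes a b n ∨ d = 1) (hgap : ∀ x ∈ Ioo c d, x ∉ unitNodes a b n)
    (hy : y ∈ Ioo c d) :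
    |gaussKernel a b n y| ≤ ∫ x in Ioo c d, jacobiWeight a b x := by
  have hcd := hy.1.trans hy.2
  have hmono := (weightCdf_strictMonoOn ha hb).monotoneOn
  have hcI : c ∈ Icc (0 : ℝ) 1 := ⟨hc0, by linarith⟩
  have hdI : d ∈ Icc (0 : ℝ) 1 := ⟨by linarith, hd1⟩
  have hyI : y ∈ Icc (0 : ℝ) 1 := ⟨by linarith [hy.1], by linarith [hy.2]⟩
  have w1 := hmono hcI hyI hy.1.le
  have w2 := hmono hyI hdI hy.2.le
  have w3 := hmono ⟨le_rfl, zero_le_one⟩ hdI hdI.1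
  have w4 := hmono hcI ⟨zero_le_one, le_rfl⟩ hcI.2
  rw [weightCdf_zero] at w3
  rw [← weightCdf_sub ha hb hc0 hcd.le hd1]
  unfold gaussKernel
  rw [filter_le_eq_of_gap hgap ⟨hy.1.le, hy.2⟩]
  have hfull : d = 1 → (unitNodes a b n).filter (fun z => z ≤ c) = unitNodes a b n := by
    rintro rfl
    refine Finset.filter_true_of_mem fun z hz => ?_
    by_contra h
    exact hgap z ⟨not_le.1 h, ((mem_unitNodes ha hb).1 hz).1.2⟩ hz
  have hempty : c = 0 → (unitNodes a b n).filter (fun z => z ≤ c) = ∅ := by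
    rintro rfl
    exact Finset.filter_false_of_mem fun z hz => not_le.2 ((mem_unitNodes ha hb).1 hz).1.1
  -- In a gap next to `0` or `1` the sum is empty or full, and the inequalities are trivial. The
  -- bound follows as the sum and `weightCdf a b y` both lie between the values of `weightCdf` at
  -- `c` and `d`.
  have key : weightCdf a b c ≤ ∑ z ∈ unitNodes a b n with z ≤ c, gaussWeight a b n z ∧
      ∑ z ∈ unitNodes a b n with z ≤ c, gaussWeight a b n z ≤ weightCdf a b d := by
    rcases hc with hc | hc
    · rcases hd with hd | hd
      · exact chebyshev_markov_stieltjes ha hb hc hd hcd hgap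
      · rw [hfull hd, ← weightCdf_one ha hb hn, hd]
        exact ⟨w4, le_rfl⟩
    · rw [hempty hc, hc, weightCdf_zero, Finset.sum_empty]
      exact ⟨le_rfl, w3⟩
  rw [abs_le]
  constructor <;> linarith [key.1, key.2]

/-! ### Weighted Cauchy-Schwarz inequalities -/

theorem jacobiWeight_mul (a b c d : ℝ) {x : ℝ} (hx : x ∈ Ioo (0 : ℝ) 1) :
    jacobiWeight a b x * jacobiWeight c d x = jacobiWeight (a + c) (b + d) x := by
  unfold jacobiWeight
  rw [Real.rpow_add (by linarith [hx.2]), Real.rpow_add hx.1]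
  ring

theorem jacobiWeight_half_mul_sq (a b : ℝ) (f : ℝ → ℝ) {x : ℝ} (hx : x ∈ Ioo (0 : ℝ) 1) :
    (jacobiWeight (a / 2) (b / 2) x * f x) ^ 2 = jacobiWeight a b x * f x ^ 2 := by
  rw [mul_pow, sq (jacobiWeight _ _ _), jacobiWeight_mul _ _ _ _ hx, add_halves, add_halves]

theorem memLp_jacobiWeight_half_mul {a b : ℝ} {f : ℝ → ℝ} (hf : MemLp f 2 (jacobiMeasure a b)) :
    MemLp (fun x => jacobiWeight (a / 2) (b / 2) x * f x) 2 (volume.restrict (Ioo (0 : ℝ) 1)) := by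
  have hm := (aestronglyMeasurable_jacobiMeasure_iff _ _).1 hf.1
  refine (memLp_two_iff_integrable_sq
    ((measurable_jacobiWeight _ _).aestronglyMeasurable.mul hm)).2 ?_
  have h := (integrable_jacobiMeasure_iff _ _ _).1 hf.integrable_sq
  exact (integrableOn_congr_fun (fun x hx => jacobiWeight_half_mul_sq a b f hx)
    measurableSet_Ioo).2 h

theorem integral_jacobiWeight_half_mul_sq (a b : ℝ) (f : ℝ → ℝ) :
    ∫ x in Ioo (0 : ℝ) 1, (jacobiWeight (a / 2) (b / 2) x * f x) ^ 2
      = ∫ x, f x ^ 2 ∂(jacobiMeasure a b) := by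
  rw [integral_jacobiMeasure]
  exact setIntegral_congr_fun measurableSet_Ioo fun x hx => jacobiWeight_half_mul_sq a b f hx

/-- The weight with exponents `a + 1/2`, `b + 1/2` is the geometric mean of the weights for
functions and for derivatives, so this is Cauchy-Schwarz. -/
theorem integrable_jacobiWeight_mul_abs {a b : ℝ} {f g : ℝ → ℝ}
    (hf : MemLp f 2 (jacobiMeasure a b)) (hg : MemLp g 2 (jacobiMeasure (a + 1) (b + 1))) :
    IntegrableOn (fun x => jacobiWeight (a + 1 / 2) (b + 1 / 2) x * (|f x| * |g x|)) (Ioo 0 1) ∧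
      ∫ x in Ioo (0 : ℝ) 1, jacobiWeight (a + 1 / 2) (b + 1 / 2) x * (|f x| * |g x|)
        ≤ √(∫ x, f x ^ 2 ∂(jacobiMeasure a b)) * √(∫ x, g x ^ 2 ∂(jacobiMeasure (a + 1) (b + 1))) := by
  have m1 := memLp_jacobiWeight_half_mul hf.abs
  have m2 := memLp_jacobiWeight_half_mul hg.abs
  have e : ∀ x ∈ Ioo (0 : ℝ) 1, (jacobiWeight (a / 2) (b / 2) x * |f| x)
      * (jacobiWeight ((a + 1) / 2) ((b + 1) / 2) x * |g| x)
      = jacobiWeight (a + 1 / 2) (b + 1 / 2) x * (|f x| * |g x|) := by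
    intro x hx
    have := jacobiWeight_mul (a / 2) (b / 2) ((a + 1) / 2) ((b + 1) / 2) hx
    rw [show a / 2 + (a + 1) / 2 = a + 1 / 2 by ring,
      show b / 2 + (b + 1) / 2 = b + 1 / 2 by ring] at this
    rw [← this]
    simp only [Pi.abs_apply]
    ring
  constructor
  · exact (integrableOn_congr_fun e measurableSet_Ioo).1 (integrable_mul_of_memLp m1 m2)
  · have h := sq_integral_mul_le m1 m2
    rw [integral_jacobiWeight_half_mul_sq, integral_jacobiWeight_half_mul_sq,
      setIntegral_congr_fun measurableSet_Ioo e] at h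
    simp only [Pi.abs_apply, sq_abs] at h
    rw [← Real.sqrt_mul (integral_nonneg fun x => sq_nonneg _)]
    exact Real.le_sqrt_of_sq_le h

/-- Square integrable functions for the weight of exponents `a + 1, b + 1 < 1` are integrable, with
a bound on subintervals. -/
theorem integrableOn_of_memLp {a b : ℝ} (ha0 : a < 0) (hb0 : b < 0)
    {g : ℝ → ℝ} (hg : MemLp g 2 (jacobiMeasure (a + 1) (b + 1))) :
    IntegrableOn g (Ioo 0 1) ∧ ∀ c d, 0 ≤ c → d ≤ 1 →
      (∫ x in Ioo c d, |g x|) ^ 2 ≤ (∫ x, g x ^ 2 ∂(jacobiMeasure (a + 1) (b + 1)))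
        * ∫ x in Ioo c d, jacobiWeight (-(a + 1)) (-(b + 1)) x := by
  have m2 := memLp_jacobiWeight_half_mul hg.abs
  have e0 : ∀ x ∈ Ioo (0 : ℝ) 1, jacobiWeight (-(a + 1) / 2) (-(b + 1) / 2) x ^ 2
      = jacobiWeight (-(a + 1)) (-(b + 1)) x := by
    intro x hx
    rw [sq, jacobiWeight_mul _ _ _ _ hx, add_halves, add_halves]
  -- `|g|` is split as `w^(-1/2)` times `w^(1/2) |g|`, with `w` of exponents `a + 1`, `b + 1`;
  -- `w^(-1)` is integrable because `a, b < 0`.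
  have m1 : MemLp (jacobiWeight (-(a + 1) / 2) (-(b + 1) / 2)) 2
      (volume.restrict (Ioo (0 : ℝ) 1)) := by
    rw [memLp_two_iff_integrable_sq (measurable_jacobiWeight _ _).aestronglyMeasurable]
    exact (integrableOn_congr_fun e0 measurableSet_Ioo).2
      (integrableOn_jacobiWeight (by linarith) (by linarith))
  have e : ∀ x ∈ Ioo (0 : ℝ) 1, jacobiWeight (-(a + 1) / 2) (-(b + 1) / 2) x
      * (jacobiWeight ((a + 1) / 2) ((b + 1) / 2) x * |g| x) = |g x| := by
    intro x hx
    have := jacobiWeight_mul (-(a + 1) / 2) (-(b + 1) / 2) ((a + 1) / 2) ((b + 1) / 2) hx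
    rw [show -(a + 1) / 2 + (a + 1) / 2 = 0 by ring,
      show -(b + 1) / 2 + (b + 1) / 2 = 0 by ring] at this
    rw [← mul_assoc, this]
    simp [jacobiWeight]
  have hm := (aestronglyMeasurable_jacobiMeasure_iff _ _).1 hg.1
  refine ⟨?_, fun c d hc hd => ?_⟩
  · have := (integrableOn_congr_fun e measurableSet_Ioo).1 (integrable_mul_of_memLp m1 m2)
    exact (integrable_norm_iff hm).1 this
  · have hsub : Ioo c d ⊆ Ioo 0 1 := Ioo_subset_Ioo hc hd
    have hle : volume.restrict (Ioo c d) ≤ volume.restrict (Ioo (0 : ℝ) 1) :=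
      Measure.restrict_mono hsub le_rfl
    have h := sq_integral_mul_le (m1.mono_measure hle) (m2.mono_measure hle)
    rw [setIntegral_congr_fun measurableSet_Ioo fun x hx => e x (hsub hx),
      setIntegral_congr_fun measurableSet_Ioo fun x hx => e0 x (hsub hx)] at h
    refine h.trans ?_
    rw [mul_comm]
    refine mul_le_mul_of_nonneg_right ?_ (setIntegral_nonneg measurableSet_Ioo fun x hx =>
      (jacobiWeight_pos _ _ (hsub hx)).le)
    have h2 := integral_jacobiWeight_half_mul_sq (a + 1) (b + 1) |g|
    simp only [Pi.abs_apply, sq_abs] at h2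
    rw [← h2]
    exact setIntegral_mono_set m2.integrable_sq (Eventually.of_forall fun x => sq_nonneg _)
      hsub.eventuallyLE

/-- Functions with a weak derivative in the weighted space are absolutely continuous. -/
theorem exists_hasL1Deriv {a b : ℝ} (ha : -1 < a) (ha0 : a < 0) (hb : -1 < b) (hb0 : b < 0)
    {g g1 : ℝ → ℝ} (hg : MemLp g 2 (jacobiMeasure a b))
    (hg1 : MemLp g1 2 (jacobiMeasure (a + 1) (b + 1))) (hw : IsWeakDeriv 1 g g1) :
    ∃ H : ℝ → ℝ, Continuous H ∧ HasL1Deriv H g1 ∧ g =ᵐ[volume.restrict (Ioo 0 1)] H := by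
  have := isFiniteMeasure_jacobiMeasure ha hb
  have hi : IntervalIntegrable g1 volume 0 1 :=
    (intervalIntegrable_iff_integrableOn_Ioo_of_le zero_le_one).2
      (integrableOn_of_memLp ha0 hb0 hg1).1
  set P : ℝ → ℝ := fun x => ∫ t in 0..x, g1 t with hP
  have hH : HasL1Deriv P g1 := ⟨hi, fun x _ => by simp [hP]⟩
  obtain ⟨B, hB⟩ := isCompact_Icc.exists_bound_of_continuousOn hH.continuousOn
  have hPm : MemLp P 2 (jacobiMeasure a b) := by
    refine MemLp.of_bound ((aestronglyMeasurable_jacobiMeasure_iff _ _).2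
      ((hH.continuousOn.mono Ioo_subset_Icc_self).aestronglyMeasurable measurableSet_Ioo)) B ?_
    filter_upwards [ae_jacobiMeasure_mem a b] with x hx
    exact hB x (Ioo_subset_Icc_self hx)
  -- `g - P`, minus its mean `p`, has zero weak derivative and is orthogonal to constants; the
  -- Poincaré inequality with the positive eigenvalue of index `1` forces it to vanish.
  obtain ⟨p, hpd, hpo⟩ := exists_projection ha hb (hg.sub hPm) 1
  have hp : p = C (p.coeff 0) := eq_C_of_degree_le_zero 
    (Nat.WithBot.lt_one_iff_le_zero.1 (by simpa using hpd))
  have hwk := (hw.sub hH.isWeakDeriv).sub (isWeakDeriv_eval p)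
  have h0 : ∀ x, g1 x - g1 x - (derivative p).eval x = 0 := fun x => by
    rw [hp]
    simp
  simp only [h0] at hwk
  have h1 := eigenvalue_mul_integral_sq_le ha hb ((hg.sub hPm).sub (memLp_eval ha hb p))
    (MemLp.zero' : MemLp (fun _ : ℝ => (0 : ℝ)) 2 _) hwk hpo
  have hl : 0 < jacobiEigenvalue a b 1 := by
    have := jacobiEigenvalue_strictMono ha hb zero_lt_one
    simpa [jacobiEigenvalue] using this
  have h2 : ∫ x, (g - P - fun x => p.eval x) x ^ 2 ∂(jacobiMeasure a b) = 0 := by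
    refine le_antisymm ?_ (integral_nonneg fun x => sq_nonneg _)
    simp only [ne_eq, OfNat.ofNat_ne_zero, not_false_eq_true, zero_pow, integral_zero] at h1
    exact nonpos_of_mul_nonpos_right h1 hl
  rw [integral_eq_zero_iff_of_nonneg (fun x => sq_nonneg _)
    ((hg.sub hPm).sub (memLp_eval ha hb p)).integrable_sq] at h2
  have h3 := (ae_jacobiMeasure_iff a b).1 h2
  set H : ℝ → ℝ := IccExtend zero_le_one ((Icc (0 : ℝ) 1).domRestrict fun x => P x + p.coeff 0) with hHdef
  have hHP : ∀ x ∈ Icc (0 : ℝ) 1, H x = P x + p.coeff 0 := fun x hx => by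
    rw [hHdef, IccExtend_of_mem _ _ hx, domRestrict_apply]
  refine ⟨H, ?_, ⟨hi, fun x hx => ?_⟩, ?_⟩
  · exact Continuous.Icc_extend' (continuousOn_iff_continuous_domRestrict.1
      (hH.continuousOn.add continuousOn_const))
  · rw [hHP x hx, hHP 0 ⟨le_rfl, zero_le_one⟩, hH.eq_integral x hx]
    ring
  · filter_upwards [h3, ae_restrict_mem measurableSet_Ioo] with x hx hx1
    rw [hHP x (Ioo_subset_Icc_self hx1)]
    simp only [Pi.sub_apply, Pi.zero_apply, ne_eq, OfNat.ofNat_ne_zero, not_false_eq_true,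
      pow_eq_zero_iff] at hx
    rw [hp, eval_C] at hx
    linarith

/-! ### Stability of the interpolation -/

/-- The constant in the bound for the Peano kernel. -/
noncomputable def gapConst (a b : ℝ) : ℝ := 4 * (2 / (a + 1) + 2 / (b + 1))

theorem gapConst_pos {a b : ℝ} (ha : -1 < a) (hb : -1 < b) : 0 < gapConst a b :=
  mul_pos four_pos (add_pos (div_pos two_pos (by linarith)) (div_pos two_pos (by linarith)))

theorem unitJacobi_eval_ne_zero_of_gap {a b : ℝ} (ha : -1 < a) (hb : -1 < b) {n : ℕ} {c d : ℝ}
    (hc : 0 ≤ c) (hd : d ≤ 1) (hgap : ∀ x ∈ Ioo c d, x ∉ unitNodes a b n) :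
    ∀ x ∈ Ioo c d, (unitJacobi a b n).eval x ≠ 0 := fun x hx h0 =>
  hgap x hx ((mem_unitNodes ha hb).2 ⟨⟨hc.trans_lt hx.1, hx.2.trans_le hd⟩, h0⟩)

theorem mul_abs_gaussKernel_le {a b : ℝ} (ha : -1 < a) (ha' : a ≤ -1 / 2) (hb : -1 < b)
    (hb' : b ≤ -1 / 2) (N : ℕ) {y : ℝ} (hy : y ∈ Ioo (0 : ℝ) 1)
    (hyS : y ∉ unitNodes a b (N + 1)) :
    N * |gaussKernel a b (N + 1) y|
      ≤ gapConst a b * jacobiWeight (a + 1 / 2) (b + 1 / 2) y := by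
  obtain ⟨c, d, hc0, hd1, hycd, hgap, hc, hd⟩ := exists_gap hy hyS
  refine (mul_le_mul_of_nonneg_left (abs_gaussKernel_le ha hb N.succ_pos hc0 hd1 hc hd hgap hycd)
    (Nat.cast_nonneg N)).trans ?_
  exact mul_integral_gap_le_jacobiWeight ha ha' hb hb' hc0 hd1 hycd
    (unitJacobi_eval_ne_zero_of_gap ha hb hc0 hd1 hgap)

/-- The Peano kernel representation of the error, followed by the pointwise kernel bound and
Cauchy-Schwarz on both terms of `(e q)'`. -/
theorem quadrature_error_le {a b : ℝ} (ha : -1 < a) (ha' : a ≤ -1 / 2) (hb : -1 < b)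
    (hb' : b ≤ -1 / 2) (N : ℕ) {e e1 : ℝ → ℝ} (he : HasL1Deriv e e1)
    (hem : MemLp e 2 (jacobiMeasure a b)) (hem1 : MemLp e1 2 (jacobiMeasure (a + 1) (b + 1)))
    (q : ℝ[X]) :
    N * |∑ z ∈ unitNodes a b (N + 1), gaussWeight a b (N + 1) z * (e z * q.eval z)
        - ∫ x, e x * q.eval x ∂(jacobiMeasure a b)|
      ≤ gapConst a b *
        (√(∫ x, q.eval x ^ 2 ∂(jacobiMeasure a b)) * √(∫ x, e1 x ^ 2 ∂(jacobiMeasure (a + 1) (b + 1)))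
        + √(∫ x, e x ^ 2 ∂(jacobiMeasure a b))
          * √(∫ x, (derivative q).eval x ^ 2 ∂(jacobiMeasure (a + 1) (b + 1)))) := by
  have hF := he.mul (hasL1Deriv_eval q)
  rw [quadrature_sub_integral ha hb N.succ_pos hF, abs_neg,
    intervalIntegral.integral_of_le zero_le_one, integral_Ioc_eq_integral_Ioo]
  obtain ⟨i1, l1⟩ := integrable_jacobiWeight_mul_abs (memLp_eval ha hb q) hem1
  obtain ⟨i2, l2⟩ := integrable_jacobiWeight_mul_abs hem
    (memLp_eval (a := a + 1) (b := b + 1) (by linarith) (by linarith) (derivative q))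
  have hne : ∀ᵐ y ∂(volume.restrict (Ioo (0 : ℝ) 1)), y ∉ unitNodes a b (N + 1) :=
    ae_restrict_of_ae (measure_eq_zero_iff_ae_notMem.1
      ((unitNodes a b (N + 1)).finite_toSet.measure_zero volume))
  have hC := gapConst_pos ha hb
  calc N * |∫ y in Ioo (0 : ℝ) 1, gaussKernel a b (N + 1) y
          * (e1 y * q.eval y + e y * (derivative q).eval y)|
      ≤ N * ∫ y in Ioo (0 : ℝ) 1, |gaussKernel a b (N + 1) y
          * (e1 y * q.eval y + e y * (derivative q).eval y)| := by
        gcongr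
        exact abs_integral_le_integral_abs
    _ = ∫ y in Ioo (0 : ℝ) 1, N * |gaussKernel a b (N + 1) y
          * (e1 y * q.eval y + e y * (derivative q).eval y)| := by rw [integral_const_mul]
    _ ≤ ∫ y in Ioo (0 : ℝ) 1, gapConst a b *
          (jacobiWeight (a + 1 / 2) (b + 1 / 2) y * (|q.eval y| * |e1 y|)
          + jacobiWeight (a + 1 / 2) (b + 1 / 2) y * (|e y| * |(derivative q).eval y|)) := by
        refine integral_mono_ae ?_ ((i1.add i2).const_mul _) ?_
        · exact ((intervalIntegrable_iff_integrableOn_Ioo_of_le zero_le_one).1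
            (intervalIntegrable_gaussKernel_mul ha hb (N + 1) hF.integrable)).abs.const_mul _
        · filter_upwards [hne, ae_restrict_mem measurableSet_Ioo] with y hy hy1
          have h1 := mul_abs_gaussKernel_le ha ha' hb hb' N hy1 hy
          have h2 : |e1 y * q.eval y + e y * (derivative q).eval y|
              ≤ |q.eval y| * |e1 y| + |e y| * |(derivative q).eval y| := by
            refine (abs_add_le _ _).trans ?_
            rw [abs_mul, abs_mul, mul_comm |e1 y|]
          have hw := (jacobiWeight_pos (a + 1 / 2) (b + 1 / 2) hy1).le
          rw [abs_mul, ← mul_assoc]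
          refine (mul_le_mul h1 h2 (abs_nonneg _) (by positivity)).trans_eq ?_
          ring
    _ = gapConst a b *
          ((∫ y in Ioo (0 : ℝ) 1, jacobiWeight (a + 1 / 2) (b + 1 / 2) y * (|q.eval y| * |e1 y|))
          + ∫ y in Ioo (0 : ℝ) 1,
            jacobiWeight (a + 1 / 2) (b + 1 / 2) y * (|e y| * |(derivative q).eval y|)) := by
        rw [integral_const_mul, integral_add i1 i2]
    _ ≤ _ := by gcongr

theorem jacobiEigenvalue_le_sq {a b : ℝ} (ha' : a ≤ -1 / 2) (hb' : b ≤ -1 / 2) (N : ℕ) :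
    jacobiEigenvalue a b N ≤ (N : ℝ) ^ 2 := by
  unfold jacobiEigenvalue
  have : (0 : ℝ) ≤ N := Nat.cast_nonneg N
  nlinarith

/-- Stability of the interpolation of functions orthogonal to polynomials. -/
theorem interpolant_stable {a b : ℝ} (ha : -1 < a) (ha' : a ≤ -1 / 2) (hb : -1 < b)
    (hb' : b ≤ -1 / 2) (N : ℕ) {e e1 : ℝ → ℝ} (he : HasL1Deriv e e1)
    (hem : MemLp e 2 (jacobiMeasure a b)) (hem1 : MemLp e1 2 (jacobiMeasure (a + 1) (b + 1)))
    (ho : ∀ q : ℝ[X], q.degree < (N + 1 : ℕ) → ∫ x, e x * q.eval x ∂(jacobiMeasure a b) = 0)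
    {q : ℝ[X]} (hq : q.degree < (N + 1 : ℕ)) (hqe : ∀ z ∈ unitNodes a b (N + 1), q.eval z = e z) :
    N * √(∫ x, q.eval x ^ 2 ∂(jacobiMeasure a b))
      ≤ 2 * gapConst a b * √(∫ x, e1 x ^ 2 ∂(jacobiMeasure (a + 1) (b + 1))) := by
  have hC := gapConst_pos ha hb
  have h1 := quadrature_error_le ha ha' hb hb' N he hem hem1 q
  rw [ho q hq, sub_zero] at h1
  -- At the nodes `e q = q^2`, and `q^2` has degree at most `2N`, within the exactness of the
  -- quadrature.
  have h2 : ∑ z ∈ unitNodes a b (N + 1), gaussWeight a b (N + 1) z * (e z * q.eval z)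
      = ∫ x, q.eval x ^ 2 ∂(jacobiMeasure a b) := by
    have hd : (q ^ 2).degree < (2 * (N + 1) : ℕ) := by
      rcases eq_or_ne q 0 with rfl | hq0
      · simp only [ne_eq, OfNat.ofNat_ne_zero, not_false_eq_true, zero_pow, degree_zero]
        exact WithBot.bot_lt_coe _
      · rw [degree_pow, degree_eq_natDegree hq0, nsmul_eq_mul]
        rw [degree_eq_natDegree hq0] at hq
        have : q.natDegree < N + 1 := by exact_mod_cast hq
        exact_mod_cast (by omega : 2 * q.natDegree < 2 * (N + 1))
    have := gauss_quadrature ha hb hd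
    simp only [eval_pow] at this
    rw [this]
    refine Finset.sum_congr rfl fun z hz => ?_
    rw [← hqe z hz, sq]
  rw [h2] at h1
  set Q := ∫ x, q.eval x ^ 2 ∂(jacobiMeasure a b) with hQ
  set E := ∫ x, e x ^ 2 ∂(jacobiMeasure a b) with hE
  set E1 := ∫ x, e1 x ^ 2 ∂(jacobiMeasure (a + 1) (b + 1)) with hE1
  have hQ0 : 0 ≤ Q := integral_nonneg fun x => sq_nonneg _
  have hE0 : 0 ≤ E := integral_nonneg fun x => sq_nonneg _
  have hN0 : (0 : ℝ) ≤ N := Nat.cast_nonneg N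
  -- Bernstein for `q` here and Poincaré for `e` in `h4`: the factor `N` gained by one pays for the
  -- other.
  have h3 : √(∫ x, (derivative q).eval x ^ 2 ∂(jacobiMeasure (a + 1) (b + 1))) ≤ N * √Q := by
    rw [← Real.sqrt_sq hN0, ← Real.sqrt_mul (sq_nonneg _)]
    exact Real.sqrt_le_sqrt ((integral_derivative_sq_le ha hb hq).trans
      (mul_le_mul_of_nonneg_right (jacobiEigenvalue_le_sq ha' hb' N) hQ0))
  have h4 : N * √E ≤ √E1 := by
    rw [← Real.sqrt_sq hN0, ← Real.sqrt_mul (sq_nonneg _)]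
    exact Real.sqrt_le_sqrt ((mul_le_mul_of_nonneg_right (sq_le_jacobiEigenvalue ha hb N) hE0).trans
      (eigenvalue_mul_integral_sq_le ha hb hem hem1 he.isWeakDeriv ho))
  rw [abs_of_nonneg hQ0] at h1
  rcases hQ0.eq_or_lt with h | h
  · rw [← h, Real.sqrt_zero, mul_zero]
    positivity
  · have hs : 0 < √Q := Real.sqrt_pos.2 h
    have h5 : √E * √(∫ x, (derivative q).eval x ^ 2 ∂(jacobiMeasure (a + 1) (b + 1)))
        ≤ √Q * √E1 := by
      calc _ ≤ √E * (N * √Q) := by gcongr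
        _ = √Q * (N * √E) := by ring
        _ ≤ √Q * √E1 := by gcongr
    have h6 : (N * √Q) * √Q ≤ (2 * gapConst a b * √E1) * √Q := by
      have h7 : √Q * √Q = Q := Real.mul_self_sqrt hQ0
      calc (N * √Q) * √Q = N * Q := by rw [mul_assoc, h7]
        _ ≤ _ := h1
        _ ≤ gapConst a b * (√Q * √E1 + √Q * √E1) := by gcongr
        _ = _ := by ring
    exact le_of_mul_le_mul_right h6 hs

/-! ### Approximation by the orthogonal projection -/

theorem degree_iterate_derivative_lt {p : ℝ[X]} {M : ℕ} (hp : p.degree < M) (k : ℕ) :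
    (derivative^[k] p).degree < (M - k : ℕ) := by
  rw [degree_lt_iff_coeff_zero] at hp ⊢
  intro m hm
  rw [coeff_iterate_derivative, hp (m + k) (by omega), smul_zero]

/-- The orthogonality relations pass to the derivatives. -/
theorem orthogonal_derivative {a b : ℝ} (ha : -1 < a) (hb : -1 < b) {h h1 : ℝ → ℝ}
    (hh : MemLp h 2 (jacobiMeasure a b)) (hh1 : MemLp h1 2 (jacobiMeasure (a + 1) (b + 1)))
    (hw : IsWeakDeriv 1 h h1) {M : ℕ}
    (ho : ∀ q : ℝ[X], q.degree < M → ∫ x, h x * q.eval x ∂(jacobiMeasure a b) = 0)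
    {q : ℝ[X]} (hq : q.degree < (M - 1 : ℕ)) :
    ∫ x, h1 x * q.eval x ∂(jacobiMeasure (a + 1) (b + 1)) = 0 := by
  rcases eq_or_ne q 0 with rfl | hq0
  · simp
  obtain ⟨Q, rfl, hQd⟩ := exists_derivative_eq q
  rw [degree_eq_natDegree hq0] at hq
  have h2 : (derivative Q).natDegree < M - 1 := by exact_mod_cast hq
  -- Writing `q = Q'` and integrating by parts leaves `h` against `jacobiOp a b Q`, whose degree is
  -- below `M`.
  rw [integral_weakDeriv_mul_derivative ha hb hh hh1 hw, ho, neg_zero]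
  refine degree_jacobiOp_lt ha hb (degree_le_natDegree.trans_lt ?_)
  exact_mod_cast (by omega : Q.natDegree < M)

/-- With `m = N + 1 - k`, the eigenvalue is `m (m + a + b + 2k + 1)`. The second factor is at least
`N` since `k ≥ 1`; the first may be as small as `1`, but `N ≤ s m` because `k < s` and `m ≥ 1`. -/
theorem jacobiEigenvalue_shift_ge {a b : ℝ} (ha : -1 < a) (hb : -1 < b) {N s k : ℕ} (hk : 1 ≤ k)
    (hks : k < s) (hs : s ≤ N + 1) :
    (N : ℝ) ^ 2 ≤ s * jacobiEigenvalue (a + k) (b + k) (N + 1 - k) := by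
  obtain ⟨m, hm⟩ : ∃ m, N + 1 = k + m := ⟨N + 1 - k, by omega⟩
  obtain ⟨j, hj⟩ : ∃ j, s = k + 1 + j := ⟨s - k - 1, by omega⟩
  obtain ⟨i, hi⟩ : ∃ i, m = j + 1 + i := ⟨m - j - 1, by omega⟩
  have h1 : N + 1 - k = m := by omega
  rw [h1]
  unfold jacobiEigenvalue
  have hN : (N : ℝ) = k + m - 1 := by
    have : (N : ℝ) + 1 = k + m := by exact_mod_cast hm
    linarith
  have hs' : (s : ℝ) = k + 1 + j := by exact_mod_cast hj
  have hm' : (m : ℝ) = j + 1 + i := by exact_mod_cast hi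
  have hk' : (1 : ℝ) ≤ k := by exact_mod_cast hk
  have hj0 : (0 : ℝ) ≤ j := Nat.cast_nonneg j
  have hi0 : (0 : ℝ) ≤ i := Nat.cast_nonneg i
  have hN0 : (0 : ℝ) ≤ N := Nat.cast_nonneg N
  have e1 : (N : ℝ) ≤ s * m := by
    rw [hN, hs', hm']
    nlinarith [mul_nonneg hj0 hi0, mul_nonneg hj0 hj0]
  have e2 : (N : ℝ) ≤ m + (a + k) + (b + k) + 1 := by
    rw [hN]
    linarith
  calc (N : ℝ) ^ 2 = N * N := sq _
    _ ≤ (s * m) * (m + (a + k) + (b + k) + 1) :=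
        mul_le_mul e1 e2 hN0 (hN0.trans e1)
    _ = _ := by ring

/-- The derivative of the projection error, for functions with `s` weak derivatives. -/
theorem integral_projection_error_le {a b : ℝ} (ha : -1 < a) (hb : -1 < b) {N s : ℕ}
    (hs1 : 1 ≤ s) (hs : s ≤ N + 1) {v : ℕ → ℝ → ℝ}
    (hv : ∀ k ≤ s, MemLp (v k) 2 (jacobiMeasure (a + k) (b + k)))
    (hvw : ∀ k < s, IsWeakDeriv 1 (v k) (v (k + 1))) {p : ℝ[X]} (hp : p.degree < (N + 1 : ℕ))
    (ho : ∀ q : ℝ[X], q.degree < (N + 1 : ℕ) →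
      ∫ x, (v 0 x - p.eval x) * q.eval x ∂(jacobiMeasure a b) = 0) :
    ((N : ℝ) ^ 2) ^ (s - 1) * ∫ x, (v 1 x - (derivative p).eval x) ^ 2 ∂(jacobiMeasure (a + 1) (b + 1))
      ≤ (s : ℝ) ^ (s - 1) * ∫ x, v s x ^ 2 ∂(jacobiMeasure (a + s) (b + s)) := by
  have hak : ∀ k : ℕ, -1 < a + k := fun k => by
    have : (0 : ℝ) ≤ k := Nat.cast_nonneg k
    linarith
  have hbk : ∀ k : ℕ, -1 < b + k := fun k => by
    have : (0 : ℝ) ≤ k := Nat.cast_nonneg k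
    linarith
  set e : ℕ → ℝ → ℝ := fun k x => v k x - (derivative^[k] p).eval x with he
  have hem : ∀ k ≤ s, MemLp (e k) 2 (jacobiMeasure (a + k) (b + k)) := fun k hk =>
    (hv k hk).sub (memLp_eval (hak k) (hbk k) _)
  have hem' : ∀ k < s, MemLp (e (k + 1)) 2 (jacobiMeasure (a + k + 1) (b + k + 1)) := by
    intro k hk
    have := hem (k + 1) hk
    push_cast at this
    rwa [← add_assoc, ← add_assoc] at this
  have hew : ∀ k < s, IsWeakDeriv 1 (e k) (e (k + 1)) := by
    intro k hk
    have := (hvw k hk).sub (isWeakDeriv_eval (derivative^[k] p))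
    simp only [← Function.iterate_succ_apply' derivative k p] at this
    exact this
  have heo : ∀ k ≤ s, ∀ q : ℝ[X], q.degree < (N + 1 - k : ℕ) →
      ∫ x, e k x * q.eval x ∂(jacobiMeasure (a + k) (b + k)) = 0 := by
    intro k
    induction k with
    | zero =>
      intro _ q hq
      simpa [he] using ho q hq
    | succ k ih =>
      intro hk q hq
      have := orthogonal_derivative (hak k) (hbk k) (hem k (by omega)) (hem' k hk) (hew k hk)
        (ih (by omega)) (q := q) (by rwa [Nat.sub_sub])
      push_cast
      rwa [← add_assoc, ← add_assoc]
  set E : ℕ → ℝ := fun k => ∫ x, e k x ^ 2 ∂(jacobiMeasure (a + k) (b + k)) with hE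
  have hE0 : ∀ k, 0 ≤ E k := fun k => integral_nonneg fun x => sq_nonneg _
  have hstep : ∀ k, 1 ≤ k → k < s → (N : ℝ) ^ 2 * E k ≤ s * E (k + 1) := by
    intro k hk1 hks
    have h1 := eigenvalue_mul_integral_sq_le (hak k) (hbk k) (hem k hks.le) (hem' k hks)
      (hew k hks) (heo k hks.le)
    have h2 := jacobiEigenvalue_shift_ge ha hb hk1 hks hs
    have h3 : E (k + 1) = ∫ x, e (k + 1) x ^ 2 ∂(jacobiMeasure (a + k + 1) (b + k + 1)) := by
      simp only [hE]
      push_cast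
      rw [← add_assoc, ← add_assoc]
    rw [h3]
    calc (N : ℝ) ^ 2 * E k ≤ (s * jacobiEigenvalue (a + k) (b + k) (N + 1 - k)) * E k :=
          mul_le_mul_of_nonneg_right h2 (hE0 k)
      _ = s * (jacobiEigenvalue (a + k) (b + k) (N + 1 - k) * E k) := by ring
      _ ≤ _ := mul_le_mul_of_nonneg_left h1 (Nat.cast_nonneg s)
  have hiter : ∀ j, j + 1 ≤ s → ((N : ℝ) ^ 2) ^ j * E 1 ≤ (s : ℝ) ^ j * E (j + 1) := by
    intro j
    induction j with
    | zero => intro _; simp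
    | succ j ih =>
      intro hj
      have h1 := ih (by omega)
      have h2 := hstep (j + 1) (by omega) (by omega)
      calc ((N : ℝ) ^ 2) ^ (j + 1) * E 1 = (N : ℝ) ^ 2 * (((N : ℝ) ^ 2) ^ j * E 1) := by ring
        _ ≤ (N : ℝ) ^ 2 * ((s : ℝ) ^ j * E (j + 1)) := by gcongr
        _ = (s : ℝ) ^ j * ((N : ℝ) ^ 2 * E (j + 1)) := by ring
        _ ≤ (s : ℝ) ^ j * (s * E (j + 1 + 1)) := by gcongr
        _ = _ := by ring
  have h1 := hiter (s - 1) (by omega)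
  rw [Nat.sub_add_cancel hs1] at h1
  -- The `s`-th derivative of `p` has degree below `N + 1 - s`, and `e s` is orthogonal to such
  -- polynomials, so Pythagoras removes it.
  have h2 : E s ≤ ∫ x, v s x ^ 2 ∂(jacobiMeasure (a + s) (b + s)) := by
    have := integral_sq_le_of_orthogonal (hak s) (hbk s) (hem s le_rfl) (heo s le_rfl)
      (p := -derivative^[s] p) (by
        rw [degree_neg]
        exact degree_iterate_derivative_lt hp s)
    simpa [he] using this
  have h3 : E 1 = ∫ x, (v 1 x - (derivative p).eval x) ^ 2 ∂(jacobiMeasure (a + 1) (b + 1)) := by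
    simp [hE, he]
  rw [← h3]
  exact h1.trans (mul_le_mul_of_nonneg_left h2 (by positivity))

/-! ### The interpolation error on the unit interval -/

/-- A function with a zero at every node is bounded by the norm of its derivative. -/
theorem sq_le_of_eq_zero_on_nodes {a b : ℝ} (ha : -1 < a) (ha' : a ≤ -1 / 2) (hb : -1 < b)
    (hb' : b ≤ -1 / 2) (N : ℕ) {r r1 : ℝ → ℝ} (hr : HasL1Deriv r r1)
    (hr1 : MemLp r1 2 (jacobiMeasure (a + 1) (b + 1)))
    (h0 : ∀ z ∈ unitNodes a b (N + 1), r z = 0) {x : ℝ} (hx : x ∈ Icc (0 : ℝ) 1) :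
    N * r x ^ 2 ≤ 32 * ∫ x, r1 x ^ 2 ∂(jacobiMeasure (a + 1) (b + 1)) := by
  set R := ∫ x, r1 x ^ 2 ∂(jacobiMeasure (a + 1) (b + 1)) with hR
  have hR0 : 0 ≤ R := integral_nonneg fun x => sq_nonneg _
  have hcl : closure (Ioo (0 : ℝ) 1) = Icc 0 1 := closure_Ioo zero_ne_one
  have hcont := hr.continuousOn
  refine le_on_closure (s := Ioo (0 : ℝ) 1) (f := fun x => N * r x ^ 2) (g := fun _ => 32 * R)
    (fun y hy => ?_) ?_ continuousOn_const (hcl ▸ hx)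
  swap
  · rw [hcl]
    exact continuousOn_const.mul (hcont.pow 2)
  by_cases hyS : y ∈ unitNodes a b (N + 1)
  · simp only [h0 y hyS]
    simpa using hR0
  obtain ⟨c, d, hc0, hd1, hycd, hgap, hc, hd⟩ := exists_gap hy hyS
  have hcd := hycd.1.trans hycd.2
  obtain ⟨hint, hcs⟩ := integrableOn_of_memLp (by linarith) (by linarith) hr1
  have hI : N * (∫ x in Ioo c d, |r1 x|) ^ 2 ≤ 32 * R := by
    have h1 := hcs c d hc0 hd1
    have h2 := mul_integral_gap_inv_le ha ha' hb hb' hc0 hd1 hcd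
      (unitJacobi_eval_ne_zero_of_gap ha hb hc0 hd1 hgap)
    calc N * (∫ x in Ioo c d, |r1 x|) ^ 2
        ≤ N * (R * ∫ x in Ioo c d, jacobiWeight (-(a + 1)) (-(b + 1)) x) := by gcongr
      _ = R * (N * ∫ x in Ioo c d, jacobiWeight (-(a + 1)) (-(b + 1)) x) := by ring
      _ ≤ R * 32 := by gcongr
      _ = _ := by ring
  refine le_trans ?_ hI
  have hsub : ∀ t ∈ Icc (0 : ℝ) 1, IntervalIntegrable r1 volume 0 t := by
    intro t ht
    refine hr.integrable.mono_set ?_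
    rw [uIcc_of_le ht.1, uIcc_of_le zero_le_one]
    exact Icc_subset_Icc_right ht.2
  have hdiff : ∀ t ∈ Icc (0 : ℝ) 1, ∀ u ∈ Icc (0 : ℝ) 1, c ≤ t → t ≤ u → u ≤ d →
      |r u - r t| ≤ ∫ x in Ioo c d, |r1 x| := by
    intro t ht u hu hct htu hud
    have h1 : r u - r t = ∫ x in t..u, r1 x := by
      rw [← intervalIntegral.integral_interval_sub_left (hsub u hu) (hsub t ht),
        hr.eq_integral u hu, hr.eq_integral t ht]
      ring
    rw [h1, intervalIntegral.integral_of_le htu, integral_Ioc_eq_integral_Ioo]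
    refine abs_integral_le_integral_abs.trans ?_
    exact setIntegral_mono_set (hint.mono_set (Ioo_subset_Ioo hc0 hd1)).abs
      (Eventually.of_forall fun x => abs_nonneg _) (Ioo_subset_Ioo hct hud).eventuallyLE
  have hyI := Ioo_subset_Icc_self hy
  -- At least one end of the gap is a node, as nodes exist; `r` is integrated from there.
  have hbound : |r y| ≤ ∫ x in Ioo c d, |r1 x| := by
    rcases hc with hc | hc
    · have := hdiff c ⟨hc0, by linarith⟩ y hyI le_rfl hycd.1.le hycd.2.le
      rwa [h0 c hc, sub_zero] at this
    rcases hd with hd | hd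
    · have := hdiff y hyI d ⟨by linarith, hd1⟩ hycd.1.le hycd.2.le le_rfl
      rwa [h0 d hd, zero_sub, abs_neg] at this
    exfalso
    have hcard := card_unitNodes ha hb (N + 1)
    obtain ⟨z, hz⟩ := Finset.card_pos.1 (hcard.symm ▸ N.succ_pos : 0 < (unitNodes a b (N + 1)).card)
    refine hgap z ?_ hz
    rw [hc, hd]
    exact ((mem_unitNodes ha hb).1 hz).1
  rw [← sq_abs]
  gcongr

/-- The error of the interpolation at the Jacobi nodes of the unit interval. -/
theorem interpolation_error_le {a b : ℝ} (ha : -1 < a) (ha' : a ≤ -1 / 2) (hb : -1 < b)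
    (hb' : b ≤ -1 / 2) {N s : ℕ} (hN : 1 ≤ N) (hs1 : 1 ≤ s) (hs : s ≤ N + 1) {v : ℕ → ℝ → ℝ}
    (hv : ∀ k ≤ s, MemLp (v k) 2 (jacobiMeasure (a + k) (b + k)))
    (hvw : ∀ k < s, IsWeakDeriv 1 (v k) (v (k + 1))) (hac : HasL1Deriv (v 0) (v 1))
    {x : ℝ} (hx : x ∈ Icc (0 : ℝ) 1) :
    |v 0 x - (Lagrange.interpolate (unitNodes a b (N + 1)) id (v 0)).eval x|
      ≤ √(32 * (2 + 8 * gapConst a b ^ 2) * (s : ℝ) ^ (s - 1)) * (N : ℝ) ^ (1 / 2 - (s : ℝ))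
        * √(∫ x, v s x ^ 2 ∂(jacobiMeasure (a + s) (b + s))) := by
  have hv0 : MemLp (v 0) 2 (jacobiMeasure a b) := by simpa using hv 0 (Nat.zero_le s)
  have hv1 : MemLp (v 1) 2 (jacobiMeasure (a + 1) (b + 1)) := by simpa using hv 1 hs1
  obtain ⟨p, hpd, hpo⟩ := exists_projection ha hb hv0 (N + 1)
  set I := Lagrange.interpolate (unitNodes a b (N + 1)) id (v 0) with hI
  have hId : I.degree < (N + 1 : ℕ) := by
    have := Lagrange.degree_interpolate_lt (s := unitNodes a b (N + 1)) (v 0) (injOn_id _)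
    rwa [card_unitNodes ha hb] at this
  have hIe : ∀ z ∈ unitNodes a b (N + 1), I.eval z = v 0 z := fun z hz =>
    Lagrange.eval_interpolate_at_node (v := id) (v 0) (injOn_id _) hz
  have hm1 : ∀ q : ℝ[X], MemLp (fun x => q.eval x) 2 (jacobiMeasure (a + 1) (b + 1)) := fun q =>
    memLp_eval (by linarith) (by linarith) q
  set E1 := ∫ x, (v 1 x - (derivative p).eval x) ^ 2 ∂(jacobiMeasure (a + 1) (b + 1)) with hE1
  set V := ∫ x, v s x ^ 2 ∂(jacobiMeasure (a + s) (b + s)) with hV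
  have hE10 : 0 ≤ E1 := integral_nonneg fun x => sq_nonneg _
  have hV0 : 0 ≤ V := integral_nonneg fun x => sq_nonneg _
  have hproj := integral_projection_error_le ha hb hs1 hs hv hvw hpd hpo
  have hqd : (I - p).degree < (N + 1 : ℕ) := (degree_sub_le _ _).trans_lt (max_lt hId hpd)
  -- Interpolation reproduces `p`, so `I - p` interpolates the projection error.
  have hstab := interpolant_stable ha ha' hb hb' N (hac.sub (hasL1Deriv_eval p))
    (hv0.sub (memLp_eval ha hb p)) (hv1.sub (hm1 _)) hpo hqd
    (fun z hz => by rw [eval_sub, hIe z hz])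
  rw [← hE1] at hstab
  set Q := ∫ x, (I - p).eval x ^ 2 ∂(jacobiMeasure a b) with hQ
  have hQ0 : 0 ≤ Q := integral_nonneg fun x => sq_nonneg _
  have hC := gapConst_pos ha hb
  have hNpos : (0 : ℝ) < N := by exact_mod_cast hN
  have hQ1 : ∫ x, (derivative (I - p)).eval x ^ 2 ∂(jacobiMeasure (a + 1) (b + 1))
      ≤ 4 * gapConst a b ^ 2 * E1 := by
    refine (integral_derivative_sq_le ha hb hqd).trans ?_
    calc jacobiEigenvalue a b N * Q ≤ (N : ℝ) ^ 2 * Q :=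
          mul_le_mul_of_nonneg_right (jacobiEigenvalue_le_sq ha' hb' N) hQ0
      _ = (N * √Q) ^ 2 := by rw [mul_pow, Real.sq_sqrt hQ0]
      _ ≤ (2 * gapConst a b * √E1) ^ 2 := by gcongr
      _ = 4 * gapConst a b ^ 2 * E1 := by
          rw [mul_pow, Real.sq_sqrt hE10]
          ring
  have hR : ∫ x, (v 1 x - (derivative I).eval x) ^ 2 ∂(jacobiMeasure (a + 1) (b + 1))
      ≤ (2 + 8 * gapConst a b ^ 2) * E1 := by
    have i1 := (hv1.sub (hm1 (derivative p))).integrable_sq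
    have i2 := (hm1 (derivative (I - p))).integrable_sq
    calc ∫ x, (v 1 x - (derivative I).eval x) ^ 2 ∂(jacobiMeasure (a + 1) (b + 1))
        ≤ ∫ x, (2 * (v 1 x - (derivative p).eval x) ^ 2 + 2 * (derivative (I - p)).eval x ^ 2)
            ∂(jacobiMeasure (a + 1) (b + 1)) := by
          refine integral_mono (hv1.sub (hm1 (derivative I))).integrable_sq
            ((i1.const_mul 2).add (i2.const_mul 2)) fun x => ?_
          simp only [derivative_sub, eval_sub]
          nlinarith [sq_nonneg ((v 1 x - (derivative p).eval x)
            + ((derivative I).eval x - (derivative p).eval x))]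
      _ = 2 * E1 + 2 * ∫ x, (derivative (I - p)).eval x ^ 2 ∂(jacobiMeasure (a + 1) (b + 1)) := by
          have := integral_add (i1.const_mul 2) (i2.const_mul 2)
          rw [integral_const_mul, integral_const_mul] at this
          exact this
      _ ≤ _ := by linarith
  have hsup := sq_le_of_eq_zero_on_nodes ha ha' hb hb' N (hac.sub (hasL1Deriv_eval I))
    (hv1.sub (hm1 (derivative I))) (fun z hz => by rw [hIe z hz, sub_self]) hx
  set K := 32 * (2 + 8 * gapConst a b ^ 2) with hK
  have hK0 : 0 < K := by positivity
  have hfin : ((N : ℝ) ^ 2) ^ (s - 1) * (N * (v 0 x - I.eval x) ^ 2)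
      ≤ K * (s : ℝ) ^ (s - 1) * V := by
    calc ((N : ℝ) ^ 2) ^ (s - 1) * (N * (v 0 x - I.eval x) ^ 2)
        ≤ ((N : ℝ) ^ 2) ^ (s - 1) * (32 * ((2 + 8 * gapConst a b ^ 2) * E1)) := by
          refine mul_le_mul_of_nonneg_left (hsup.trans ?_) (by positivity)
          exact mul_le_mul_of_nonneg_left hR (by norm_num)
      _ = K * (((N : ℝ) ^ 2) ^ (s - 1) * E1) := by
          rw [hK]
          ring
      _ ≤ K * ((s : ℝ) ^ (s - 1) * V) := mul_le_mul_of_nonneg_left hproj hK0.le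
      _ = _ := by ring
  -- The power of `N` collected on the left is `2 (s - 1) + 1 = 2s - 1`: the first part from the
  -- projection, the last unit from the passage to the sup norm.
  have hNpow : ((N : ℝ) ^ (1 / 2 - (s : ℝ))) ^ 2 * (((N : ℝ) ^ 2) ^ (s - 1) * N) = 1 := by
    rw [← pow_mul, ← pow_succ, show 2 * (s - 1) + 1 = 2 * s - 1 by omega, ← Real.rpow_natCast,
      ← Real.rpow_mul hNpos.le, ← Real.rpow_natCast, ← Real.rpow_add hNpos]
    have : (1 / 2 - (s : ℝ)) * ((2 : ℕ) : ℝ) + ((2 * s - 1 : ℕ) : ℝ) = 0 := by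
      rw [Nat.cast_sub (by omega)]
      push_cast
      ring
    rw [this, Real.rpow_zero]
  refine abs_le_of_sq_le_sq ?_ (by positivity)
  rw [mul_pow, mul_pow, Real.sq_sqrt (by positivity), Real.sq_sqrt hV0]
  calc (v 0 x - I.eval x) ^ 2
      = ((N : ℝ) ^ (1 / 2 - (s : ℝ))) ^ 2
          * (((N : ℝ) ^ 2) ^ (s - 1) * (N * (v 0 x - I.eval x) ^ 2)) := by
        linear_combination -(v 0 x - I.eval x) ^ 2 * hNpow
    _ ≤ ((N : ℝ) ^ (1 / 2 - (s : ℝ))) ^ 2 * (K * (s : ℝ) ^ (s - 1) * V) := by gcongr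
    _ = _ := by ring

/-! ### The change of variables -/

/-- The map `x ↦ 1 - (1 - x) ^ p` of the unit interval. -/
noncomputable def powMap (p x : ℝ) : ℝ := 1 - (1 - x) ^ p

theorem powMap_mem_Icc {p : ℝ} (hp : 0 < p) {x : ℝ} (hx : x ∈ Icc (0 : ℝ) 1) :
    powMap p x ∈ Icc (0 : ℝ) 1 := by
  have h1 : 0 ≤ 1 - x := by linarith [hx.2]
  have h2 := Real.rpow_nonneg h1 p
  have h3 := Real.rpow_le_one h1 (by linarith [hx.1]) hp.le
  constructor <;> unfold powMap <;> linarith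

theorem powMap_mem_Ioo {p : ℝ} (hp : 0 < p) {x : ℝ} (hx : x ∈ Ioo (0 : ℝ) 1) :
    powMap p x ∈ Ioo (0 : ℝ) 1 := by
  have h1 : 0 < 1 - x := by linarith [hx.2]
  have h2 := Real.rpow_pos_of_pos h1 p
  have h3 := Real.rpow_lt_one h1.le (by linarith [hx.1]) hp
  constructor <;> unfold powMap <;> linarith

theorem one_sub_powMap_rpow {p q : ℝ} (hpq : p * q = 1) {x : ℝ} (hx : x ≤ 1) :
    (1 - powMap p x) ^ q = 1 - x := by
  unfold powMap
  rw [sub_sub_cancel, ← Real.rpow_mul (by linarith), hpq, Real.rpow_one]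

theorem powMap_powMap {p q : ℝ} (hpq : p * q = 1) {x : ℝ} (hx : x ≤ 1) :
    powMap q (powMap p x) = x := by
  nth_rewrite 1 [powMap]
  rw [one_sub_powMap_rpow hpq hx, sub_sub_cancel]

theorem continuous_powMap {p : ℝ} (hp : 0 < p) : Continuous (powMap p) :=
  continuous_const.sub ((continuous_const.sub continuous_id).rpow_const fun _ => Or.inr hp.le)

/-- The inverse map is differentiable on `(0, 1)`, so it sends null sets to null sets. -/
theorem ae_comp_powMap {p : ℝ} (hp : 0 < p) {P : ℝ → Prop}
    (h : ∀ᵐ x ∂(volume.restrict (Ioo (0 : ℝ) 1)), P x) :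
    ∀ᵐ x ∂(volume.restrict (Ioo (0 : ℝ) 1)), P (powMap p x) := by
  rw [ae_restrict_iff' measurableSet_Ioo] at h ⊢
  have h0 : volume {x | ¬(x ∈ Ioo (0 : ℝ) 1 → P x)} = 0 := h
  have hp' : 0 < 1 / p := by positivity
  have hd : DifferentiableOn ℝ (powMap (1 / p)) {x | ¬(x ∈ Ioo (0 : ℝ) 1 → P x)} := by
    intro x hx
    simp only [mem_ofPred_eq, Classical.not_imp] at hx
    have h1 : (1 - x : ℝ) ≠ 0 := by linarith [hx.1.2]
    exact ((((hasDerivAt_id x).const_sub 1).rpow_const (Or.inl h1)).const_sub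
      1).differentiableAt.differentiableWithinAt
  have h1 := addHaar_image_eq_zero_of_differentiableOn_of_addHaar_eq_zero volume hd h0
  filter_upwards [measure_eq_zero_iff_ae_notMem.1 h1] with x hx hx1
  by_contra hP
  refine hx ⟨powMap p x, ?_, powMap_powMap (by field_simp) hx1.2.le⟩
  simp only [mem_ofPred_eq, Classical.not_imp]
  exact ⟨powMap_mem_Ioo hp hx1, hP⟩

/-- With `x = powMap rho t` one has `2 x - 1 = 1 - 2 (1 - t)^rho`. -/
theorem nodes_eq_image {mu ups rho : ℝ} (hmu : -1 < mu) (hups : -1 < ups) (hrho : 0 < rho)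
    (N : ℕ) : nodes mu ups rho N = powMap (1 / rho) '' (unitNodes mu ups (N + 1) : Set ℝ) := by
  have hrho' : 0 < 1 / rho := by positivity
  have hev : ∀ t, backwardFun mu ups rho (N + 1) t
      = (unitJacobi mu ups (N + 1)).eval (powMap rho t) := by
    intro t
    simp only [backwardFun, unitJacobi, powMap, eval_comp, eval_sub, eval_mul, eval_X, eval_one,
      eval_ofNat]
    congr 1
    ring
  ext t
  simp only [nodes, mem_ofPred_eq, mem_image, Finset.mem_coe, mem_unitNodes hmu hups, hev]
  constructor
  · rintro ⟨ht, h⟩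
    exact ⟨powMap rho t, ⟨powMap_mem_Ioo hrho ht, h⟩, powMap_powMap (by field_simp) ht.2.le⟩
  · rintro ⟨x, ⟨hx, h⟩, rfl⟩
    exact ⟨powMap_mem_Ioo hrho' hx, by rwa [powMap_powMap (by field_simp) hx.2.le]⟩

theorem interp_eq_eval {mu ups rho : ℝ} (hmu : -1 < mu) (hups : -1 < ups) (hrho : 0 < rho)
    (N : ℕ) (F : ℝ → ℝ) (t : ℝ) :
    interp mu ups rho N F t = (Lagrange.interpolate (unitNodes mu ups (N + 1)) id
      fun x => F (powMap (1 / rho) x)).eval (powMap rho t) := by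
  set S := unitNodes mu ups (N + 1) with hS
  have hS1 : ∀ x ∈ S, x ≤ 1 := fun x hx => ((mem_unitNodes hmu hups).1 hx).1.2.le
  have hone : 1 / rho * rho = 1 := by field_simp
  have hinj : InjOn (powMap (1 / rho)) (S : Set ℝ) := by
    intro x hx y hy hxy
    rw [← powMap_powMap hone (hS1 x hx), ← powMap_powMap hone (hS1 y hy), hxy]
  have hbasis : ∀ x ∈ S, lagrangeFun mu ups rho N (powMap (1 / rho) x) t
      = (Lagrange.basis S id x).eval (powMap rho t) := by
    intro x hx
    have hset : nodes mu ups rho N \ {powMap (1 / rho) x}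
        = powMap (1 / rho) '' ((S.erase x : Finset ℝ) : Set ℝ) := by
      rw [nodes_eq_image hmu hups hrho, Finset.coe_erase, hinj.image_sdiff_subset
        (singleton_subset_iff.2 hx), image_singleton]
    unfold lagrangeFun
    rw [hset, finprod_mem_image (hinj.mono (by simp)), finprod_mem_coe_finset, Lagrange.basis,
      eval_prod]
    refine Finset.prod_congr rfl fun z hz => ?_
    have hzS := Finset.mem_of_mem_erase hz
    -- Every `(1 - t)^rho` becomes `1 - x`, and the signs of numerator and denominator cancel.
    rw [one_sub_powMap_rpow hone (hS1 x hx), one_sub_powMap_rpow hone (hS1 z hzS)]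
    have hne : x - z ≠ 0 := sub_ne_zero.2 (Finset.ne_of_mem_erase hz).symm
    have hne' : 1 - x - (1 - z) ≠ 0 := fun h => hne (by linarith)
    simp only [Lagrange.basisDivisor, id, eval_mul, eval_C, eval_sub, eval_X, powMap]
    rw [inv_mul_eq_div, div_eq_div_iff hne' hne]
    ring
  unfold interp
  rw [nodes_eq_image hmu hups hrho, finsum_mem_image hinj, finsum_mem_coe_finset,
    Lagrange.interpolate_apply, eval_finsetSum]
  refine Finset.sum_congr rfl fun x hx => ?_
  rw [hbasis x hx, eval_mul, eval_C]

/-- Representatives of the weak derivatives of a function in the weighted Sobolev space. -/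
theorem exists_derivative_tower {mu ups : ℝ} (hmu : -1 < mu) (hmu0 : mu < 0) (hups : -1 < ups)
    (hups0 : ups < 0) {s : ℕ} (hs : 1 ≤ s) {g : ℝ → ℝ} (hg : MemB mu ups s g) :
    ∃ v : ℕ → ℝ → ℝ, Continuous (v 0) ∧ g =ᵐ[volume.restrict (Ioo 0 1)] v 0 ∧
      HasL1Deriv (v 0) (v 1) ∧
      (∀ k ≤ s, MemLp (v k) 2 (jacobiMeasure (mu + k) (ups + k))) ∧
      (∀ k < s, IsWeakDeriv 1 (v k) (v (k + 1))) ∧ IsWeakDeriv s g (v s) := by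
  have hex : ∀ k : ℕ, ∃ w : ℝ → ℝ, k ≤ s → IsWeakDeriv k g w ∧
      MemLp w 2 (jacobiMeasure (mu + k) (ups + k)) := by
    intro k
    by_cases hk : k ≤ s
    · obtain ⟨w, hw⟩ := hg k hk
      exact ⟨w, fun _ => hw⟩
    · exact ⟨0, fun h => absurd h hk⟩
  choose w hw using hex
  have hw0 := hw 0 (Nat.zero_le s)
  have hgae : w 0 =ᵐ[volume.restrict (Ioo 0 1)] g := hw0.1.ae_eq (isWeakDeriv_zero hw0.1.1)
  have hgm : MemLp g 2 (jacobiMeasure mu ups) := by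
    have h1 : MemLp (w 0) 2 (jacobiMeasure mu ups) := by simpa using hw0.2
    exact h1.ae_eq ((ae_jacobiMeasure_iff mu ups).2 hgae)
  have hw1 : MemLp (w 1) 2 (jacobiMeasure (mu + 1) (ups + 1)) := by simpa using (hw 1 hs).2
  obtain ⟨H, hHc, hH, hgH⟩ := exists_hasL1Deriv hmu hmu0 hups hups0 hgm hw1 (hw 1 hs).1
  -- Only level `0` is changed, to its continuous representative.
  refine ⟨fun k => if k = 0 then H else w k, by simpa using hHc, by simpa using hgH,
    by simpa using hH, fun k hk => ?_, fun k hk => ?_, ?_⟩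
  · rcases k with _ | k
    · simpa using hgm.ae_eq ((ae_jacobiMeasure_iff mu ups).2 hgH)
    · simpa using (hw (k + 1) hk).2
  · rcases k with _ | k
    · simpa using hH.isWeakDeriv
    · simpa using (hw (k + 1) hk.le).1.of_succ (hw (k + 2) hk).1
  · simpa [show s ≠ 0 by omega] using (hw s le_rfl).1

end BackwardJacobi

/-! ### Transfer of the error bound to `f` -/

theorem proposition2 (mu ups rho : ℝ) (hmu : -1 < mu) (hmu' : mu ≤ -1 / 2)
    (hups : -1 < ups) (hups' : ups ≤ -1 / 2) (hrho : 0 < rho) (hrho' : rho ≤ 1)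
    (s : ℕ) (hs : 1 ≤ s) :
    ∃ c : ℝ, 0 < c ∧ ∀ f : ℝ → ℝ,
      BackwardJacobi.MemB mu ups s (BackwardJacobi.pullback rho f) →
        (∃ F : ℝ → ℝ, BackwardJacobi.IsContRep f F) ∧
        ∀ F : ℝ → ℝ, BackwardJacobi.IsContRep f F →
        ∀ v : ℝ → ℝ, BackwardJacobi.IsWeakDeriv s (BackwardJacobi.pullback rho f) v →
        ∀ N : ℕ, 1 ≤ N → s ≤ N + 1 →
        ∀ t ∈ Icc (0 : ℝ) 1,
          |F t - BackwardJacobi.interp mu ups rho N F t|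
            ≤ c * (N : ℝ) ^ (1 / 2 - (s : ℝ))
              * BackwardJacobi.weightNorm (mu + s) (ups + s) 1 v := by
  open BackwardJacobi in
  have hC := gapConst_pos hmu hups
  have hs0 : (0 : ℝ) < s := by exact_mod_cast hs
  have hinv : 0 < 1 / rho := by positivity
  have hone : rho * (1 / rho) = 1 := by field_simp
  refine ⟨√(32 * (2 + 8 * gapConst mu ups ^ 2) * (s : ℝ) ^ (s - 1)), by positivity,
    fun f hf => ?_⟩
  obtain ⟨w, hwc, hgw, hac, hwm, hww, hws⟩ :=
    exists_derivative_tower hmu (by linarith) hups (by linarith) hs hf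
  have hres : volume.restrict (Icc (0 : ℝ) 1) = volume.restrict (Ioo (0 : ℝ) 1) :=
    (Measure.restrict_congr_set Ioo_ae_eq_Icc).symm
  refine ⟨⟨fun t => w 0 (powMap rho t), ?_, ?_⟩, ?_⟩
  · exact (hwc.comp (continuous_powMap hrho)).continuousOn
  · rw [hres]
    filter_upwards [ae_comp_powMap hrho hgw, ae_restrict_mem measurableSet_Ioo] with t ht ht1
    rw [← ht]
    exact congrArg f (powMap_powMap hone ht1.2.le)
  · rintro F ⟨hFc, hFf⟩ v hv N hN hsN t ht
    rw [hres] at hFf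
    have hae : (fun x => F (powMap (1 / rho) x)) =ᵐ[volume.restrict (Icc (0 : ℝ) 1)] w 0 := by
      rw [hres]
      filter_upwards [ae_comp_powMap hinv hFf, hgw] with x hx hx1
      rw [hx]
      exact hx1
    -- Two continuous functions that agree almost everywhere agree on all of `[0, 1]`. Equality
    -- everywhere is needed, since interpolation uses the values at the nodes.
    have heq : EqOn (fun x => F (powMap (1 / rho) x)) (w 0) (Icc 0 1) :=
      Measure.eqOn_Icc_of_ae_eq volume zero_ne_one hae
        (hFc.comp (continuous_powMap hinv).continuousOn fun x hx => powMap_mem_Icc hinv hx)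
        hwc.continuousOn
    have htI := powMap_mem_Icc hrho ht
    have hFt : F t = w 0 (powMap rho t) := by
      have := heq htI
      simp only at this
      rwa [powMap_powMap hone ht.2] at this
    have hinterp : interp mu ups rho N F t
        = (Lagrange.interpolate (unitNodes mu ups (N + 1)) id (w 0)).eval (powMap rho t) := by
      rw [interp_eq_eval hmu hups hrho]
      congr 1
      refine Lagrange.interpolate_eq_of_values_eq_on _ _ fun x hx => ?_
      exact heq (Ioo_subset_Icc_self ((mem_unitNodes hmu hups).1 hx).1)
    have hvw : v =ᵐ[jacobiMeasure (mu + s) (ups + s)] w s :=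
      (ae_jacobiMeasure_iff _ _).2 (hv.ae_eq hws)
    have hnorm : weightNorm (mu + s) (ups + s) 1 v
        = √(∫ x, w s x ^ 2 ∂(jacobiMeasure (mu + s) (ups + s))) := by
      rw [← weightNorm_sq (hwm s le_rfl)]
      unfold weightNorm
      rw [Real.sqrt_sq ENNReal.toReal_nonneg, eLpNorm_congr_ae hvw]
    rw [hFt, hinterp, hnorm]
    exact interpolation_error_le hmu hmu' hups hups' hN hs hsN hwm hww hac htI
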